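/- Let $K$ be an algebraic function field of one variable with full constant field $\mathbb F_q$, let $\infty$ be a place of $K$ of degree $\delta$, and let $A$ be the ring of elements of $K$ that are integral outside $\infty$. Let $K_\infty$ be the completion of $K$ at $\infty$, with valuation ring $\mathcal O_\infty$, let $C_\infty$ be the completion of an algebraic closure of $K_\infty$, and $\Omega=C_\infty\setminus K_\infty$. Let $G=GL_2(A)$ act on $\Omega$ by linear fractional transformations, and let $G_\omega$ be the stabilizer of $\omega\in\Omega$. An element $\omega\in\Omega$ is elliptic if $G_\omega$ contains a non-scalar matrix; $\mathrm{Ell}(G)\subseteq G\backslash\Omega$ is the set of $G$-orbits of elliptic elements (the elliptic points). Put $\widetilde K=\mathbb F_{q^2}K\subseteq C_\infty$. Let $\mathcal T$ be the Bruhat–Tits tree of $GL_2(K_\infty)$: its vertices are the homothety classes of $\mathcal O_\infty$-lattices of rank $2$ in the space $K_\infty\oplus K_\infty$ of row vectors, on which $g\in GL_2(K_\infty)$ acts by $x\mapsto xg^{-1}$. For a vertex $v$ let $G_v$ be its stabilizer in $G$ (a finite group) and $\widetilde v$ its image in $G\backslash\mathcal T$. For $\omega\in\Omega$ and a vertex $v$,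 write $\lambda(\omega)=v$ (building map) if the norm $(x_0,x_1)\mapsto|x_0\omega+x_1|$ on $K_\infty\oplus K_\infty$ is the norm $x\mapsto\min\{|a|: a\in K_\infty,\ x\in aL\}$ of a lattice $L$ in the class $v$. A point of $G\backslash\Omega$ lies over $\widetilde v$ if it is the orbit of some $\omega$ such that $\lambda(\omega)$ is a vertex in the $G$-orbit of $v$. **Theorem.** Suppose that $\delta$ is odd. Then every elliptic element lies in $\widetilde K$, its $\mathrm{Gal}(\widetilde K/K)$-conjugates are again elliptic, and $\sigma[\omega]=[\sigma(\omega)]$ defines an action of $\mathrm{Gal}(\widetilde K/K)$ on $\mathrm{Ell}(G)$. There are bijections between the following three sets: (i) the vertices $\widetilde v$ of $G\backslash\mathcal T$ such that $q^2-1$ divides $|G_v|$; (ii) the $G$-conjugacy classes of cyclic subgroups of $G$ of order $q^2-1$; (iii) the orbits of the $\mathrm{Gal}(\widetilde K/K)$-action on $\mathrm{Ell}(G)$. They are natural in the following sense. The vertex $\widetilde v$ in (i) corresponds to the class of $C$ in (ii) if and only if $C$ fixes a vertex of $\mathcal T$ in the $G$-orbit of $v$. The class of $C$ in (ii) corresponds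 to the orbit of $[\omega]$ in (iii) if and only if $C=G_{g\omega}$ for some $g\in G$. The composite bijection makes $\widetilde v$ correspond to the orbit of $[\omega]$ if and only if $\lambda(\omega)=gv$ for some $g\in G$. Moreover, let $v$ be any vertex of $\mathcal T$. There are uncountably many points of $G\backslash\Omega$ lying over $\widetilde v$. If $q^2-1$ divides $|G_v|$, then $G_v\cong GL_2(\mathbb F_q)$ or $G_v\cong\mathbb F_{q^2}^*$. Among the points of $G\backslash\Omega$ lying over $\widetilde v$ there are exactly - one elliptic point if $G_v\cong GL_2(\mathbb F_q)$; - two elliptic points, conjugate under $\mathrm{Gal}(\widetilde K/K)$, if $G_v\cong\mathbb F_{q^2}^*$; - no elliptic points in all other cases. -/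

import Mathlib

open scoped Pointwise MatrixGroups NNReal WithZero

noncomputable section

namespace Drinfeld

/-- `K` is an algebraic function field of one variable over `F`, and `F` is its full field of
constants. -/
structure IsFunctionField (F K : Type*) [Field F] [Field K] [Algebra F K] : Prop where
  exists_finite : ∃ x : K, Transcendental F x ∧
    FiniteDimensional (IntermediateField.adjoin F ({x} : Set K)) K
  constants : ∀ z : K, IsAlgebraic F z → z ∈ Set.range (algebraMap F K)

/-- A place of `K` over `F`, given by its (discrete) valuation ring. -/
structure Place (F K : Type*) [Field F] [Field K] [Algebra F K] where
  ring : ValuationSubring K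
  const_mem : ∀ a : F, algebraMap F K a ∈ ring
  dvr : IsDiscreteValuationRing ring

/-- The field with `q ^ 2` elements, where `q = |F|`: the splitting field of `X ^ (q ^ 2) - X`. -/
abbrev Fq2 (F : Type*) [Field F] : Type _ :=
  Polynomial.SplittingField
    ((Polynomial.X : Polynomial F) ^ (Nat.card F ^ 2) - Polynomial.X)

namespace Place

variable {F K : Type*} [Field F] [Field K] [Algebra F K] (P : Place F K)

instance : IsDiscreteValuationRing P.ring := P.dvr

instance : Algebra F P.ring :=
  ((algebraMap F K).codRestrict P.ring P.const_mem).toAlgebra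

/-- The degree `δ` of the place: the degree of its residue field over the constant field. -/
def degree : ℕ := Module.finrank F (IsLocalRing.ResidueField P.ring)

/-- The ring `A` of the elements of `K` that are integral outside `P`, i.e. that lie in every
valuation ring of `K` other than that of `P` (the trivial valuation ring `K` imposes nothing, and
the others are the rings of the places different from `P`). -/
def affineRing : Subring K := ⨅ R : {R : ValuationSubring K // R ≠ P.ring}, R.1.toSubring

/-- The Drinfeld modular group `G = GL₂(A)`. -/
abbrev G : Type _ := GL (Fin 2) P.affineRing

/-! ### The fields `K_∞` and `C_∞` -/

/-- The completion `K_∞` of `K` at the place. -/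
abbrev Kinf : Type _ :=
  (IsDiscreteValuationRing.maximalIdeal P.ring).adicCompletion K

/-- The valuation ring `O_∞` of `K_∞`. -/
abbrev Oinf : ValuationSubring P.Kinf :=
  (IsDiscreteValuationRing.maximalIdeal P.ring).adicCompletionIntegers K

/-- The multiplicative valuation on `K_∞` is `|x| = 2 ^ (-ν(x))`. The choice of the base is
immaterial. -/
instance : (Valued.v : Valuation P.Kinf ℤᵐ⁰).RankOne :=
  Valuation.IsRankOneDiscrete.rankOne _ (e := 2) one_lt_two

instance : NontriviallyNormedField P.Kinf :=
  Valued.toNontriviallyNormedField (L := P.Kinf) (Γ₀ := ℤᵐ⁰)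

instance : IsUltrametricDist P.Kinf :=
  inferInstanceAs (@IsUltrametricDist P.Kinf (Valued.toNormedField P.Kinf ℤᵐ⁰).toDist)

/-- An algebraic closure of `K_∞`. -/
abbrev KinfBar : Type _ := AlgebraicClosure P.Kinf

/-- The algebraic closure of `K_∞` carries the unique extension of the absolute value. -/
instance : NontriviallyNormedField P.KinfBar :=
  spectralNorm.nontriviallyNormedField P.Kinf P.KinfBar

instance : NormedAlgebra P.Kinf P.KinfBar := spectralNorm.normedAlgebra P.Kinf P.KinfBar

/-- The field `C_∞`: the completion of an algebraic closure of `K_∞`. -/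
abbrev Cinf : Type _ := UniformSpace.Completion P.KinfBar

/-- `C_∞` as an algebra over `K`, through `K ⊆ K_∞ ⊆ C_∞`. -/
instance : Algebra K P.Cinf :=
  ((algebraMap P.Kinf P.Cinf).comp (algebraMap K P.Kinf)).toAlgebra

/-! ### The upper half-plane -/

/-- Drinfeld's upper half-plane `Ω = C_∞ \ K_∞`. -/
def Omega : Type _ := {z : P.Cinf // z ∉ Set.range (algebraMap P.Kinf P.Cinf)}

variable {P}

/-- The denominator `c z + d`. -/
def den (g : GL (Fin 2) P.Kinf) (z : P.Cinf) : P.Cinf :=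
  algebraMap P.Kinf P.Cinf (g 1 0) * z + algebraMap P.Kinf P.Cinf (g 1 1)

/-- The numerator `a z + b`. -/
def num (g : GL (Fin 2) P.Kinf) (z : P.Cinf) : P.Cinf :=
  algebraMap P.Kinf P.Cinf (g 0 0) * z + algebraMap P.Kinf P.Cinf (g 0 1)

theorem linear_ne_zero {z : P.Cinf} (hz : z ∉ Set.range (algebraMap P.Kinf P.Cinf))
    {c d : P.Kinf} (h : c ≠ 0 ∨ d ≠ 0) :
    algebraMap P.Kinf P.Cinf c * z + algebraMap P.Kinf P.Cinf d ≠ 0 := by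
  intro h0
  by_cases hc : c = 0
  · subst hc
    simp at h0 h
    exact h h0
  · refine hz ⟨-d / c, ?_⟩
    have : algebraMap P.Kinf P.Cinf c ≠ 0 := by simpa using hc
    rw [map_div₀, map_neg]
    field_simp
    linear_combination -h0

theorem den_ne_zero (g : GL (Fin 2) P.Kinf) (z : P.Omega) : den g z.1 ≠ 0 := by
  refine linear_ne_zero z.2 ?_
  by_contra! h
  have := g.det.ne_zero
  rw [Matrix.GeneralLinearGroup.val_det_apply, Matrix.det_fin_two, h.1, h.2] at this
  simp at this

theorem moebius_notMem (g : GL (Fin 2) P.Kinf) (z : P.Omega) :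
    num g z.1 / den g z.1 ∉ Set.range (algebraMap P.Kinf P.Cinf) := by
  rintro ⟨w, hw⟩
  rw [eq_div_iff (den_ne_zero g z)] at hw
  refine linear_ne_zero (c := w * g 1 0 - g 0 0) (d := w * g 1 1 - g 0 1) z.2 ?_ ?_
  · by_contra! h
    have := g.det.ne_zero
    rw [Matrix.GeneralLinearGroup.val_det_apply, Matrix.det_fin_two] at this
    exact this (by linear_combination g 1 0 * h.2 - g 1 1 * h.1)
  · simp only [num, den, map_sub, map_mul] at hw ⊢
    linear_combination hw

theorem num_mul (g h : GL (Fin 2) P.Kinf) (z : P.Omega) :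
    num (g * h) z.1 = num g (num h z.1 / den h z.1) * den h z.1 := by
  have hd := den_ne_zero h z
  have e : num h z.1 / den h z.1 * den h z.1 = num h z.1 := div_mul_cancel₀ _ hd
  have h1 : num g (num h z.1 / den h z.1) * den h z.1 =
      algebraMap P.Kinf P.Cinf (g 0 0) * num h z.1 +
        algebraMap P.Kinf P.Cinf (g 0 1) * den h z.1 := by
    rw [num, add_mul, mul_assoc, e]
  rw [h1]
  simp only [num, den, Matrix.GeneralLinearGroup.coe_mul, Matrix.mul_apply, Fin.sum_univ_two,
    map_add, map_mul]
  ring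

theorem den_mul (g h : GL (Fin 2) P.Kinf) (z : P.Omega) :
    den (g * h) z.1 = den g (num h z.1 / den h z.1) * den h z.1 := by
  have hd := den_ne_zero h z
  have e : num h z.1 / den h z.1 * den h z.1 = num h z.1 := div_mul_cancel₀ _ hd
  have h1 : den g (num h z.1 / den h z.1) * den h z.1 =
      algebraMap P.Kinf P.Cinf (g 1 0) * num h z.1 +
        algebraMap P.Kinf P.Cinf (g 1 1) * den h z.1 := by
    rw [den, add_mul, mul_assoc, e]
  rw [h1]
  simp only [num, den, Matrix.GeneralLinearGroup.coe_mul, Matrix.mul_apply, Fin.sum_univ_two,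
    map_add, map_mul]
  ring

/-- `GL₂(K_∞)` acts on `Ω` by `z ↦ (a z + b) / (c z + d)`. -/
instance : MulAction (GL (Fin 2) P.Kinf) P.Omega where
  smul g z := ⟨num g z.1 / den g z.1, moebius_notMem g z⟩
  one_smul z := Subtype.ext (by
    change num 1 z.1 / den 1 z.1 = z.1
    simp [num, den])
  mul_smul g h z := Subtype.ext (by
    change num (g * h) z.1 / den (g * h) z.1 =
      num g (num h z.1 / den h z.1) / den g (num h z.1 / den h z.1)
    rw [num_mul, den_mul, mul_div_mul_right _ _ (den_ne_zero h z)])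

variable (P) in
/-- The inclusion of `G = GL₂(A)` into `GL₂(K_∞)`. -/
def toGLinf : P.G →* GL (Fin 2) P.Kinf :=
  Matrix.GeneralLinearGroup.map ((algebraMap K P.Kinf).comp P.affineRing.subtype)

/-- The action of `G` on `Ω` by linear fractional transformations. -/
instance : MulAction P.G P.Omega := MulAction.compHom _ P.toGLinf

variable (P) in
/-- The points of `G \ Ω`. -/
abbrev OmegaQuot : Type _ := MulAction.orbitRel.Quotient P.G P.Omega

variable (P) in
/-- The point of `G \ Ω` below `ω`. -/
def mkOmega (ω : P.Omega) : P.OmegaQuot := Quotient.mk _ ω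

/-- `ω ∈ Ω` is elliptic: its stabilizer in `G` contains a non-scalar matrix. -/
def IsElliptic (ω : P.Omega) : Prop :=
  ∃ g ∈ MulAction.stabilizer P.G ω,
    ∀ a : P.affineRing, (g : Matrix (Fin 2) (Fin 2) P.affineRing) ≠ Matrix.scalar (Fin 2) a

variable (P) in
/-- The set `Ell(G)` of elliptic points, as a subset of `G \ Ω`. -/
def Ell : Set P.OmegaQuot := {c | ∃ ω : P.Omega, IsElliptic ω ∧ P.mkOmega ω = c}

/-- The elliptic point defined by an elliptic element. -/
def mkEll (ω : P.Omega) (h : IsElliptic ω) : P.Ell := ⟨P.mkOmega ω, ω, h, rfl⟩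

/-! ### The Galois action -/

variable (P) in
/-- The field `K̃ = F_{q²} K`, inside `C_∞`. -/
def Ktilde : IntermediateField K P.Cinf :=
  IntermediateField.adjoin K {z : P.Cinf | z ^ (Nat.card F ^ 2) = z}

variable (P) in
/-- The Galois group of `K̃ / K`. -/
abbrev Gal : Type _ := P.Ktilde ≃ₐ[K] P.Ktilde

/-- `act` is the action of `Gal(K̃/K)` on `Ell(G)` that is induced by the action on elements:
every elliptic element lies in `K̃`, its conjugates are elliptic, and `σ` maps the class of `ω`
to the class of `σ ω`. There is at most one such action. -/
structure IsGaloisAction (act : MulAction P.Gal P.Ell) : Prop where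
  mem_Ktilde : ∀ ω : P.Omega, IsElliptic ω → ω.1 ∈ P.Ktilde
  smul_mk : ∀ (σ : P.Gal) (x : P.Ktilde) (ω : P.Omega) (h : IsElliptic ω), ω.1 = x →
    ∃ (ω' : P.Omega) (h' : IsElliptic ω'), ω'.1 = σ x ∧ act.smul σ (mkEll ω h) = mkEll ω' h'

/-! ### The Bruhat-Tits tree -/

variable (P) in
/-- The `O_∞`-lattices of rank two in `K_∞ ⊕ K_∞`. -/
def Lattice : Type _ :=
  {L : Submodule P.Oinf (Fin 2 → P.Kinf) // L.IsLattice P.Kinf}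

/-- The linear automorphism `x ↦ x g⁻¹` of the space of row vectors. -/
def rowMap (g : GL (Fin 2) P.Kinf) : (Fin 2 → P.Kinf) →ₗ[P.Kinf] (Fin 2 → P.Kinf) :=
  Matrix.vecMulLinear (g⁻¹ : GL (Fin 2) P.Kinf).1

theorem rowMap_apply (g : GL (Fin 2) P.Kinf) (x : Fin 2 → P.Kinf) :
    rowMap g x = Matrix.vecMul x (g⁻¹ : GL (Fin 2) P.Kinf).1 := rfl

theorem rowMap_one : rowMap (1 : GL (Fin 2) P.Kinf) = LinearMap.id :=
  LinearMap.ext fun x => by simp [rowMap_apply]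

theorem rowMap_mul (g h : GL (Fin 2) P.Kinf) : rowMap (g * h) = rowMap g ∘ₗ rowMap h := by
  refine LinearMap.ext fun x => ?_
  rw [LinearMap.comp_apply, rowMap_apply, rowMap_apply, rowMap_apply, Matrix.vecMul_vecMul,
    mul_inv_rev, Matrix.GeneralLinearGroup.coe_mul]

theorem rowMap_surjective (g : GL (Fin 2) P.Kinf) : Function.Surjective (rowMap g) := fun x =>
  ⟨rowMap g⁻¹ x, by rw [← LinearMap.comp_apply, ← rowMap_mul, mul_inv_cancel, rowMap_one]; rfl⟩

theorem isLattice_map (g : GL (Fin 2) P.Kinf) (L : P.Lattice) :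
    (L.1.map ((rowMap g).restrictScalars P.Oinf)).IsLattice P.Kinf where
  fg := L.2.fg.map _
  span_eq_top := by
    rw [Submodule.map_coe]
    change Submodule.span P.Kinf (rowMap g '' (L.1 : Set (Fin 2 → P.Kinf))) = ⊤
    rw [Submodule.span_image, L.2.span_eq_top, Submodule.map_top,
      LinearMap.range_eq_top.2 (rowMap_surjective g)]

/-- `GL₂(K_∞)` acts on row vectors by `x ↦ x g⁻¹`, and so on lattices. -/
instance : MulAction (GL (Fin 2) P.Kinf) P.Lattice where
  smul g L := ⟨L.1.map ((rowMap g).restrictScalars P.Oinf), isLattice_map g L⟩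
  one_smul L := Subtype.ext (by
    change L.1.map ((rowMap 1).restrictScalars P.Oinf) = L.1
    rw [rowMap_one]
    exact Submodule.map_id L.1)
  mul_smul g h L := Subtype.ext (by
    change L.1.map ((rowMap (g * h)).restrictScalars P.Oinf) =
      (L.1.map ((rowMap h).restrictScalars P.Oinf)).map ((rowMap g).restrictScalars P.Oinf)
    rw [rowMap_mul, ← Submodule.map_comp]
    rfl)

variable (P) in
/-- Homothety of lattices. -/
def homothety : Setoid P.Lattice where
  r L L' := ∃ c : P.Kinfˣ, L'.1 = c • L.1
  iseqv := {
    refl := fun L => ⟨1, (one_smul _ _).symm⟩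
    symm := fun {L L'} ⟨c, h⟩ => ⟨c⁻¹, by rw [h, inv_smul_smul]⟩
    trans := fun {L L' L''} ⟨c, h⟩ ⟨c', h'⟩ => ⟨c' * c, by rw [h', h, mul_smul]⟩ }

variable (P) in
/-- The vertices of the Bruhat-Tits tree: homothety classes of lattices. -/
def Vertex : Type _ := Quotient P.homothety

variable (P) in
/-- The class of a lattice. -/
def mkVertex (L : P.Lattice) : P.Vertex := Quotient.mk P.homothety L

theorem homothety_smul (g : GL (Fin 2) P.Kinf) {L L' : P.Lattice} (h : P.homothety L L') :
    P.homothety (g • L) (g • L') := by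
  obtain ⟨c, h⟩ := h
  refine ⟨c, ?_⟩
  change L'.1.map ((rowMap g).restrictScalars P.Oinf) =
    c • L.1.map ((rowMap g).restrictScalars P.Oinf)
  rw [h]
  ext x
  simp only [Submodule.mem_map, LinearMap.coe_restrictScalars]
  constructor
  · rintro ⟨_, ⟨y, hy, rfl⟩, rfl⟩
    exact ⟨_, ⟨y, hy, rfl⟩, ((rowMap g).map_smul (c : P.Kinf) y).symm⟩
  · rintro ⟨_, ⟨y, hy, rfl⟩, rfl⟩
    exact ⟨_, ⟨y, hy, rfl⟩, (rowMap g).map_smul (c : P.Kinf) y⟩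

instance : MulAction (GL (Fin 2) P.Kinf) P.Vertex where
  smul g := Quotient.map (g • ·) fun _ _ h => homothety_smul g h
  one_smul v := by
    induction v using Quotient.inductionOn with
    | h L => exact congrArg P.mkVertex (one_smul _ L)
  mul_smul g h v := by
    induction v using Quotient.inductionOn with
    | h L => exact congrArg P.mkVertex (mul_smul g h L)

/-- The action of `G` on the vertices of the tree. -/
instance : MulAction P.G P.Vertex := MulAction.compHom _ P.toGLinf

variable (P) in
/-- The vertices of `G \ T`. -/
abbrev VertexQuot : Type _ := MulAction.orbitRel.Quotient P.G P.Vertex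

variable (P) in
/-- The image `ṽ` in `G \ T` of a vertex `v`. -/
def mkVertexQuot (v : P.Vertex) : P.VertexQuot := Quotient.mk _ v

/-- The norm on `K_∞ ⊕ K_∞` with unit ball the lattice `L`:
`‖x‖ = min {|a| : a ∈ K_∞, x ∈ a L}`. -/
def latticeNorm (L : P.Lattice) (x : Fin 2 → P.Kinf) : ℝ :=
  sInf {r : ℝ | ∃ a : P.Kinf, ∃ y ∈ L.1, x = a • y ∧ r = ‖a‖}

/-- The building map `λ` sends `ω` to the vertex `v`: the norm `(x₀, x₁) ↦ |x₀ ω + x₁|` on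
`K_∞ ⊕ K_∞` is the norm of a lattice in the class `v`. -/
def BuildingMapsTo (ω : P.Omega) (v : P.Vertex) : Prop :=
  ∃ L : P.Lattice, P.mkVertex L = v ∧ ∀ x : Fin 2 → P.Kinf,
    ‖algebraMap P.Kinf P.Cinf (x 0) * ω.1 + algebraMap P.Kinf P.Cinf (x 1)‖ = latticeNorm L x

/-- The point `c` of `G \ Ω` lies over the vertex `w` of `G \ T`. -/
def LiesOver (c : P.OmegaQuot) (w : P.VertexQuot) : Prop :=
  ∃ (ω : P.Omega) (v : P.Vertex), P.mkOmega ω = c ∧ P.mkVertexQuot v = w ∧ BuildingMapsTo ω v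

/-! ### The three sets -/

/-- `q ^ 2 - 1` divides the order of the stabilizer `G_v`. The stabilizers of vertices are in fact
always finite; the first clause only keeps the convention `Nat.card = 0` for infinite types out. -/
def IsGoodVertex (v : P.Vertex) : Prop :=
  Finite (MulAction.stabilizer P.G v) ∧
    Nat.card F ^ 2 - 1 ∣ Nat.card (MulAction.stabilizer P.G v)

variable (P) in
/-- The vertices `ṽ` of `G \ T` such that `q ^ 2 - 1` divides `|G_v|`. -/
def GoodVertexQuot : Set P.VertexQuot :=
  {w | ∃ v : P.Vertex, IsGoodVertex v ∧ P.mkVertexQuot v = w}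

/-- The image of a vertex in the first set. -/
def mkGood (v : P.Vertex) (h : IsGoodVertex v) : P.GoodVertexQuot :=
  ⟨P.mkVertexQuot v, v, h, rfl⟩

variable (P) in
/-- The cyclic subgroups of `G` of order `q ^ 2 - 1`. -/
def CyclicSub : Type _ :=
  {C : Subgroup P.G // IsCyclic C ∧ Nat.card C = Nat.card F ^ 2 - 1}

variable (P) in
/-- Conjugacy in `G` of cyclic subgroups of order `q ^ 2 - 1`. -/
def conjugacy : Setoid P.CyclicSub where
  r C C' := ∃ g : P.G, C'.1 = C.1.map (MulAut.conj g).toMonoidHom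
  iseqv := {
    refl := fun C => ⟨1, by ext x; simp [Subgroup.mem_map]⟩
    symm := fun {C C'} ⟨g, h⟩ => ⟨g⁻¹, by
      rw [h, Subgroup.map_map]
      ext x
      simp [Subgroup.mem_map, mul_assoc]⟩
    trans := fun {C C' C''} ⟨g, h⟩ ⟨g', h'⟩ => ⟨g' * g, by
      rw [h', h, Subgroup.map_map]
      congr 1
      ext x
      simp [mul_assoc]⟩ }

variable (P) in
/-- The conjugacy classes of cyclic subgroups of `G` of order `q ^ 2 - 1`. -/
def CyclicClasses : Type _ := Quotient P.conjugacy

/-- The conjugacy class of a cyclic subgroup. -/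
def mkCyclic (C : P.CyclicSub) : P.CyclicClasses := Quotient.mk P.conjugacy C

end Place

end Drinfeld

end

/-!
An elliptic element is the same thing as an eigenvector `(ω, 1)ᵗ` of a non-scalar matrix `g ∈ G`.
The eigenvalue `ε` is a unit over `A` that is quadratic over `K_∞`, so the trace and determinant of
`g` have no pole at `∞` and are constants: `ε ∈ F_{q²}` (`Eigen.trace_det_const`). Since `ω ∉ K_∞`,
a matrix over `A` is determined by its eigenvalue at `ω`. Hence `G_ω` is the group of the nonzero
matrices `x + y g` with `x, y ∈ F`, it is cyclic of order `q² - 1` (`stabilizerEquiv`), and the only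
other element with this stabilizer is the second fixed point of `g`, the conjugate of `ω` under
`Gal(K̃/K)` (`eigen_or_eigen_pow`, `eq_or_eq_galPoint`). Conversely, a cyclic subgroup of order
`q² - 1` is generated by a matrix whose eigenvalues are in `F_{q²}` but not in `F_q`, and so it is
the stabilizer of an elliptic element (`exists_eq_stabilizer`).

The degree `δ` being odd, `F_{q²}` is not contained in the residue field of `K_∞`, and `ε, 1` is an
orthonormal basis of an unramified quadratic extension of `K_∞` (`norm_mul_add_eq_max`). It follows
that the building map sends `ω` to a vertex (`exists_buildingMapsTo`), and that this is the only
vertex fixed by `g` (`BuildingMapsTo.eq_of_smul_eq`).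

The group `G_v` is the group of units of the order `M` of the matrices over `A` that preserve a
lattice in the class `v` (`orderAt`). Traces and determinants of elements of `M` are constants. If
`q² - 1` divides `|G_v|`, some element of `G_v` has its eigenvalues outside `F_q`, and so there is
an elliptic element above `v`: otherwise the orders of all elements divide `q (q - 1)`, and a prime
divisor of `q + 1`, or an elementary abelian `2`-subgroup of order `8`, gives a contradiction
(`not_dvd_card_of_pow_eq_one`). For two elliptic elements above `v`, choose elements `g, g'` of the
stabilizers with the same characteristic polynomial, of trace `t`. Then `g' + g - t` is in `M`, it
intertwines `g` and `g'`, and it is zero or invertible. So the two elements are equivalent under `G`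
or have the same stabilizer (`exists_smul_eq_or_stabilizer_eq`). The maps that send an elliptic
element to its vertex, to its stabilizer and to its point of `Ell(G)` therefore have the same fibres
modulo `G` and the Galois group, which gives the bijections.

Finally, let `ω` be elliptic above `v`. If `G_v` commutes with `G_ω`, it is equal to `G_ω`, and then
`ω` and its conjugate are not equivalent. Otherwise the commutator of `g` with an element of `G_v`
provides an involution in `M`, which together with `g` generates a matrix algebra `M₂(F)` equal to
`M` (`orderAt_ringEquiv`), and `ω` is equivalent to its conjugate
(`exists_smul_eq_of_mulEquiv_GL`).
-/

noncomputable section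

namespace Drinfeld.Place

/-! ### The absolute values of `K_∞` and `C_∞` -/

section Basic
variable {F K : Type*} [Field F] [Field K] [Algebra F K] {P : Place F K}

theorem mem_Oinf_iff (x : P.Kinf) : x ∈ P.Oinf ↔ ‖x‖ ≤ 1 := by
  rw [IsDedekindDomain.HeightOneSpectrum.mem_adicCompletionIntegers]
  exact Valued.toNormedField.norm_le_one_iff.symm

theorem norm_algebraMap_ring_le_one (x : P.ring) : ‖algebraMap K P.Kinf x‖ ≤ 1 := by
  refine Valued.toNormedField.norm_le_one_iff.2 ?_
  have := IsDedekindDomain.HeightOneSpectrum.valuedAdicCompletion_eq_valuation'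
    (IsDiscreteValuationRing.maximalIdeal P.ring) (x : K)
  refine this.le.trans ?_
  exact IsDedekindDomain.HeightOneSpectrum.valuation_le_one _ x

theorem norm_algebraMap_lt_one_iff (x : P.ring) :
    ‖algebraMap K P.Kinf x‖ < 1 ↔ IsLocalRing.residue P.ring x = 0 := by
  rw [IsLocalRing.residue_eq_zero_iff]
  refine Iff.trans Valued.toNormedField.norm_lt_one_iff ?_
  have := IsDedekindDomain.HeightOneSpectrum.valuedAdicCompletion_eq_valuation'
    (IsDiscreteValuationRing.maximalIdeal P.ring) (x : K)
  refine (Iff.of_eq (congrArg (· < 1) this)).trans ?_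
  exact IsDedekindDomain.HeightOneSpectrum.valuation_lt_one_iff_mem _ x

theorem mem_ring_iff (x : K) : x ∈ P.ring ↔ ‖algebraMap K P.Kinf x‖ ≤ 1 := by
  refine ⟨fun h => norm_algebraMap_ring_le_one ⟨x, h⟩, fun h => ?_⟩
  by_contra hx
  have hx0 : x ≠ 0 := by rintro rfl; exact hx P.ring.zero_mem
  have hi : x⁻¹ ∈ P.ring := (P.ring.mem_or_inv_mem x).resolve_left hx
  have h1 : IsLocalRing.residue P.ring ⟨x⁻¹, hi⟩ = 0 := by
    rw [IsLocalRing.residue_eq_zero_iff, IsLocalRing.mem_maximalIdeal]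
    intro hu
    obtain ⟨y, hy⟩ := hu.exists_right_inv
    have : x⁻¹ * (y : K) = 1 := congrArg Subtype.val hy
    have : (y : K) = x := by field_simp at this; exact this
    exact hx (this ▸ y.2)
  rw [← norm_algebraMap_lt_one_iff] at h1
  simp only [map_inv₀, norm_inv] at h1
  have h0 : 0 < ‖algebraMap K P.Kinf x‖ := by simpa using hx0
  exact absurd h (not_le.2 ((inv_lt_one₀ h0).1 h1))

theorem exists_algebraMap_norm_sub_lt_one (y : P.Kinf) :
    ∃ x : K, ‖y - algebraMap K P.Kinf x‖ < 1 := by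
  have h := IsDedekindDomain.HeightOneSpectrum.denseRange_algebraMap
    (K := K) (v := IsDiscreteValuationRing.maximalIdeal P.ring)
  obtain ⟨x, hx⟩ := Metric.denseRange_iff.1 h y 1 one_pos
  exact ⟨x, by rwa [dist_eq_norm] at hx⟩

instance : IsUltrametricDist P.KinfBar := by
  refine IsUltrametricDist.isUltrametricDist_of_isNonarchimedean_norm ?_
  exact isNonarchimedean_spectralNorm

instance : IsUltrametricDist P.Cinf where
  dist_triangle_max x y z := by
    refine UniformSpace.Completion.induction_on₃ x y z
      (isClosed_le (by fun_prop) (by fun_prop)) fun a b c => ?_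
    simp only [UniformSpace.Completion.dist_eq]
    exact dist_triangle_max a b c

theorem algebraMap_Cinf (x : K) :
    algebraMap K P.Cinf x = algebraMap P.Kinf P.Cinf (algebraMap K P.Kinf x) := rfl

@[simp] theorem norm_algebraMap_Cinf (x : P.Kinf) : ‖algebraMap P.Kinf P.Cinf x‖ = ‖x‖ :=
  norm_algebraMap' _ _

/-! ### The constants and the ring `A` -/

theorem mem_affineRing_iff (x : K) :
    x ∈ P.affineRing ↔ ∀ R : ValuationSubring K, R ≠ P.ring → x ∈ R := by
  simp [affineRing, Subring.mem_iInf]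

variable [Finite F]

theorem algebraMap_mem_valuationSubring (R : ValuationSubring K) (a : F) :
    algebraMap F K a ∈ R := by
  have : Fintype F := Fintype.ofFinite F
  have h : IsIntegral R (algebraMap F K a) := by
    refine ⟨Polynomial.X ^ Fintype.card F - Polynomial.X,
      Polynomial.monic_X_pow_sub (by simpa using Fintype.one_lt_card), ?_⟩
    simp [← map_pow, FiniteField.pow_card]
  obtain ⟨y, hy⟩ := IsIntegrallyClosed.isIntegral_iff.1 h
  rw [← hy]
  exact y.2

variable (P) in
/-- The inclusion of the constants into `A`. -/
def constA : F →+* P.affineRing :=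
  (algebraMap F K).codRestrict P.affineRing fun a => (mem_affineRing_iff _).2
    fun R _ => algebraMap_mem_valuationSubring R a

/-- An element of `A` without a pole at `∞` is a constant. -/
theorem exists_const_of_norm_le_one (hK : IsFunctionField F K) {a : P.affineRing}
    (h : ‖algebraMap K P.Kinf a‖ ≤ 1) : ∃ f : F, a = P.constA f := by
  suffices h : IsAlgebraic F (a : K) by
    obtain ⟨f, hf⟩ := hK.constants _ h
    exact ⟨f, Subtype.ext hf.symm⟩
  have h1 : (a : K) ∈ (⨅ V : {V : ValuationSubring K //
      (Set.range (algebraMap F K)) ⊆ V.toSubring}, V.1.toSubring) := by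
    rw [Subring.mem_iInf]
    intro V
    by_cases hV : V.1 = P.ring
    · rw [hV]; exact (mem_ring_iff _).2 h
    · exact (mem_affineRing_iff _).1 a.2 _ hV
  rw [iInf_valuationSubring_superset] at h1
  have h2 : IsIntegral (Subring.closure (Set.range (algebraMap F K))) (a : K) := h1
  have h3 : Subring.closure (Set.range (algebraMap F K)) = (algebraMap F K).range := by
    rw [← RingHom.coe_range, Subring.closure_eq]
  rw [h3] at h2
  obtain ⟨p, hp, hp0⟩ := h2
  obtain ⟨q, hq, hqd, hqm⟩ := Polynomial.lifts_and_natDegree_eq_and_monic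
    (f := (algebraMap F K).rangeRestrict) (p := p)
    ((Polynomial.lifts_iff_coeff_lifts p).2 fun n =>
      (algebraMap F K).rangeRestrict_surjective _) hp
  refine IsIntegral.isAlgebraic ⟨q, hqm, ?_⟩
  rw [← hq, Polynomial.eval₂_map] at hp0
  exact hp0

end Basic
end Drinfeld.Place

namespace Drinfeld

/-! ### Finite fields -/

section FiniteField
variable {F : Type*} [Field F] [Finite F]

variable (F) in
theorem exists_card_eq_prime_pow :
    ∃ (p n : ℕ), CharP F p ∧ p.Prime ∧ 0 < n ∧ Nat.card F = p ^ n := by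
  have : Fintype F := Fintype.ofFinite F
  obtain ⟨p, hp, n, hpp, hn⟩ := FiniteField.card' (K := F)
  exact ⟨p, n, hp, hpp, n.pos, by rw [Nat.card_eq_fintype_card, hn]⟩

theorem sub_pow_card {R : Type*} [CommRing R] (f : F →+* R) (x y : R) :
    (x - y) ^ Nat.card F = x ^ Nat.card F - y ^ Nat.card F := by
  rcases subsingleton_or_nontrivial R with h | h
  · exact Subsingleton.elim _ _
  obtain ⟨p, n, hp, hpp, -, hn⟩ := exists_card_eq_prime_pow F
  have : Fact p.Prime := ⟨hpp⟩
  have : CharP R p := charP_of_injective_ringHom f.injective p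
  rw [hn, sub_pow_expChar_pow]

theorem pow_card_map {R : Type*} [CommRing R] (f : F →+* R) (a : F) :
    f a ^ Nat.card F = f a := by
  have : Fintype F := Fintype.ofFinite F
  rw [← map_pow, Nat.card_eq_fintype_card, FiniteField.pow_card]

theorem add_pow_card {R : Type*} [CommRing R] (f : F →+* R) (x y : R) :
    (x + y) ^ Nat.card F = x ^ Nat.card F + y ^ Nat.card F := by
  have h := sub_pow_card f (x + y) y
  rw [add_sub_cancel_right] at h
  rw [h, sub_add_cancel]

/-- The polynomial `X ^ q - X` vanishes exactly at the elements of a field with `q` elements. -/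
theorem pow_card_eq_self_iff {L : Type*} [Field L] (f : F →+* L) (z : L) :
    z ^ Nat.card F = z ↔ ∃ a : F, z = f a := by
  refine ⟨fun h => ?_, fun ⟨a, ha⟩ => ha ▸ pow_card_map f a⟩
  have : Fintype F := Fintype.ofFinite F
  have h1 : (Polynomial.X ^ Fintype.card F - Polynomial.X : Polynomial F) =
      (Finset.univ.val.map fun a : F => Polynomial.X - Polynomial.C a).prod := by
    have h2 := FiniteField.isSplittingField_sub F F
    have h3 := h2.splits.eq_prod_roots
    rw [Algebra.algebraMap_self, Polynomial.map_id] at h3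
    rw [← FiniteField.roots_X_pow_card_sub_X F]
    conv_lhs => rw [h3]
    have hm : (Polynomial.X ^ Fintype.card F - Polynomial.X : Polynomial F).Monic :=
      Polynomial.monic_X_pow_sub (by simpa using Fintype.one_lt_card (α := F))
    rw [hm.leadingCoeff]
    simp
  have h4 := congrArg (Polynomial.eval₂ f z) h1
  rw [Nat.card_eq_fintype_card] at h
  rw [Polynomial.eval₂_sub, Polynomial.eval₂_X_pow, Polynomial.eval₂_X, h, sub_self] at h4
  change 0 = Polynomial.eval₂ f z (∏ a : F, (Polynomial.X - Polynomial.C a)) at h4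
  rw [Polynomial.eval₂_finsetProd, eq_comm, Finset.prod_eq_zero_iff] at h4
  obtain ⟨a, -, ha⟩ := h4
  exact ⟨a, by simpa [sub_eq_zero] using ha⟩

variable (F) in
theorem one_lt_natCard : 1 < Nat.card F := Finite.one_lt_card

variable (F) in
theorem natCard_sq_sub_one_pos : 0 < Nat.card F ^ 2 - 1 :=
  Nat.sub_pos_of_lt (Nat.one_lt_pow two_ne_zero (one_lt_natCard F))

theorem pow_card_sq {F : Type*} {R : Type*} [Monoid R] (z : R) :
    z ^ Nat.card F ^ 2 = (z ^ Nat.card F) ^ Nat.card F := by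
  rw [← pow_mul, sq]

theorem sub_pow_card_sq {R : Type*} [CommRing R] (f : F →+* R) (x y : R) :
    (x - y) ^ Nat.card F ^ 2 = x ^ Nat.card F ^ 2 - y ^ Nat.card F ^ 2 := by
  simp only [pow_card_sq, sub_pow_card f]

/-- In a field of odd degree over `F`, the only elements of a quadratic extension of `F` are those
of `F`. -/
theorem pow_card_eq_self_of_odd {k : Type*} [Field k] [Algebra F k]
    (hk : Odd (Module.finrank F k)) {r : k} (hr : r ^ Nat.card F ^ 2 = r) :
    r ^ Nat.card F = r := by
  have hfin : FiniteDimensional F k := FiniteDimensional.of_finrank_pos hk.pos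
  have : Finite k := Module.finite_of_finite F
  obtain ⟨m, hm⟩ := hk
  have h1 : ∀ m : ℕ, r ^ (Nat.card F ^ (2 * m)) = r := by
    intro m
    induction m with
    | zero => simp
    | succ m ih => rw [mul_add, pow_add, pow_mul, ih, mul_one, hr]
  have h2 : r ^ Nat.card k = r := by
    have : Fintype k := Fintype.ofFinite k
    rw [Nat.card_eq_fintype_card, FiniteField.pow_card]
  rw [Module.natCard_eq_pow_finrank (K := F), hm, pow_add, pow_mul, h1, pow_one] at h2
  exact h2

end FiniteField

namespace Place

/-! ### The unramified quadratic extension of `K_∞` -/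

section Cinf
variable {F K : Type*} [Field F] [Field K] [Algebra F K] {P : Place F K}

variable (P) in
/-- The inclusion of the constants into `C_∞`. -/
def constC : F →+* P.Cinf := (algebraMap K P.Cinf).comp (algebraMap F K)

/-- The two roots of an irreducible quadratic polynomial over `K_∞` have the same absolute value.
If the norm is a unit, the trace is therefore integral. -/
theorem norm_trace_le_one {ε : P.Cinf} (hε : ε ∉ Set.range (algebraMap P.Kinf P.Cinf))
    {t n : P.Kinf} (hn : ‖n‖ = 1)
    (h : ε ^ 2 - algebraMap P.Kinf P.Cinf t * ε + algebraMap P.Kinf P.Cinf n = 0) :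
    ‖t‖ ≤ 1 := by
  let f : Polynomial P.Kinf := Polynomial.X ^ 2 - Polynomial.C t * Polynomial.X + Polynomial.C n
  have hdeg : f.natDegree = 2 := by simp only [f]; compute_degree!
  have hmon : f.Monic := by simp only [f]; monicity!
  obtain ⟨e, he⟩ := IsAlgClosed.exists_root (f.map (algebraMap P.Kinf P.KinfBar))
    (by rw [Polynomial.degree_map, Polynomial.degree_eq_natDegree hmon.ne_zero, hdeg]; norm_num)
  have he' : e ^ 2 - algebraMap P.Kinf P.KinfBar t * e + algebraMap P.Kinf P.KinfBar n = 0 := by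
    simpa [f, Polynomial.IsRoot] using he
  set e' := algebraMap P.Kinf P.KinfBar t - e with he'def
  have hprod : e * e' = algebraMap P.Kinf P.KinfBar n := by
    rw [he'def]; linear_combination -he'
  have he'' : e' ^ 2 - algebraMap P.Kinf P.KinfBar t * e' + algebraMap P.Kinf P.KinfBar n = 0 := by
    rw [he'def]; linear_combination he'
  have hirr : Irreducible f := by
    refine Polynomial.irreducible_of_degree_le_three_of_not_isRoot
      (by rw [hdeg]; simp) fun x hx => ?_
    have hx' : x ^ 2 - t * x + n = 0 := by simpa [f, Polynomial.IsRoot] using hx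
    have hx2 := congrArg (algebraMap P.Kinf P.Cinf) hx'
    simp only [map_add, map_sub, map_mul, map_pow, map_zero] at hx2
    have : (ε - algebraMap P.Kinf P.Cinf x) *
        (ε - algebraMap P.Kinf P.Cinf (t - x)) = 0 := by
      rw [map_sub]
      linear_combination h - hx2
    rcases mul_eq_zero.1 this with h1 | h1
    · exact hε ⟨_, (sub_eq_zero.1 h1).symm⟩
    · exact hε ⟨_, (sub_eq_zero.1 h1).symm⟩
  have hmin : ∀ z : P.KinfBar, z ^ 2 - algebraMap P.Kinf P.KinfBar t * z +
      algebraMap P.Kinf P.KinfBar n = 0 → minpoly P.Kinf z = f := fun z hz =>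
    (minpoly.eq_of_irreducible_of_monic hirr (by simpa [f] using hz) hmon).symm
  have hnorm : ‖e‖ = ‖e'‖ := by
    change spectralNorm P.Kinf P.KinfBar e = spectralNorm P.Kinf P.KinfBar e'
    rw [spectralNorm, spectralNorm, hmin e he', hmin e' he'']
  have h1 : ‖e‖ = 1 := by
    have := congrArg norm hprod
    rw [norm_mul, ← hnorm, norm_algebraMap', hn] at this
    nlinarith [norm_nonneg e]
  rw [← norm_algebraMap' P.KinfBar t, show algebraMap P.Kinf P.KinfBar t = e + e' by
    rw [he'def]; ring]
  exact (IsUltrametricDist.norm_add_le_max _ _).trans (by rw [← hnorm, h1, max_self])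

variable [Finite F]

theorem norm_eq_one_of_pow_card_sq {z : P.Cinf} (h : z ^ Nat.card F ^ 2 = z) (h0 : z ≠ 0) :
    ‖z‖ = 1 := by
  refine (pow_eq_one_iff_of_nonneg (norm_nonneg z) (natCard_sq_sub_one_pos F).ne').1 ?_
  rw [← norm_pow, ← norm_one (α := P.Cinf)]
  congr 1
  have : z ^ (Nat.card F ^ 2 - 1) * z = z := by
    rw [← pow_succ, Nat.sub_add_cancel (Nat.one_le_pow _ _ (one_lt_natCard F).le), h]
  exact mul_right_cancel₀ h0 (by rw [this, one_mul])

/-- Distinct elements of `F_{q²}` have distinct residues, and the residue field of `K_∞` has odd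
degree over `F_q`: an element of `F_{q²}` congruent to an element of `K_∞` belongs to `F_q`. -/
theorem pow_card_eq_self_of_norm_sub_lt_one (hδ : Odd P.degree) {ε : P.Cinf}
    (h : ε ^ Nat.card F ^ 2 = ε) {y : P.Kinf} (hy : ‖ε - algebraMap P.Kinf P.Cinf y‖ < 1) :
    ε ^ Nat.card F = ε := by
  have lt_max : ∀ a b : P.Cinf, ‖a‖ < 1 → ‖b‖ < 1 → ‖a - b‖ < 1 := fun a b ha hb => by
    rw [sub_eq_add_neg]
    exact (IsUltrametricDist.norm_add_le_max _ _).trans_lt (max_lt ha (by rwa [norm_neg]))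
  have pow_lt : ∀ (a : P.Cinf) (n : ℕ), n ≠ 0 → ‖a‖ < 1 → ‖a ^ n‖ < 1 := fun a n hn ha => by
    rw [norm_pow]; exact pow_lt_one₀ (norm_nonneg _) ha hn
  have hq : Nat.card F ≠ 0 := (one_lt_natCard F).ne_bot
  -- approximate by an element `r` of `K`
  obtain ⟨r, hr⟩ := exists_algebraMap_norm_sub_lt_one y
  have hr1 : ‖ε - algebraMap K P.Cinf r‖ < 1 := by
    have h1 : ‖algebraMap K P.Cinf r - algebraMap P.Kinf P.Cinf y‖ < 1 := by
      rw [algebraMap_Cinf, ← map_sub, norm_algebraMap_Cinf, norm_sub_rev]; exact hr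
    have := lt_max _ _ hy h1
    rwa [sub_sub_sub_cancel_right] at this
  have hε : ‖ε‖ ≤ 1 := by
    rcases eq_or_ne ε 0 with rfl | h0
    · simp
    · exact (norm_eq_one_of_pow_card_sq h h0).le
  have hrr : r ∈ P.ring := by
    rw [mem_ring_iff, ← norm_algebraMap_Cinf, ← algebraMap_Cinf]
    have : algebraMap K P.Cinf r = ε + (-(ε - algebraMap K P.Cinf r)) := by ring
    rw [this]
    exact (IsUltrametricDist.norm_add_le_max _ _).trans (max_le hε (by rw [norm_neg]; exact hr1.le))
  have key : ∀ s : P.ring, ‖algebraMap K P.Cinf s‖ < 1 ↔ IsLocalRing.residue P.ring s = 0 := by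
    intro s
    rw [← norm_algebraMap_lt_one_iff, algebraMap_Cinf, norm_algebraMap_Cinf]
  let r' : P.ring := ⟨r, hrr⟩
  have h2 : IsLocalRing.residue P.ring (r' ^ Nat.card F ^ 2 - r') = 0 := by
    rw [← key]
    have : algebraMap K P.Cinf ((r' ^ Nat.card F ^ 2 - r' : P.ring) : K) =
        (ε - algebraMap K P.Cinf r) - (ε - algebraMap K P.Cinf r) ^ Nat.card F ^ 2 := by
      rw [sub_pow_card_sq P.constC, h]
      simp [r']
    rw [this]
    exact lt_max _ _ hr1 (pow_lt _ _ (pow_ne_zero _ hq) hr1)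
  have h3 : (IsLocalRing.residue P.ring r') ^ Nat.card F = IsLocalRing.residue P.ring r' := by
    refine pow_card_eq_self_of_odd (F := F) hδ ?_
    rwa [map_sub, map_pow, sub_eq_zero] at h2
  rw [← sub_eq_zero, ← map_pow, ← map_sub, ← key] at h3
  have h4 : ε ^ Nat.card F - ε = (algebraMap K P.Cinf ((r' ^ Nat.card F - r' : P.ring) : K)) -
      ((ε - algebraMap K P.Cinf r) - (ε - algebraMap K P.Cinf r) ^ Nat.card F) := by
    rw [sub_pow_card P.constC]
    simp [r']
    ring
  have h5 : ‖ε ^ Nat.card F - ε‖ < 1 := by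
    rw [h4]
    exact lt_max _ _ h3 (lt_max _ _ hr1 (pow_lt _ _ hq hr1))
  by_contra hne
  refine h5.ne (norm_eq_one_of_pow_card_sq ?_ (sub_ne_zero.2 hne))
  rw [sub_pow_card_sq P.constC, h, ← pow_mul, mul_comm, pow_mul, h]

/-- If `ε` generates `F_{q²}` over `F_q`, then `1, ε` is an orthonormal basis of the unramified
quadratic extension of `K_∞`. This is where the degree of the place has to be odd. -/
theorem norm_mul_add_eq_max (hδ : Odd P.degree) {ε : P.Cinf}
    (h : ε ^ Nat.card F ^ 2 = ε) (h' : ε ^ Nat.card F ≠ ε) (x y : P.Kinf) :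
    ‖algebraMap P.Kinf P.Cinf x * ε + algebraMap P.Kinf P.Cinf y‖ = max ‖x‖ ‖y‖ := by
  have h0 : ε ≠ 0 := by
    rintro rfl
    exact h' (zero_pow (one_lt_natCard F).ne_bot)
  have h1 := norm_eq_one_of_pow_card_sq h h0
  have hx : ‖algebraMap P.Kinf P.Cinf x * ε‖ = ‖x‖ := by
    rw [norm_mul, h1, mul_one, norm_algebraMap_Cinf]
  have hy := norm_algebraMap_Cinf y
  by_cases hxy : ‖x‖ = ‖y‖
  · refine le_antisymm ((IsUltrametricDist.norm_add_le_max _ _).trans (by rw [hx, hy])) ?_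
    by_contra! hlt
    rw [← hxy, max_self] at hlt
    have hx0 : x ≠ 0 := by
      rintro rfl
      rw [norm_zero] at hlt
      exact absurd hlt (norm_nonneg _).not_gt
    refine h' (pow_card_eq_self_of_norm_sub_lt_one hδ h (y := -(y / x)) ?_)
    have hx1 : algebraMap P.Kinf P.Cinf x ≠ 0 := by simpa using hx0
    have : ε - algebraMap P.Kinf P.Cinf (-(y / x)) =
      (algebraMap P.Kinf P.Cinf x * ε + algebraMap P.Kinf P.Cinf y) /
        algebraMap P.Kinf P.Cinf x := by
      rw [map_neg, map_div₀]
      field_simp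
      ring
    rw [this, norm_div, norm_algebraMap_Cinf, div_lt_one (by simpa using hx0)]
    exact hlt
  · rw [IsUltrametricDist.norm_add_eq_max_of_norm_ne_norm (by rwa [hx, hy]), hx, hy]

theorem notMem_range_of_pow_card_ne (hδ : Odd P.degree) {ε : P.Cinf}
    (h : ε ^ Nat.card F ^ 2 = ε) (h' : ε ^ Nat.card F ≠ ε) :
    ε ∉ Set.range (algebraMap P.Kinf P.Cinf) := by
  rintro ⟨y, hy⟩
  exact h' (pow_card_eq_self_of_norm_sub_lt_one hδ h (y := y) (by simp [hy]))

variable (P) in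
/-- The field `C_∞` contains `F_{q²}`. -/
theorem exists_isPrimitiveRoot : ∃ ζ : P.Cinf, IsPrimitiveRoot ζ (Nat.card F ^ 2 - 1) := by
  have : NeZero ((Nat.card F ^ 2 - 1 : ℕ) : P.Kinf) := by
    refine ⟨fun h => ?_⟩
    let f : F →+* P.Kinf := (algebraMap K P.Kinf).comp (algebraMap F K)
    have h1 : ((Nat.card F ^ 2 - 1 : ℕ) : F) = 0 := f.injective (by rw [map_natCast, h, map_zero])
    have hF : (Nat.card F : F) = 0 := by
      have : Fintype F := Fintype.ofFinite F
      rw [Nat.card_eq_fintype_card, FiniteField.cast_card_eq_zero]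
    rw [Nat.cast_sub (Nat.one_le_pow _ _ (one_lt_natCard F).le), Nat.cast_pow, hF] at h1
    simp at h1
  obtain ⟨ζ, hζ⟩ := HasEnoughRootsOfUnity.exists_primitiveRoot P.KinfBar (Nat.card F ^ 2 - 1)
  exact ⟨_, hζ.map_of_injective (f := algebraMap P.KinfBar P.Cinf) (RingHom.injective _)⟩

end Cinf
end Place
end Drinfeld

namespace Drinfeld.Place

/-! ### Lattices and their norms -/

section Lattice
variable {F K : Type*} [Field F] [Field K] [Algebra F K] {P : Place F K}

theorem norm_eq_max (x : Fin 2 → P.Kinf) : ‖x‖ = max ‖x 0‖ ‖x 1‖ := by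
  refine le_antisymm ((pi_norm_le_iff_of_nonneg (by positivity)).2 fun i => ?_)
    (max_le (norm_le_pi_norm x 0) (norm_le_pi_norm x 1))
  fin_cases i <;> simp

variable (P) in
/-- The standard lattice `O_∞ ⊕ O_∞`. -/
def stdLattice : P.Lattice := by
  refine ⟨{ carrier := {x | ‖x‖ ≤ 1}
            add_mem' := fun {x y} hx hy => ?_
            zero_mem' := by simp
            smul_mem' := fun c x hx => ?_ }, ⟨?_, ?_⟩⟩
  · rw [Set.mem_ofPred_eq, pi_norm_le_iff_of_nonneg zero_le_one]
    exact fun i => (IsUltrametricDist.norm_add_le_max _ _).trans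
      (max_le ((norm_le_pi_norm x i).trans hx) ((norm_le_pi_norm y i).trans hy))
  · rw [Set.mem_ofPred_eq, show c • x = (c : P.Kinf) • x from rfl, norm_smul]
    exact mul_le_one₀ ((mem_Oinf_iff _).1 c.2) (norm_nonneg _) hx
  · refine Submodule.fg_def.2 ⟨{Pi.single 0 1, Pi.single 1 1}, Set.toFinite _,
      le_antisymm ?_ fun x hx => ?_⟩
    · rw [Submodule.span_le]
      intro x hx
      simp only [Set.mem_insert_iff, Set.mem_singleton_iff] at hx
      rcases hx with rfl | rfl <;>
      · change ‖_‖ ≤ 1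
        simp [norm_eq_max]
    · have hx0 : x 0 ∈ P.Oinf := (mem_Oinf_iff _).2 ((norm_le_pi_norm x 0).trans hx)
      have hx1 : x 1 ∈ P.Oinf := (mem_Oinf_iff _).2 ((norm_le_pi_norm x 1).trans hx)
      have : x = (⟨x 0, hx0⟩ : P.Oinf) • (Pi.single 0 1 : Fin 2 → P.Kinf) +
          (⟨x 1, hx1⟩ : P.Oinf) • (Pi.single 1 1 : Fin 2 → P.Kinf) := by
        funext i
        fin_cases i <;> simp <;> exact (mul_one _).symm
      rw [this]
      refine Submodule.add_mem _ (Submodule.smul_mem _ _ (Submodule.subset_span ?_))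
        (Submodule.smul_mem _ _ (Submodule.subset_span ?_)) <;> simp
  · rw [eq_top_iff]
    rintro x -
    have : x = x 0 • (Pi.single 0 1 : Fin 2 → P.Kinf) + x 1 • (Pi.single 1 1) := by
      funext i
      fin_cases i <;> simp
    rw [this]
    refine Submodule.add_mem _ (Submodule.smul_mem _ _ (Submodule.subset_span ?_))
        (Submodule.smul_mem _ _ (Submodule.subset_span ?_)) <;>
    · change ‖_‖ ≤ 1
      simp [norm_eq_max]

theorem mem_stdLattice {x : Fin 2 → P.Kinf} : x ∈ P.stdLattice.1 ↔ ‖x‖ ≤ 1 := Iff.rfl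

theorem rowMap_inv_apply (g : GL (Fin 2) P.Kinf) (x : Fin 2 → P.Kinf) :
    rowMap g⁻¹ x = Matrix.vecMul x g.1 := by rw [rowMap_apply, inv_inv]

theorem rowMap_inv_rowMap (g : GL (Fin 2) P.Kinf) (x : Fin 2 → P.Kinf) :
    rowMap g⁻¹ (rowMap g x) = x := by
  rw [← LinearMap.comp_apply, ← rowMap_mul, inv_mul_cancel, rowMap_one]; rfl

theorem rowMap_rowMap_inv (g : GL (Fin 2) P.Kinf) (x : Fin 2 → P.Kinf) :
    rowMap g (rowMap g⁻¹ x) = x := by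
  rw [← LinearMap.comp_apply, ← rowMap_mul, mul_inv_cancel, rowMap_one]; rfl

theorem mem_smul_lattice (g : GL (Fin 2) P.Kinf) (L : P.Lattice) (x : Fin 2 → P.Kinf) :
    x ∈ (g • L).1 ↔ rowMap g⁻¹ x ∈ L.1 := by
  change x ∈ L.1.map ((rowMap g).restrictScalars P.Oinf) ↔ _
  rw [Submodule.mem_map]
  constructor
  · rintro ⟨y, hy, rfl⟩
    rw [LinearMap.coe_restrictScalars, rowMap_inv_rowMap]
    exact hy
  · exact fun h => ⟨_, h, rowMap_rowMap_inv g x⟩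

theorem latticeNorm_smul (g : GL (Fin 2) P.Kinf) (L : P.Lattice) (x : Fin 2 → P.Kinf) :
    latticeNorm (g • L) x = latticeNorm L (Matrix.vecMul x g.1) := by
  rw [← rowMap_inv_apply]
  unfold latticeNorm
  congr 1
  ext r
  constructor
  · rintro ⟨a, y, hy, hx, hr⟩
    exact ⟨a, _, (mem_smul_lattice g L y).1 hy, by rw [hx, map_smul], hr⟩
  · rintro ⟨a, y, hy, hx, hr⟩
    refine ⟨a, rowMap g y, (mem_smul_lattice g L _).2 (by rwa [rowMap_inv_rowMap]), ?_, hr⟩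
    rw [← map_smul, ← hx, rowMap_rowMap_inv]

theorem exists_norm_eq (x : Fin 2 → P.Kinf) : ∃ a : P.Kinf, ‖x‖ = ‖a‖ := by
  rw [norm_eq_max]
  rcases max_choice ‖x 0‖ ‖x 1‖ with h | h <;> exact ⟨_, h⟩

theorem latticeNorm_stdLattice (x : Fin 2 → P.Kinf) : latticeNorm P.stdLattice x = ‖x‖ := by
  refine IsLeast.csInf_eq ⟨?_, ?_⟩
  · obtain ⟨a, ha⟩ := exists_norm_eq x
    rcases eq_or_ne a 0 with rfl | h0
    · refine ⟨0, 0, by simp, ?_, ha⟩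
      rw [norm_zero, norm_eq_zero] at ha
      simp [ha]
    · refine ⟨a, a⁻¹ • x, ?_, ?_, ha⟩
      · rw [mem_stdLattice, norm_smul, norm_inv, ha, inv_mul_cancel₀ (by simpa using h0)]
      · rw [smul_inv_smul₀ h0]
  · rintro r ⟨a, y, hy, rfl, rfl⟩
    rw [norm_smul]
    exact mul_le_of_le_one_right (norm_nonneg _) hy

/-- Every lattice is free over `O_∞`, hence a translate of the standard one. -/
theorem exists_eq_smul_stdLattice (L : P.Lattice) :
    ∃ g : GL (Fin 2) P.Kinf, L = g • P.stdLattice := by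
  have hL := L.2
  have hfree : Module.Free P.Oinf L.1 := Submodule.IsLattice.free P.Kinf L.1
  have hrank : Module.finrank P.Oinf L.1 = 2 := by
    rw [Submodule.IsLattice.finrank_of_pi P.Kinf L.1, Fintype.card_fin]
  let b : Module.Basis (Fin 2) P.Oinf L.1 :=
    (Module.finBasis P.Oinf L.1).reindex (finCongr hrank)
  let b' := b.extendOfIsLattice P.Kinf
  have hb' : ∀ i, b' i = (b i).1 := fun i => Module.Basis.extendOfIsLattice_apply _ _ _
  let B : Matrix (Fin 2) (Fin 2) P.Kinf := Matrix.of fun i => (b i).1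
  have hB : IsUnit B := by
    rw [← Matrix.linearIndependent_rows_iff_isUnit]
    have := b'.linearIndependent
    rw [show B.row = b' from funext fun i => (hb' i).symm]
    exact this
  obtain ⟨u, hu⟩ := hB
  refine ⟨u⁻¹, Subtype.ext (Submodule.ext fun x => ?_)⟩
  rw [mem_smul_lattice, mem_stdLattice]
  have hmul : ∀ y : Fin 2 → P.Kinf, Matrix.vecMul y u.1 = y 0 • (b 0).1 + y 1 • (b 1).1 := by
    intro y
    rw [hu]
    funext j
    simp [Matrix.vecMul, dotProduct, B]
  constructor
  · intro hx
    have h1 : x = rowMap u⁻¹ (fun i => (b.repr ⟨x, hx⟩ i : P.Kinf)) := by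
      rw [rowMap_inv_apply, hmul]
      have := congrArg Subtype.val (b.sum_repr ⟨x, hx⟩)
      simp only [Fin.sum_univ_two, Submodule.coe_add, Submodule.coe_smul] at this
      exact this.symm
    rw [h1, inv_inv, rowMap_rowMap_inv, pi_norm_le_iff_of_nonneg zero_le_one]
    exact fun i => (mem_Oinf_iff _).1 (b.repr ⟨x, hx⟩ i).2
  · intro hx
    rw [inv_inv] at hx
    rw [pi_norm_le_iff_of_nonneg zero_le_one] at hx
    have h1 : x = rowMap u⁻¹ (rowMap u x) := (rowMap_inv_rowMap u x).symm
    rw [h1, rowMap_inv_apply, hmul]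
    have h2 : ∀ (i : Fin 2), rowMap u x i • (b i).1 ∈ L.1 := fun i =>
      L.1.smul_mem (⟨_, (mem_Oinf_iff _).2 (hx i)⟩ : P.Oinf) (b i).2
    exact L.1.add_mem (h2 0) (h2 1)

theorem latticeNorm_smul_stdLattice (g : GL (Fin 2) P.Kinf) (x : Fin 2 → P.Kinf) :
    latticeNorm (g • P.stdLattice) x = ‖Matrix.vecMul x g.1‖ := by
  rw [latticeNorm_smul, latticeNorm_stdLattice]

theorem mem_lattice_iff (L : P.Lattice) (x : Fin 2 → P.Kinf) :
    x ∈ L.1 ↔ latticeNorm L x ≤ 1 := by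
  obtain ⟨g, rfl⟩ := exists_eq_smul_stdLattice L
  rw [latticeNorm_smul_stdLattice, mem_smul_lattice, mem_stdLattice, rowMap_inv_apply]

theorem lattice_ext {L L' : P.Lattice} (h : ∀ x, latticeNorm L x = latticeNorm L' x) : L = L' :=
  Subtype.ext (Submodule.ext fun x => by rw [mem_lattice_iff, mem_lattice_iff, h])

theorem exists_latticeNorm_eq (L : P.Lattice) (x : Fin 2 → P.Kinf) :
    ∃ a : P.Kinf, latticeNorm L x = ‖a‖ := by
  obtain ⟨g, rfl⟩ := exists_eq_smul_stdLattice L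
  rw [latticeNorm_smul_stdLattice]
  exact exists_norm_eq _

theorem latticeNorm_smul_vec (L : P.Lattice) (a : P.Kinf) (x : Fin 2 → P.Kinf) :
    latticeNorm L (a • x) = ‖a‖ * latticeNorm L x := by
  obtain ⟨g, rfl⟩ := exists_eq_smul_stdLattice L
  rw [latticeNorm_smul_stdLattice, latticeNorm_smul_stdLattice, Matrix.smul_vecMul, norm_smul]

theorem latticeNorm_add_le (L : P.Lattice) (x y : Fin 2 → P.Kinf) :
    latticeNorm L (x + y) ≤ max (latticeNorm L x) (latticeNorm L y) := by
  obtain ⟨g, rfl⟩ := exists_eq_smul_stdLattice L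
  simp only [latticeNorm_smul_stdLattice, Matrix.add_vecMul]
  exact IsUltrametricDist.norm_add_le_max _ _

/-- The norm of a lattice determines the homothety class up to a scalar factor. -/
theorem mkVertex_eq_iff {L L' : P.Lattice} :
    P.mkVertex L = P.mkVertex L' ↔
      ∃ c : P.Kinf, c ≠ 0 ∧ ∀ x, latticeNorm L x = ‖c‖ * latticeNorm L' x := by
  have key : ∀ (c : P.Kinfˣ) x, x ∈ c • L.1 ↔ latticeNorm L x ≤ ‖(c : P.Kinf)‖ := by
    intro c x
    have hc : 0 < ‖(c : P.Kinf)‖ := norm_pos_iff.2 c.ne_zero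
    refine (Submodule.mem_smul_pointwise_iff_exists x c _).trans ⟨?_, ?_⟩
    · rintro ⟨y, hy, rfl⟩
      rw [show c • y = (c : P.Kinf) • y from rfl, latticeNorm_smul_vec]
      exact mul_le_of_le_one_right hc.le ((mem_lattice_iff _ _).1 hy)
    · intro h
      refine ⟨c⁻¹ • x, ?_, smul_inv_smul _ _⟩
      rw [mem_lattice_iff, show c⁻¹ • x = ((c⁻¹ : P.Kinfˣ) : P.Kinf) • x from rfl,
        latticeNorm_smul_vec, Units.val_inv_eq_inv_val, norm_inv]
      exact (inv_mul_le_one₀ hc).2 h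
  constructor
  · intro h
    obtain ⟨c, hc⟩ := Quotient.exact h
    have hc0 : 0 < ‖(c : P.Kinf)‖ := norm_pos_iff.2 c.ne_zero
    refine ⟨c, c.ne_zero, ?_⟩
    -- both sides take values in the value group, so it suffices to compare closed balls
    have h1 : ∀ x, latticeNorm L' x ≤ 1 ↔ latticeNorm L x ≤ ‖(c : P.Kinf)‖ := fun x => by
      rw [← mem_lattice_iff, hc, key]
    have h2 : ∀ x (a : P.Kinf), a ≠ 0 →
        (latticeNorm L' x ≤ ‖a‖ ↔ latticeNorm L x ≤ ‖(c : P.Kinf)‖ * ‖a‖) := by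
      intro x a ha
      have ha' : 0 < ‖a‖ := norm_pos_iff.2 ha
      have := h1 (a⁻¹ • x)
      rwa [latticeNorm_smul_vec, latticeNorm_smul_vec, norm_inv, inv_mul_le_one₀ ha',
        inv_mul_le_iff₀ ha', mul_comm ‖a‖] at this
    intro x
    have hpos : ∀ (M : P.Lattice) x, x ≠ 0 → ∃ a : P.Kinf, a ≠ 0 ∧ latticeNorm M x = ‖a‖ := by
      intro M x hx
      obtain ⟨a, ha⟩ := exists_latticeNorm_eq M x
      refine ⟨a, ?_, ha⟩
      rintro rfl
      obtain ⟨g, rfl⟩ := exists_eq_smul_stdLattice M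
      rw [latticeNorm_smul_stdLattice, norm_zero, norm_eq_zero, ← rowMap_inv_apply] at ha
      exact hx (by rw [← rowMap_rowMap_inv g x, ha, map_zero])
    rcases eq_or_ne x 0 with rfl | hx
    · have : ∀ M : P.Lattice, latticeNorm M 0 = 0 := fun M => by
        simpa using latticeNorm_smul_vec M 0 0
      rw [this, this, mul_zero]
    · obtain ⟨a, ha0, ha⟩ := hpos L' x hx
      obtain ⟨b, hb0, hb⟩ := hpos L x hx
      refine le_antisymm ?_ ?_
      · rw [ha]; exact (h2 x a ha0).1 ha.le
      · have h3 : (c : P.Kinf)⁻¹ * b ≠ 0 := mul_ne_zero (inv_ne_zero c.ne_zero) hb0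
        have h4 := (h2 x _ h3).2 (by
          rw [norm_mul, norm_inv, hb, mul_inv_cancel_left₀ hc0.ne'])
        rwa [norm_mul, norm_inv, ← hb, le_inv_mul_iff₀ hc0] at h4
  · rintro ⟨c, hc, h⟩
    refine Quotient.sound ⟨Units.mk0 c hc, Submodule.ext fun x => ?_⟩
    rw [key, mem_lattice_iff, h, Units.val_mk0,
      mul_le_iff_le_one_right (norm_pos_iff.2 hc)]

end Lattice
end Drinfeld.Place

namespace Drinfeld.Place

/-! ### The building map -/

section Building
variable {F K : Type*} [Field F] [Field K] [Algebra F K] {P : Place F K}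

theorem coe_smul_Omega (g : GL (Fin 2) P.Kinf) (ω : P.Omega) :
    (g • ω).1 = num g ω.1 / den g ω.1 := rfl

theorem smul_Omega_def (g : P.G) (ω : P.Omega) : g • ω = P.toGLinf g • ω := rfl

theorem smul_Vertex_def (g : P.G) (v : P.Vertex) : g • v = P.toGLinf g • v := rfl

theorem smul_mkVertex (g : GL (Fin 2) P.Kinf) (L : P.Lattice) :
    g • P.mkVertex L = P.mkVertex (g • L) := rfl

/-- The linear form `(x₀, x₁) ↦ x₀ ω + x₁`, whose absolute value is the norm defining the
building map. -/
def linForm (ω : P.Omega) (x : Fin 2 → P.Kinf) : P.Cinf :=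
  algebraMap P.Kinf P.Cinf (x 0) * ω.1 + algebraMap P.Kinf P.Cinf (x 1)

theorem buildingMapsTo_iff {ω : P.Omega} {v : P.Vertex} :
    BuildingMapsTo ω v ↔ ∃ L : P.Lattice, P.mkVertex L = v ∧
      ∀ x, ‖linForm ω x‖ = latticeNorm L x := Iff.rfl

theorem linForm_smul (g : GL (Fin 2) P.Kinf) (ω : P.Omega) (x : Fin 2 → P.Kinf) :
    linForm (g • ω) x * den g ω.1 = linForm ω (Matrix.vecMul x g.1) := by
  have hd := den_ne_zero g ω
  rw [linForm, coe_smul_Omega, add_mul, mul_assoc, div_mul_cancel₀ _ hd, linForm, num, den]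
  simp only [Matrix.vecMul, dotProduct, Fin.sum_univ_two, map_add, map_mul]
  ring

theorem linForm_row_one (g : GL (Fin 2) P.Kinf) (ω : P.Omega) :
    linForm ω (g.1 1) = den g ω.1 := rfl

theorem BuildingMapsTo.smul {ω : P.Omega} {v : P.Vertex} (h : BuildingMapsTo ω v)
    (g : GL (Fin 2) P.Kinf) : BuildingMapsTo (g • ω) (g • v) := by
  obtain ⟨L, rfl, hL⟩ := buildingMapsTo_iff.1 h
  have hd := den_ne_zero g ω
  -- the value of the norm at a vector lies in the value group of `K_∞`
  obtain ⟨a, ha⟩ := exists_latticeNorm_eq L (g.1 1)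
  rw [← hL, linForm_row_one] at ha
  have ha0 : a ≠ 0 := by
    rintro rfl
    rw [norm_zero, norm_eq_zero] at ha
    exact hd ha
  let s : GL (Fin 2) P.Kinf := Matrix.GeneralLinearGroup.scalar (Fin 2) (Units.mk0 a ha0)⁻¹
  have hs : ∀ x, latticeNorm (s • g • L) x = ‖a‖⁻¹ * latticeNorm (g • L) x := by
    intro x
    rw [latticeNorm_smul, ← norm_inv, ← latticeNorm_smul_vec]
    congr 1
    simp only [s, Matrix.GeneralLinearGroup.coe_scalar]
    funext i
    fin_cases i <;> simp [Matrix.vecMul, dotProduct, Fin.sum_univ_two, mul_comm]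
  refine ⟨s • g • L, ?_, fun x => ?_⟩
  · exact mkVertex_eq_iff.2 ⟨a⁻¹, inv_ne_zero ha0, fun x => by rw [hs, norm_inv]⟩
  · rw [hs, latticeNorm_smul, ← hL, ← linForm_smul, norm_mul, ha,
      mul_comm ‖linForm _ _‖, inv_mul_cancel_left₀ (by simpa using ha0)]
    rfl

theorem BuildingMapsTo.smul_G {ω : P.Omega} {v : P.Vertex} (h : BuildingMapsTo ω v)
    (g : P.G) : BuildingMapsTo (g • ω) (g • v) := h.smul (P.toGLinf g)

theorem BuildingMapsTo.unique {ω : P.Omega} {v v' : P.Vertex} (h : BuildingMapsTo ω v)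
    (h' : BuildingMapsTo ω v') : v = v' := by
  obtain ⟨L, rfl, hL⟩ := h
  obtain ⟨L', rfl, hL'⟩ := h'
  rw [lattice_ext fun x => (hL x).symm.trans (hL' x)]

variable (P) in
/-- The class of the standard lattice. -/
def stdVertex : P.Vertex := P.mkVertex P.stdLattice

theorem exists_eq_smul_stdVertex (v : P.Vertex) :
    ∃ h : GL (Fin 2) P.Kinf, v = h • P.stdVertex := by
  obtain ⟨L, rfl⟩ : ∃ L, P.mkVertex L = v := Quotient.exists_rep v
  obtain ⟨h, rfl⟩ := exists_eq_smul_stdLattice L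
  exact ⟨h, rfl⟩

/-! ### Stabilizers of vertices -/

theorem norm_mul_apply_le {X Y : Matrix (Fin 2) (Fin 2) P.Kinf} {a b : ℝ}
    (hX : ∀ i j, ‖X i j‖ ≤ a) (hY : ∀ i j, ‖Y i j‖ ≤ b) (i j : Fin 2) :
    ‖(X * Y) i j‖ ≤ a * b := by
  rw [Matrix.mul_apply, Fin.sum_univ_two]
  have ha : 0 ≤ a := (norm_nonneg _).trans (hX 0 0)
  have h : ∀ k, ‖X i k * Y k j‖ ≤ a * b := fun k => by
    rw [norm_mul]
    exact mul_le_mul (hX i k) (hY k j) (norm_nonneg _) ha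
  exact (IsUltrametricDist.norm_add_le_max _ _).trans (max_le (h 0) (h 1))

theorem norm_vecMul_le {X : Matrix (Fin 2) (Fin 2) P.Kinf} {a : ℝ}
    (hX : ∀ i j, ‖X i j‖ ≤ a) (x : Fin 2 → P.Kinf) : ‖Matrix.vecMul x X‖ ≤ a * ‖x‖ := by
  have ha : 0 ≤ a := (norm_nonneg _).trans (hX 0 0)
  rw [pi_norm_le_iff_of_nonneg (by positivity)]
  intro j
  simp only [Matrix.vecMul, dotProduct, Fin.sum_univ_two]
  have h : ∀ k, ‖x k * X k j‖ ≤ a * ‖x‖ := fun k => by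
    rw [norm_mul, mul_comm]
    exact mul_le_mul (hX k j) (norm_le_pi_norm x k) (norm_nonneg _) ha
  exact (IsUltrametricDist.norm_add_le_max _ _).trans (max_le (h 0) (h 1))

theorem norm_apply_le_of_vecMul {X : Matrix (Fin 2) (Fin 2) P.Kinf} {a : ℝ}
    (h : ∀ x, ‖Matrix.vecMul x X‖ ≤ a * ‖x‖) (i j : Fin 2) : ‖X i j‖ ≤ a := by
  have h1 := h (Pi.single i 1)
  rw [Matrix.single_one_vecMul, Pi.norm_single, norm_one, mul_one] at h1
  exact (norm_le_pi_norm (X i) j).trans h1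

theorem norm_det_le {X : Matrix (Fin 2) (Fin 2) P.Kinf} {a : ℝ}
    (hX : ∀ i j, ‖X i j‖ ≤ a) : ‖X.det‖ ≤ a ^ 2 := by
  have ha : 0 ≤ a := (norm_nonneg _).trans (hX 0 0)
  rw [Matrix.det_fin_two, sub_eq_add_neg]
  refine (IsUltrametricDist.norm_add_le_max _ _).trans (max_le ?_ ?_)
  · rw [norm_mul, sq]; exact mul_le_mul (hX _ _) (hX _ _) (norm_nonneg _) ha
  · rw [norm_neg, norm_mul, sq]; exact mul_le_mul (hX _ _) (hX _ _) (norm_nonneg _) ha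

/-- The stabilizer of the standard vertex among the matrices with unit determinant
is `GL₂(O_∞)`. -/
theorem smul_stdVertex_eq_iff {m : GL (Fin 2) P.Kinf} (hm : ‖m.1.det‖ = 1) :
    m • P.stdVertex = P.stdVertex ↔ ∀ i j, ‖m i j‖ ≤ 1 := by
  have hinv : ∀ x, Matrix.vecMul (Matrix.vecMul x m.1) (m⁻¹ : GL (Fin 2) P.Kinf).1 = x := by
    intro x
    rw [Matrix.vecMul_vecMul, ← Units.val_mul, mul_inv_cancel, Units.val_one, Matrix.vecMul_one]
  have hinv' : ∀ x, Matrix.vecMul (Matrix.vecMul x (m⁻¹ : GL (Fin 2) P.Kinf).1) m.1 = x := by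
    intro x
    rw [Matrix.vecMul_vecMul, ← Units.val_mul, inv_mul_cancel, Units.val_one, Matrix.vecMul_one]
  have hm' : ‖(m⁻¹ : GL (Fin 2) P.Kinf).1.det‖ = 1 := by
    rw [Matrix.coe_units_inv, Matrix.det_nonsing_inv, Ring.inverse_eq_inv', norm_inv, hm, inv_one]
  rw [stdVertex, smul_mkVertex, mkVertex_eq_iff]
  simp only [latticeNorm_smul_stdLattice, latticeNorm_stdLattice]
  constructor
  · rintro ⟨c, hc, h⟩
    have hc0 : 0 < ‖c‖ := norm_pos_iff.2 hc
    have h1 := norm_det_le (norm_apply_le_of_vecMul fun x => (h x).le)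
    have h2 := norm_det_le (X := (m⁻¹ : GL (Fin 2) P.Kinf).1) (a := ‖c‖⁻¹)
      (norm_apply_le_of_vecMul fun x => by
        have := h (Matrix.vecMul x (m⁻¹ : GL (Fin 2) P.Kinf).1)
        rw [hinv'] at this
        rw [this, inv_mul_cancel_left₀ hc0.ne'])
    rw [hm] at h1
    rw [hm', inv_pow, one_le_inv₀ (by positivity)] at h2
    have h3 : ‖c‖ = 1 := by nlinarith
    intro i j
    exact h3 ▸ norm_apply_le_of_vecMul (fun x => (h x).le) i j
  · intro h
    refine ⟨1, one_ne_zero, fun x => ?_⟩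
    rw [norm_one, one_mul]
    refine le_antisymm (by simpa using norm_vecMul_le h x) ?_
    have h' : ∀ i j, ‖(m⁻¹ : GL (Fin 2) P.Kinf).1 i j‖ ≤ 1 := by
      intro i j
      rw [Matrix.coe_units_inv, Matrix.inv_def, Matrix.smul_apply, smul_eq_mul, norm_mul,
        Ring.inverse_eq_inv', norm_inv, hm, inv_one, one_mul, Matrix.adjugate_fin_two]
      fin_cases i <;> fin_cases j <;> simpa using h _ _
    simpa [hinv] using norm_vecMul_le h' (Matrix.vecMul x m.1)

variable (P) in
/-- The inclusion of `A` into `K_∞`. -/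
def affineToKinf : P.affineRing →+* P.Kinf := (algebraMap K P.Kinf).comp P.affineRing.subtype

theorem affineToKinf_injective : Function.Injective P.affineToKinf :=
  (algebraMap K P.Kinf).injective.comp Subtype.val_injective

/-- The ring of the matrices over `A` that map the lattice `h • O_∞²` into itself. Its units are
the elements of `G` that fix the vertex of the lattice. -/
def orderAt (h : GL (Fin 2) P.Kinf) : Subring (Matrix (Fin 2) (Fin 2) P.affineRing) where
  carrier := {X | ∀ i j, ‖((h⁻¹ : GL (Fin 2) P.Kinf).1 * X.map P.affineToKinf * h.1) i j‖ ≤ 1}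
  mul_mem' {X Y} hX hY i j := by
    have hh : h.1 * (h⁻¹ : GL (Fin 2) P.Kinf).1 = 1 := by
      rw [← Units.val_mul, mul_inv_cancel, Units.val_one]
    have e : (h⁻¹ : GL (Fin 2) P.Kinf).1 * (X * Y).map P.affineToKinf * h.1 =
        ((h⁻¹ : GL (Fin 2) P.Kinf).1 * X.map P.affineToKinf * h.1) *
          ((h⁻¹ : GL (Fin 2) P.Kinf).1 * Y.map P.affineToKinf * h.1) := by
      rw [Matrix.map_mul]
      simp only [Matrix.mul_assoc]
      rw [← Matrix.mul_assoc h.1 (h⁻¹ : GL (Fin 2) P.Kinf).1, hh, Matrix.one_mul]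
    have := norm_mul_apply_le hX hY i j
    rw [e]
    rwa [one_mul] at this
  one_mem' i j := by
    rw [Matrix.map_one _ (map_zero _) (map_one _), Matrix.mul_one, ← Units.val_mul,
      inv_mul_cancel, Units.val_one, Matrix.one_apply]
    split_ifs <;> simp
  add_mem' {X Y} hX hY i j := by
    rw [Matrix.map_add _ (map_add _), Matrix.mul_add, Matrix.add_mul, Matrix.add_apply]
    exact (IsUltrametricDist.norm_add_le_max _ _).trans (max_le (hX i j) (hY i j))
  zero_mem' i j := by simp
  neg_mem' {X} hX i j := by
    rw [show (-X).map P.affineToKinf = -X.map P.affineToKinf from Matrix.map_neg _ (map_neg _) _,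
      Matrix.mul_neg, Matrix.neg_mul, Matrix.neg_apply, norm_neg]
    exact hX i j

theorem mem_orderAt {h : GL (Fin 2) P.Kinf} {X : Matrix (Fin 2) (Fin 2) P.affineRing} :
    X ∈ orderAt h ↔
      ∀ i j, ‖((h⁻¹ : GL (Fin 2) P.Kinf).1 * X.map P.affineToKinf * h.1) i j‖ ≤ 1 := Iff.rfl

theorem norm_det_le_one_of_mem_orderAt {h : GL (Fin 2) P.Kinf}
    {X : Matrix (Fin 2) (Fin 2) P.affineRing} (hX : X ∈ orderAt h) :
    ‖P.affineToKinf X.det‖ ≤ 1 := by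
  have h1 := norm_det_le hX
  rw [Matrix.det_mul, Matrix.det_mul, mul_right_comm, ← Matrix.det_mul, ← Units.val_mul,
    inv_mul_cancel, Units.val_one, Matrix.det_one, one_mul, one_pow] at h1
  rwa [RingHom.map_det]

theorem norm_trace_le_one_of_mem_orderAt {h : GL (Fin 2) P.Kinf}
    {X : Matrix (Fin 2) (Fin 2) P.affineRing} (hX : X ∈ orderAt h) :
    ‖P.affineToKinf X.trace‖ ≤ 1 := by
  have h1 : P.affineToKinf X.trace =
      ((h⁻¹ : GL (Fin 2) P.Kinf).1 * X.map P.affineToKinf * h.1).trace := by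
    rw [Matrix.trace_mul_comm, ← Matrix.mul_assoc, ← Units.val_mul, mul_inv_cancel, Units.val_one,
      Matrix.one_mul, Matrix.trace_fin_two, Matrix.trace_fin_two, map_add]
    rfl
  rw [h1, Matrix.trace_fin_two]
  exact (IsUltrametricDist.norm_add_le_max _ _).trans (max_le (hX 0 0) (hX 1 1))

/-- An order is closed under multiplication by the scalars of absolute value at most one. -/
theorem smul_mem_orderAt {h : GL (Fin 2) P.Kinf} {X : Matrix (Fin 2) (Fin 2) P.affineRing}
    (hX : X ∈ orderAt h) {a : P.affineRing} (ha : ‖P.affineToKinf a‖ ≤ 1) :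
    a • X ∈ orderAt h := by
  intro i j
  have : (a • X).map P.affineToKinf = P.affineToKinf a • X.map P.affineToKinf := by
    ext i j; simp
  rw [this, Matrix.mul_smul, Matrix.smul_mul, Matrix.smul_apply, smul_eq_mul, norm_mul]
  exact mul_le_one₀ ha (norm_nonneg _) (hX i j)

end Building

section Units
variable {F K : Type*} [Field F] [Finite F] [Field K] [Algebra F K] {P : Place F K}

theorem norm_affineToKinf_constA {a : F} (ha : a ≠ 0) :
    ‖P.affineToKinf (P.constA a)‖ = 1 := by
  rw [← norm_algebraMap_Cinf]
  refine norm_eq_one_of_pow_card_sq (F := F) ?_ ?_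
  · have := pow_card_map (P.constC) a
    rw [pow_card_sq]
    change ((P.constC a) ^ _) ^ _ = P.constC a
    rw [this, this]
  · exact (map_ne_zero P.constC).2 ha

theorem norm_affineToKinf_constA_le (a : F) : ‖P.affineToKinf (P.constA a)‖ ≤ 1 := by
  rcases eq_or_ne a 0 with rfl | ha
  · simp
  · exact (norm_affineToKinf_constA ha).le

/-- The units of `A` are the nonzero constants. -/
theorem exists_const_of_isUnit (hK : IsFunctionField F K) {u : P.affineRing} (hu : IsUnit u) :
    ∃ a : F, a ≠ 0 ∧ u = P.constA a := by
  obtain ⟨w, hw⟩ := hu.exists_right_inv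
  have hn : ‖P.affineToKinf u‖ * ‖P.affineToKinf w‖ = 1 := by
    rw [← norm_mul, ← map_mul, hw, map_one, norm_one]
  rcases le_total ‖P.affineToKinf u‖ 1 with h | h
  · obtain ⟨a, rfl⟩ := exists_const_of_norm_le_one hK h
    refine ⟨a, ?_, rfl⟩
    rintro rfl
    simp at hn
  · have h' : ‖P.affineToKinf w‖ ≤ 1 := by nlinarith [norm_nonneg (P.affineToKinf w)]
    obtain ⟨a, rfl⟩ := exists_const_of_norm_le_one hK h'
    have ha : a ≠ 0 := by
      rintro rfl
      simp at hn
    refine ⟨a⁻¹, inv_ne_zero ha, ?_⟩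
    have h1 : P.constA a * P.constA a⁻¹ = 1 := by rw [← map_mul, mul_inv_cancel₀ ha, map_one]
    calc u = u * (P.constA a * P.constA a⁻¹) := by rw [h1, mul_one]
      _ = P.constA a⁻¹ := by rw [← mul_assoc, hw, one_mul]

theorem exists_const_det (hK : IsFunctionField F K) (g : P.G) :
    ∃ a : F, a ≠ 0 ∧ g.1.det = P.constA a :=
  exists_const_of_isUnit hK ((Matrix.isUnit_iff_isUnit_det _).1 g.isUnit)

theorem norm_det_toGLinf (hK : IsFunctionField F K) (g : P.G) :
    ‖(P.toGLinf g).1.det‖ = 1 := by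
  obtain ⟨a, ha, h⟩ := exists_const_det hK g
  have : (P.toGLinf g).1.det = P.affineToKinf g.1.det := by
    rw [RingHom.map_det]; rfl
  rw [this, h, norm_affineToKinf_constA ha]

/-- The stabilizer of a vertex is the group of units of an order. -/
theorem smul_vertex_eq_iff (hK : IsFunctionField F K) (g : P.G) (h : GL (Fin 2) P.Kinf) :
    g • h • P.stdVertex = h • P.stdVertex ↔ g.1 ∈ orderAt h := by
  rw [smul_Vertex_def, ← inv_smul_eq_iff, smul_smul, smul_smul,
    smul_stdVertex_eq_iff]
  · rfl
  · rw [Units.val_mul, Units.val_mul, Matrix.det_mul, Matrix.det_mul, mul_right_comm,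
      ← Matrix.det_mul, ← Units.val_mul, inv_mul_cancel, Units.val_one, Matrix.det_one, one_mul,
      norm_det_toGLinf hK]

theorem exists_const_of_mem_orderAt (hK : IsFunctionField F K) {h : GL (Fin 2) P.Kinf}
    {X : Matrix (Fin 2) (Fin 2) P.affineRing} (hX : X ∈ orderAt h) :
    ∃ t n : F, X.trace = P.constA t ∧ X.det = P.constA n := by
  obtain ⟨t, ht⟩ := exists_const_of_norm_le_one hK (norm_trace_le_one_of_mem_orderAt hX)
  obtain ⟨n, hn⟩ := exists_const_of_norm_le_one hK (norm_det_le_one_of_mem_orderAt hX)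
  exact ⟨t, n, ht, hn⟩

/-- `A` is a discrete subset of `K_∞`, with finite balls. -/
theorem finite_norm_le (hK : IsFunctionField F K) (hδ : Odd P.degree) (R : ℝ) :
    {a : P.affineRing | ‖P.affineToKinf a‖ ≤ R}.Finite := by
  classical
  obtain ⟨ϖ, hϖ⟩ := IsDiscreteValuationRing.exists_irreducible P.ring
  have hfin : FiniteDimensional F (IsLocalRing.ResidueField P.ring) :=
    FiniteDimensional.of_finrank_pos hδ.pos
  have hk : Finite (IsLocalRing.ResidueField P.ring) := Module.finite_of_finite F
  have hB : ∀ n : ℕ, {a : P.affineRing | (ϖ : K) ^ n * a ∈ P.ring}.Finite := by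
    intro n
    induction n with
    | zero =>
      refine (Set.finite_range P.constA).subset fun a ha => ?_
      simp only [pow_zero, one_mul, Set.mem_ofPred_eq, mem_ring_iff] at ha
      obtain ⟨f, hf⟩ := exists_const_of_norm_le_one hK ha
      exact ⟨f, hf.symm⟩
    | succ n ih =>
      refine Set.Finite.of_finite_fibers
        (fun a : P.affineRing => if ha : (ϖ : K) ^ (n + 1) * a ∈ P.ring then
          IsLocalRing.residue P.ring ⟨_, ha⟩ else 0) (Set.toFinite _) ?_
      rintro x -
      rcases Set.eq_empty_or_nonempty ({a : P.affineRing | (ϖ : K) ^ (n + 1) * a ∈ P.ring} ∩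
        (fun a : P.affineRing => if ha : (ϖ : K) ^ (n + 1) * a ∈ P.ring then
          IsLocalRing.residue P.ring ⟨_, ha⟩ else 0) ⁻¹' {x}) with h0 | ⟨b, hb, hbx⟩
      · rw [h0]; exact Set.finite_empty
      refine (ih.image (· + b)).subset ?_
      rintro a ⟨ha, hax⟩
      refine ⟨a - b, ?_, sub_add_cancel a b⟩
      have ha' : (ϖ : K) ^ (n + 1) * a ∈ P.ring := ha
      have hb' : (ϖ : K) ^ (n + 1) * b ∈ P.ring := hb
      simp only [Set.mem_preimage, Set.mem_singleton_iff, dif_pos ha'] at hax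
      simp only [Set.mem_preimage, Set.mem_singleton_iff, dif_pos hb'] at hbx
      have h1 := sub_eq_zero.2 (hax.trans hbx.symm)
      rw [← map_sub, IsLocalRing.residue_eq_zero_iff, hϖ.maximalIdeal_eq,
        Ideal.mem_span_singleton] at h1
      obtain ⟨c, hc⟩ := h1
      have h2 : (ϖ : K) ^ (n + 1) * a - (ϖ : K) ^ (n + 1) * b = ϖ * c := congrArg Subtype.val hc
      have hϖ0 : (ϖ : K) ≠ 0 := fun h => hϖ.ne_zero (Subtype.ext h)
      have h3 : (ϖ : K) ^ n * (a - b : P.affineRing) = c := by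
        refine mul_left_cancel₀ hϖ0 ?_
        rw [← h2, AddSubgroupClass.coe_sub]; ring
      change (ϖ : K) ^ n * (a - b : P.affineRing) ∈ P.ring
      rw [h3]; exact c.2
  have h1 : ‖algebraMap K P.Kinf ϖ‖ < 1 := by
    rw [norm_algebraMap_lt_one_iff, IsLocalRing.residue_eq_zero_iff, hϖ.maximalIdeal_eq]
    exact Ideal.mem_span_singleton_self ϖ
  obtain ⟨n, hn⟩ := exists_pow_lt_of_lt_one (show (0 : ℝ) < (max R 1)⁻¹ by positivity) h1
  refine (hB n).subset fun a ha => ?_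
  change (ϖ : K) ^ n * a ∈ P.ring
  rw [mem_ring_iff, map_mul, map_pow, norm_mul, norm_pow]
  have ha' : ‖algebraMap K P.Kinf a‖ ≤ max R 1 := le_max_of_le_left ha
  calc _ ≤ (max R 1)⁻¹ * max R 1 := mul_le_mul hn.le ha' (norm_nonneg _) (by positivity)
    _ = 1 := inv_mul_cancel₀ (by positivity)

/-- An order consists of matrices over `A` with bounded entries. -/
theorem finite_orderAt (hK : IsFunctionField F K) (hδ : Odd P.degree) (h : GL (Fin 2) P.Kinf) :
    Finite (orderAt h) := by
  have hbd : ∀ m : Matrix (Fin 2) (Fin 2) P.Kinf, ∃ C : ℝ, ∀ i j, ‖m i j‖ ≤ C := fun m =>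
    ⟨max ‖m 0‖ ‖m 1‖, fun i j => (norm_le_pi_norm (m i) j).trans (by fin_cases i <;> simp)⟩
  obtain ⟨a, ha⟩ := hbd h.1
  obtain ⟨b, hb⟩ := hbd (h⁻¹ : GL (Fin 2) P.Kinf).1
  have hf := (Set.Finite.pi' fun _ : Fin 2 => Set.Finite.pi' fun _ : Fin 2 =>
    finite_norm_le hK hδ (a * 1 * b))
  refine (hf.subset fun (X : Matrix (Fin 2) (Fin 2) P.affineRing) hX => ?_ : Set.Finite
    ((orderAt h : Set (Matrix (Fin 2) (Fin 2) P.affineRing)))).to_subtype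
  intro i j
  have h1 := norm_mul_apply_le (norm_mul_apply_le ha hX) hb i j
  have hh : h.1 * (h⁻¹ : GL (Fin 2) P.Kinf).1 = 1 := by
    rw [← Units.val_mul, mul_inv_cancel, Units.val_one]
  have h2 : h.1 * ((h⁻¹ : GL (Fin 2) P.Kinf).1 * X.map P.affineToKinf * h.1) *
      (h⁻¹ : GL (Fin 2) P.Kinf).1 = X.map P.affineToKinf := by
    simp only [Matrix.mul_assoc]
    rw [hh, Matrix.mul_one, ← Matrix.mul_assoc, hh, Matrix.one_mul]
  rw [h2] at h1
  exact h1

theorem finite_stabilizer (hK : IsFunctionField F K) (hδ : Odd P.degree) (v : P.Vertex) :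
    Finite (MulAction.stabilizer P.G v) := by
  obtain ⟨h, rfl⟩ := exists_eq_smul_stdVertex v
  have := finite_orderAt hK hδ h
  refine Finite.of_injective (fun g : MulAction.stabilizer P.G (h • P.stdVertex) =>
    (⟨g.1.1, (smul_vertex_eq_iff hK _ _).1 g.2⟩ : orderAt h)) fun g g' hg => ?_
  exact Subtype.ext (Units.ext (congrArg Subtype.val hg))

theorem countable_field (hK : IsFunctionField F K) : Countable K := by
  obtain ⟨x, -, hx⟩ := hK.exists_finite
  have h1 : Countable (IntermediateField.adjoin F ({x} : Set K)) := by
    have : (Set.range (algebraMap F K) ∪ {x}).Countable :=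
      (Set.countable_range _).union (Set.countable_singleton x)
    have h2 := Subfield.cardinalMk_closure_le_max (Set.range (algebraMap F K) ∪ {x})
    have h3 := h2.trans (max_le (Cardinal.le_aleph0_iff_set_countable.2 this) le_rfl)
    exact Cardinal.mk_le_aleph0_iff.1 h3
  have h2 := Algebra.IsAlgebraic.cardinalMk_le_max
    (IntermediateField.adjoin F ({x} : Set K)) K
  exact Cardinal.mk_le_aleph0_iff.1 (h2.trans (max_le Cardinal.mk_le_aleph0 le_rfl))

theorem countable_G (hK : IsFunctionField F K) : Countable P.G := by
  have := countable_field hK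
  have h1 : Countable P.affineRing := Subtype.val_injective.countable
  have h2 : Countable (Matrix (Fin 2) (Fin 2) P.affineRing) :=
    inferInstanceAs (Countable (Fin 2 → Fin 2 → P.affineRing))
  exact Units.val_injective.countable

end Units
end Drinfeld.Place

namespace Drinfeld

/-- The roots of a quadratic polynomial over a field with `q` elements are permuted by
`x ↦ x ^ q`. -/
theorem pow_card_eq_or_of_quadratic {F L : Type*} [Field F] [Finite F] [Field L] (f : F →+* L)
    {ε : L} {t n : F} (h : ε ^ 2 - f t * ε + f n = 0) :
    ε ^ Nat.card F = ε ∨ ε ^ Nat.card F = f t - ε := by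
  have h1 := congrArg (· ^ Nat.card F) h
  simp only [add_pow_card f, sub_pow_card f, mul_pow, pow_card_map,
    zero_pow (one_lt_natCard F).ne_bot] at h1
  rw [← pow_mul, mul_comm 2, pow_mul] at h1
  have : (ε ^ Nat.card F - ε) * (ε ^ Nat.card F - (f t - ε)) = 0 := by
    linear_combination h1 - h
  rcases mul_eq_zero.1 this with h2 | h2
  · exact Or.inl (sub_eq_zero.1 h2)
  · exact Or.inr (sub_eq_zero.1 h2)

theorem pow_card_sq_eq_of_quadratic {F L : Type*} [Field F] [Finite F] [Field L] (f : F →+* L)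
    {ε : L} {t n : F} (h : ε ^ 2 - f t * ε + f n = 0) : ε ^ Nat.card F ^ 2 = ε := by
  rcases pow_card_eq_or_of_quadratic f h with h1 | h1
  · rw [pow_card_sq, h1, h1]
  · rw [pow_card_sq, h1, sub_pow_card f, pow_card_map, h1, sub_sub_cancel]

/-- An element of `F_{q²}` that is not in `F_q` generates it. -/
theorem exists_eq_add_mul {F L : Type*} [Field F] [Finite F] [Field L] (f : F →+* L)
    {ε z : L} (h : ε ^ Nat.card F ^ 2 = ε) (h' : ε ^ Nat.card F ≠ ε)
    (hz : z ^ Nat.card F ^ 2 = z) : ∃ x y : F, z = f x + f y * ε := by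
  rw [pow_card_sq] at h hz
  have hne : ε ^ Nat.card F - ε ≠ 0 := sub_ne_zero.2 h'
  obtain ⟨y, hy⟩ := (pow_card_eq_self_iff f ((z ^ Nat.card F - z) / (ε ^ Nat.card F - ε))).1 (by
    rw [div_pow, sub_pow_card f, sub_pow_card f, h, hz, ← neg_sub, ← neg_sub (ε ^ Nat.card F),
      neg_div_neg_eq])
  rw [div_eq_iff hne] at hy
  obtain ⟨x, hx⟩ := (pow_card_eq_self_iff f (z - f y * ε)).1 (by
    rw [sub_pow_card f, mul_pow, pow_card_map]
    linear_combination hy)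
  exact ⟨x, y, by rw [← hx]; ring⟩

namespace Place

/-! ### Fixed points in `Ω` as eigenvectors -/

section Eigen
variable {F K : Type*} [Field F] [Field K] [Algebra F K] {P : Place F K}

variable (P) in
/-- The inclusion of `A` into `C_∞`. -/
def affineToCinf : P.affineRing →+* P.Cinf := (algebraMap P.Kinf P.Cinf).comp P.affineToKinf

theorem affineToCinf_injective : Function.Injective P.affineToCinf :=
  (algebraMap P.Kinf P.Cinf).injective.comp affineToKinf_injective

theorem affineToCinf_mem_range (a : P.affineRing) :
    P.affineToCinf a ∈ Set.range (algebraMap P.Kinf P.Cinf) := ⟨_, rfl⟩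

/-- The column vector `(ω, 1)` is an eigenvector of the matrix `X`, with eigenvalue `ε`. -/
def Eigen (X : Matrix (Fin 2) (Fin 2) P.affineRing) (ω : P.Omega) (ε : P.Cinf) : Prop :=
  P.affineToCinf (X 0 0) * ω.1 + P.affineToCinf (X 0 1) = ε * ω.1 ∧
    P.affineToCinf (X 1 0) * ω.1 + P.affineToCinf (X 1 1) = ε

theorem eq_zero_of_linear {ω : P.Omega} {c d : P.affineRing}
    (h : P.affineToCinf c * ω.1 + P.affineToCinf d = 0) : c = 0 ∧ d = 0 := by
  by_contra hcd
  refine linear_ne_zero ω.2 (c := P.affineToKinf c) (d := P.affineToKinf d) ?_ h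
  rw [Ne, Ne, map_eq_zero_iff _ affineToKinf_injective, map_eq_zero_iff _ affineToKinf_injective]
  tauto

theorem smul_eq_iff_num (g : P.G) (ω : P.Omega) :
    g • ω = ω ↔ num (P.toGLinf g) ω.1 = den (P.toGLinf g) ω.1 * ω.1 := by
  have hd := den_ne_zero (P.toGLinf g) ω
  refine Subtype.coe_inj.symm.trans ?_
  change num (P.toGLinf g) ω.1 / den (P.toGLinf g) ω.1 = ω.1 ↔ _
  rw [div_eq_iff hd, mul_comm]

/-- A matrix of `G` fixes `ω` if and only if `(ω, 1)` is an eigenvector. -/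
theorem smul_eq_iff_eigen (g : P.G) (ω : P.Omega) :
    g • ω = ω ↔ ∃ ε, Eigen g.1 ω ε := by
  rw [smul_eq_iff_num]
  constructor
  · exact fun h => ⟨_, h, rfl⟩
  · rintro ⟨ε, h1, h2⟩
    change P.affineToCinf (g 0 0) * ω.1 + P.affineToCinf (g 0 1) = _ at h1
    change _ = (P.affineToCinf (g 1 0) * ω.1 + P.affineToCinf (g 1 1)) * ω.1
    rw [show P.affineToCinf (g 1 0) * ω.1 + P.affineToCinf (g 1 1) = ε from h2, ← h1]
    rfl

namespace Eigen

variable {X Y : Matrix (Fin 2) (Fin 2) P.affineRing} {ω ω' : P.Omega} {ε ε' : P.Cinf}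

theorem smul_eq {g : P.G} (h : Eigen g.1 ω ε) : g • ω = ω := (smul_eq_iff_eigen g ω).2 ⟨_, h⟩

theorem unique (h : Eigen X ω ε) (h' : Eigen X ω ε') : ε = ε' := h.2.symm.trans h'.2

theorem scalar (a : P.affineRing) (ω : P.Omega) :
    Eigen (Matrix.scalar (Fin 2) a) ω (P.affineToCinf a) := by
  constructor <;> simp

theorem one (ω : P.Omega) : Eigen (1 : Matrix (Fin 2) (Fin 2) P.affineRing) ω 1 := by
  constructor <;> simp

theorem add (h : Eigen X ω ε) (h' : Eigen Y ω ε') : Eigen (X + Y) ω (ε + ε') := by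
  obtain ⟨h1, h2⟩ := h
  obtain ⟨h3, h4⟩ := h'
  constructor
  · simp only [Matrix.add_apply, map_add]; linear_combination h1 + h3
  · simp only [Matrix.add_apply, map_add]; linear_combination h2 + h4

theorem smul (h : Eigen X ω ε) (a : P.affineRing) :
    Eigen (a • X) ω (P.affineToCinf a * ε) := by
  obtain ⟨h1, h2⟩ := h
  constructor
  · simp only [Matrix.smul_apply, smul_eq_mul, map_mul]
    linear_combination P.affineToCinf a * h1
  · simp only [Matrix.smul_apply, smul_eq_mul, map_mul]
    linear_combination P.affineToCinf a * h2

theorem sub (h : Eigen X ω ε) (h' : Eigen Y ω ε') : Eigen (X - Y) ω (ε - ε') := by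
  have := h.add (h'.smul (-1))
  rw [map_neg, map_one, neg_one_mul, neg_one_smul] at this
  rwa [sub_eq_add_neg, sub_eq_add_neg]

theorem mul (h : Eigen X ω ε) (h' : Eigen Y ω ε') : Eigen (X * Y) ω (ε * ε') := by
  obtain ⟨h1, h2⟩ := h
  obtain ⟨h3, h4⟩ := h'
  constructor
  · simp only [Matrix.mul_apply, Fin.sum_univ_two, map_add, map_mul]
    linear_combination P.affineToCinf (X 0 0) * h3 + P.affineToCinf (X 0 1) * h4 + ε' * h1
  · simp only [Matrix.mul_apply, Fin.sum_univ_two, map_add, map_mul]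
    linear_combination P.affineToCinf (X 1 0) * h3 + P.affineToCinf (X 1 1) * h4 + ε' * h2

/-- A matrix over `A` is determined by its eigenvalue at `ω`, since `ω ∉ K_∞`. -/
theorem matrix_eq (h : Eigen X ω ε) (h' : Eigen Y ω ε) : X = Y := by
  obtain ⟨h1, h2⟩ := h.sub h'
  rw [sub_self, zero_mul] at h1
  rw [sub_self] at h2
  obtain ⟨h3, h4⟩ := eq_zero_of_linear h1
  obtain ⟨h5, h6⟩ := eq_zero_of_linear h2
  rw [← sub_eq_zero]
  ext i j
  fin_cases i <;> fin_cases j <;> simp_all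

theorem charpoly (h : Eigen X ω ε) :
    ε ^ 2 - P.affineToCinf X.trace * ε + P.affineToCinf X.det = 0 := by
  obtain ⟨h1, h2⟩ := h
  rw [Matrix.trace_fin_two, Matrix.det_fin_two]
  simp only [map_add, map_sub, map_mul]
  -- eliminate `ω` from the two equations of the eigenvector
  linear_combination (P.affineToCinf (X 0 0) - ε) * h2 - P.affineToCinf (X 1 0) * h1

theorem apply_one_zero_ne (h : Eigen X ω ε)
    (hX : ∀ a : P.affineRing, X ≠ Matrix.scalar (Fin 2) a) : X 1 0 ≠ 0 := by
  intro h0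
  have h2 := h.2
  rw [h0, map_zero, zero_mul, zero_add] at h2
  exact hX (X 1 1) (h.matrix_eq (h2 ▸ scalar (X 1 1) ω))

theorem notMem_range (h : Eigen X ω ε)
    (hX : ∀ a : P.affineRing, X ≠ Matrix.scalar (Fin 2) a) :
    ε ∉ Set.range (algebraMap P.Kinf P.Cinf) := by
  rintro ⟨e, he⟩
  refine linear_ne_zero ω.2 (c := P.affineToKinf (X 1 0)) (d := P.affineToKinf (X 1 1) - e)
    (Or.inl ((map_ne_zero_iff _ affineToKinf_injective).2 (h.apply_one_zero_ne hX))) ?_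
  rw [map_sub, he]
  have h2 := h.2
  simp only [affineToCinf, RingHom.comp_apply] at h2
  linear_combination h2

theorem point_eq (h : Eigen X ω ε) (h' : Eigen X ω' ε)
    (hX : ∀ a : P.affineRing, X ≠ Matrix.scalar (Fin 2) a) : ω = ω' := by
  have hc : P.affineToCinf (X 1 0) ≠ 0 :=
    (map_ne_zero_iff _ affineToCinf_injective).2 (h.apply_one_zero_ne hX)
  refine Subtype.ext (mul_left_cancel₀ hc ?_)
  linear_combination h.2 - h'.2

/-- Every eigenvalue outside `K_∞` belongs to a fixed point in `Ω`. -/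
theorem exists_of_charpoly (hε : ε ∉ Set.range (algebraMap P.Kinf P.Cinf))
    (h : ε ^ 2 - P.affineToCinf X.trace * ε + P.affineToCinf X.det = 0) :
    ∃ ω : P.Omega, Eigen X ω ε := by
  have hd : X.det = X 0 0 * X 1 1 - X 0 1 * X 1 0 := Matrix.det_fin_two _
  have ht : X.trace = X 0 0 + X 1 1 := Matrix.trace_fin_two _
  rw [hd, ht] at h
  simp only [map_add, map_sub, map_mul] at h
  have hc : P.affineToCinf (X 1 0) ≠ 0 := by
    intro h0
    rw [h0] at h
    have : (ε - P.affineToCinf (X 0 0)) * (ε - P.affineToCinf (X 1 1)) = 0 := by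
      linear_combination h
    rcases mul_eq_zero.1 this with h1 | h1
    · exact hε (sub_eq_zero.1 h1 ▸ affineToCinf_mem_range _)
    · exact hε (sub_eq_zero.1 h1 ▸ affineToCinf_mem_range _)
  refine ⟨⟨(ε - P.affineToCinf (X 1 1)) / P.affineToCinf (X 1 0), ?_⟩, ?_, ?_⟩
  · rintro ⟨y, hy⟩
    rw [eq_div_iff hc] at hy
    refine hε ⟨y * P.affineToKinf (X 1 0) + P.affineToKinf (X 1 1), ?_⟩
    rw [map_add, map_mul]
    simp only [affineToCinf, RingHom.comp_apply] at hy ⊢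
    linear_combination hy
  · field_simp
    linear_combination -h
  · field_simp
    ring

end Eigen

/-- The eigenvalue of an element of the stabilizer of `ω`, as a homomorphism. -/
def eigenvalueHom (ω : P.Omega) : MulAction.stabilizer P.G ω →* P.Cinfˣ where
  toFun g := Units.mk0 (den (P.toGLinf g) ω.1) (den_ne_zero _ _)
  map_one' := Units.ext (by simp [den])
  map_mul' g h := Units.ext (by
    have h2 : (P.toGLinf h.1 • ω).1 = ω.1 := congrArg Subtype.val h.2
    have h1 := den_mul (P.toGLinf g.1) (P.toGLinf h.1) ω
    rw [coe_smul_Omega] at h2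
    rw [h2] at h1
    simpa using h1)

theorem eigen_den {g : P.G} {ω : P.Omega} (hg : g • ω = ω) :
    Eigen g.1 ω (den (P.toGLinf g) ω.1) := by
  obtain ⟨ε, h⟩ := (smul_eq_iff_eigen g ω).1 hg
  have : den (P.toGLinf g) ω.1 = ε := h.2
  rwa [this]

theorem eigenvalueHom_injective (ω : P.Omega) : Function.Injective (eigenvalueHom ω) := by
  intro g g' h
  have h1 : den (P.toGLinf g) ω.1 = den (P.toGLinf g') ω.1 := congrArg Units.val h
  exact Subtype.ext (Units.ext ((eigen_den g.2).matrix_eq (h1 ▸ eigen_den g'.2)))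

theorem IsElliptic.of_smul_eq {ω : P.Omega} {g : P.G}
    (hg : ∀ a : P.affineRing, g.1 ≠ Matrix.scalar (Fin 2) a) (h : g • ω = ω) :
    IsElliptic ω := ⟨g, h, hg⟩

theorem IsElliptic.smul {ω : P.Omega} (h : IsElliptic ω) (k : P.G) : IsElliptic (k • ω) := by
  obtain ⟨g, hg, hns⟩ := h
  refine ⟨k * g * k⁻¹, ?_, fun a ha => hns a ?_⟩
  · rw [MulAction.mem_stabilizer_iff, mul_smul, mul_smul, inv_smul_smul,
      MulAction.mem_stabilizer_iff.1 hg]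
  · have h1 : k.1 * g.1 * (k⁻¹ : P.G).1 = Matrix.scalar (Fin 2) a := by
      rw [← ha, Units.val_mul, Units.val_mul]
    have h2 : (k⁻¹ : P.G).1 * k.1 = 1 := by rw [← Units.val_mul, inv_mul_cancel, Units.val_one]
    calc g.1 = (k⁻¹ : P.G).1 * (k.1 * g.1 * (k⁻¹ : P.G).1) * k.1 := by
          simp only [Matrix.mul_assoc]
          rw [h2, Matrix.mul_one, ← Matrix.mul_assoc, h2, Matrix.one_mul]
      _ = Matrix.scalar (Fin 2) a := by
          rw [h1, ← Matrix.scalar_comm _ (Commute.all _), Matrix.mul_assoc, h2, Matrix.mul_one]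

end Eigen

/-! ### Stabilizers of elliptic elements -/

section Elliptic
variable {F K : Type*} [Field F] [Finite F] [Field K] [Algebra F K] {P : Place F K}

theorem affineToCinf_constA (a : F) : P.affineToCinf (P.constA a) = P.constC a := rfl

/-- The characteristic polynomial of a non-scalar matrix of `G` with a fixed point in `Ω` has
constant coefficients: the determinant is a unit of `A`, so the trace has no pole at `∞`. -/
theorem Eigen.trace_det_const (hK : IsFunctionField F K) {g : P.G} {ω : P.Omega} {ε : P.Cinf}
    (h : Eigen g.1 ω ε) (hg : ∀ a : P.affineRing, g.1 ≠ Matrix.scalar (Fin 2) a) :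
    ∃ t n : F, g.1.trace = P.constA t ∧ g.1.det = P.constA n ∧
      ε ^ 2 - P.constC t * ε + P.constC n = 0 := by
  obtain ⟨n, hn0, hn⟩ := exists_const_det hK g
  have h1 := h.charpoly
  have h2 : ‖P.affineToKinf g.1.trace‖ ≤ 1 := by
    refine norm_trace_le_one (h.notMem_range hg) (n := P.affineToKinf g.1.det) ?_ h1
    rw [hn, norm_affineToKinf_constA hn0]
  obtain ⟨t, ht⟩ := exists_const_of_norm_le_one hK h2
  refine ⟨t, n, ht, hn, ?_⟩
  rwa [ht, hn] at h1

/-- The eigenvalues of an element of `G` at its fixed points belong to `F_{q²}`. -/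
theorem Eigen.pow_card_sq (hK : IsFunctionField F K) {g : P.G} {ω : P.Omega} {ε : P.Cinf}
    (h : Eigen g.1 ω ε) : ε ^ Nat.card F ^ 2 = ε := by
  by_cases hg : ∀ a : P.affineRing, g.1 ≠ Matrix.scalar (Fin 2) a
  · obtain ⟨t, n, -, -, h1⟩ := h.trace_det_const hK hg
    exact pow_card_sq_eq_of_quadratic _ h1
  · push Not at hg
    obtain ⟨a, ha⟩ := hg
    have hu : IsUnit a := by
      have h1 := (Matrix.isUnit_iff_isUnit_det _).1 g.isUnit
      rw [ha, Matrix.scalar_apply, Matrix.det_diagonal] at h1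
      simpa using h1
    obtain ⟨f, -, rfl⟩ := exists_const_of_isUnit hK hu
    have h2 := h.unique (ha ▸ Eigen.scalar _ ω)
    rw [h2, affineToCinf_constA, Drinfeld.pow_card_sq, pow_card_map, pow_card_map]

theorem Eigen.pow_card_ne {X : Matrix (Fin 2) (Fin 2) P.affineRing} {ω : P.Omega} {ε : P.Cinf}
    (h : Eigen X ω ε) (hX : ∀ a : P.affineRing, X ≠ Matrix.scalar (Fin 2) a) :
    ε ^ Nat.card F ≠ ε := by
  intro h1
  obtain ⟨a, rfl⟩ := (pow_card_eq_self_iff P.constC ε).1 h1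
  exact h.notMem_range hX (affineToCinf_mem_range (P.constA a))

theorem exists_eigen_of_pow_card_sq {X : Matrix (Fin 2) (Fin 2) P.affineRing}
    {ω : P.Omega} {ε : P.Cinf} (h : Eigen X ω ε) (hε : ε ^ Nat.card F ^ 2 = ε)
    (hε' : ε ^ Nat.card F ≠ ε) {z : P.Cinf} (hz : z ^ Nat.card F ^ 2 = z) :
    ∃ x y : F, Eigen (Matrix.scalar (Fin 2) (P.constA x) + P.constA y • X) ω z := by
  obtain ⟨x, y, rfl⟩ := exists_eq_add_mul P.constC hε hε' hz
  exact ⟨x, y, (Eigen.scalar _ ω).add (h.smul _)⟩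

theorem pow_card_sq_iff_pow_eq_one {z : P.Cinf} (hz : z ≠ 0) :
    z ^ Nat.card F ^ 2 = z ↔ z ^ (Nat.card F ^ 2 - 1) = 1 := by
  rw [← mul_left_inj' hz (a := z ^ (Nat.card F ^ 2 - 1)), ← pow_succ,
    Nat.sub_add_cancel (Nat.one_le_pow _ _ (one_lt_natCard F).le), one_mul]

/-- The matrices `x + y g` with `x, y ∈ F` have all elements of `F_{q²}` as eigenvalues at `ω`. -/
theorem range_eigenvalueHom (hK : IsFunctionField F K) {ω : P.Omega} (hω : IsElliptic ω) :
    (eigenvalueHom ω).range = rootsOfUnity (Nat.card F ^ 2 - 1) P.Cinf := by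
  obtain ⟨g, hg, hns⟩ := hω
  have he := eigen_den hg
  ext z
  rw [MonoidHom.mem_range, mem_rootsOfUnity']
  rw [← pow_card_sq_iff_pow_eq_one z.ne_zero]
  constructor
  · rintro ⟨g', rfl⟩
    exact (eigen_den g'.2).pow_card_sq hK
  · intro hz
    have hzi : (z.1⁻¹) ^ Nat.card F ^ 2 = z.1⁻¹ := by rw [inv_pow, hz]
    obtain ⟨x, y, h1⟩ := exists_eigen_of_pow_card_sq he (he.pow_card_sq hK) (he.pow_card_ne hns) hz
    obtain ⟨x', y', h2⟩ :=
      exists_eigen_of_pow_card_sq he (he.pow_card_sq hK) (he.pow_card_ne hns) hzi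
    have h12 := h1.mul h2
    have h21 := h2.mul h1
    rw [mul_inv_cancel₀ z.ne_zero] at h12
    rw [inv_mul_cancel₀ z.ne_zero] at h21
    let u : P.G := ⟨_, _, h12.matrix_eq (Eigen.one ω), h21.matrix_eq (Eigen.one ω)⟩
    have hu : Eigen u.1 ω z := h1
    exact ⟨⟨u, hu.smul_eq⟩, Units.ext hu.2⟩

/-- The eigenvalue identifies the stabilizer of an elliptic element with the multiplicative group
of `F_{q²}`. -/
def stabilizerEquiv (hK : IsFunctionField F K) {ω : P.Omega} (hω : IsElliptic ω) :
    MulAction.stabilizer P.G ω ≃* rootsOfUnity (Nat.card F ^ 2 - 1) P.Cinf :=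
  (MonoidHom.ofInjective (eigenvalueHom_injective ω)).trans
    (MulEquiv.subgroupCongr (range_eigenvalueHom hK hω))

theorem isCyclic_stabilizer (hK : IsFunctionField F K) {ω : P.Omega} (hω : IsElliptic ω) :
    IsCyclic (MulAction.stabilizer P.G ω) := by
  have : NeZero (Nat.card F ^ 2 - 1) := ⟨(natCard_sq_sub_one_pos F).ne'⟩
  exact isCyclic_of_surjective _ (stabilizerEquiv hK hω).symm.surjective

theorem card_stabilizer (hK : IsFunctionField F K) {ω : P.Omega} (hω : IsElliptic ω) :
    Nat.card (MulAction.stabilizer P.G ω) = Nat.card F ^ 2 - 1 := by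
  have : NeZero (Nat.card F ^ 2 - 1) := ⟨(natCard_sq_sub_one_pos F).ne'⟩
  rw [Nat.card_congr (stabilizerEquiv hK hω).toEquiv]
  obtain ⟨ζ, hζ⟩ := P.exists_isPrimitiveRoot
  exact hζ.card_rootsOfUnity

theorem finite_stabilizer_of_isElliptic (hK : IsFunctionField F K) {ω : P.Omega}
    (hω : IsElliptic ω) : Finite (MulAction.stabilizer P.G ω) :=
  Nat.finite_of_card_ne_zero (by
    rw [card_stabilizer hK hω]; exact (natCard_sq_sub_one_pos F).ne')

/-- A non-scalar matrix determines the stabilizer of each of its fixed points. -/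
theorem stabilizer_eq_of_smul_eq (hK : IsFunctionField F K) {ω ω' : P.Omega} {g : P.G}
    (hg : ∀ a : P.affineRing, g.1 ≠ Matrix.scalar (Fin 2) a) (h : g • ω = ω) (h' : g • ω' = ω') :
    MulAction.stabilizer P.G ω = MulAction.stabilizer P.G ω' := by
  suffices key : ∀ {ω ω' : P.Omega}, g • ω = ω → g • ω' = ω' →
      MulAction.stabilizer P.G ω ≤ MulAction.stabilizer P.G ω' from
    le_antisymm (key h h') (key h' h)
  intro ω ω' h h' k hk
  have he := eigen_den h
  obtain ⟨x, y, hxy⟩ := exists_eigen_of_pow_card_sq he (he.pow_card_sq hK) (he.pow_card_ne hg)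
    ((eigen_den hk).pow_card_sq hK)
  have h1 := (Eigen.scalar (P.constA x) ω').add ((eigen_den h').smul (P.constA y))
  rw [← (eigen_den hk).matrix_eq hxy] at h1
  exact h1.smul_eq

/-- A non-scalar matrix that fixes `ω` has exactly two eigenvalues, and they are conjugate. -/
theorem eigen_or_eigen_pow (hK : IsFunctionField F K) {ω ω' : P.Omega} {g : P.G} {ε : P.Cinf}
    (hg : ∀ a : P.affineRing, g.1 ≠ Matrix.scalar (Fin 2) a) (h : Eigen g.1 ω ε)
    (h' : g • ω' = ω') : Eigen g.1 ω' ε ∨ Eigen g.1 ω' (ε ^ Nat.card F) := by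
  obtain ⟨t, n, ht, hn, h1⟩ := h.trace_det_const hK hg
  have he := eigen_den h'
  set ε' := den (P.toGLinf g) ω'.1
  have h2 := he.charpoly
  rw [ht, hn, affineToCinf_constA, affineToCinf_constA] at h2
  have h3 := (pow_card_eq_or_of_quadratic _ h1).resolve_left (h.pow_card_ne hg)
  have : (ε' - ε) * (ε' - ε ^ Nat.card F) = 0 := by
    rw [h3]
    linear_combination h2 - h1
  rcases mul_eq_zero.1 this with h4 | h4
  · exact Or.inl (sub_eq_zero.1 h4 ▸ he)
  · exact Or.inr (sub_eq_zero.1 h4 ▸ he)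

theorem exists_eigen_pow (hK : IsFunctionField F K) (hδ : Odd P.degree) {ω : P.Omega} {g : P.G}
    {ε : P.Cinf} (hg : ∀ a : P.affineRing, g.1 ≠ Matrix.scalar (Fin 2) a) (h : Eigen g.1 ω ε) :
    ∃ ω' : P.Omega, Eigen g.1 ω' (ε ^ Nat.card F) := by
  obtain ⟨t, n, ht, hn, h1⟩ := h.trace_det_const hK hg
  have h2 := h.pow_card_sq hK
  have h3 := h.pow_card_ne hg
  refine Eigen.exists_of_charpoly (notMem_range_of_pow_card_ne hδ ?_ ?_) ?_
  · rw [← pow_mul, mul_comm, pow_mul, h2]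
  · rw [← Drinfeld.pow_card_sq, h2]; exact h3.symm
  · rw [(pow_card_eq_or_of_quadratic _ h1).resolve_left h3, ht, hn, affineToCinf_constA,
      affineToCinf_constA]
    linear_combination h1

end Elliptic
end Place
end Drinfeld

namespace Drinfeld

/-- If the eigenvalues of a `2 × 2` matrix `X` lie in a field with `q` elements, its characteristic
polynomial divides `(T ^ q - T) ^ q = T ^ (q ^ 2) - T ^ q`. -/
theorem pow_card_sq_eq_pow_card_of_split {F R : Type*} [Field F] [Finite F] [CommRing R]
    (f : F →+* R) {X : Matrix (Fin 2) (Fin 2) R} {α β : F} (ht : X.trace = f (α + β))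
    (hn : X.det = f (α * β)) : X ^ Nat.card F ^ 2 = X ^ Nat.card F := by
  let _ : Algebra F R := f.toAlgebra
  have hch : (X - algebraMap F _ α) * (X - algebraMap F _ β) = 0 := by
    rw [Matrix.trace_fin_two, map_add] at ht
    rw [Matrix.det_fin_two, map_mul] at hn
    have hα : algebraMap F (Matrix (Fin 2) (Fin 2) R) α = Matrix.scalar (Fin 2) (f α) := rfl
    have hβ : algebraMap F (Matrix (Fin 2) (Fin 2) R) β = Matrix.scalar (Fin 2) (f β) := rfl
    rw [hα, hβ]
    ext i j
    fin_cases i <;> fin_cases j <;>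
      simp only [Matrix.mul_apply, Fin.sum_univ_two, Matrix.sub_apply, Matrix.scalar_apply,
        Matrix.diagonal_apply, Fin.mk_zero, Fin.mk_one, Fin.isValue, if_true,
        Matrix.zero_apply, zero_ne_one, one_ne_zero, if_false, sub_zero]
    · linear_combination X 0 0 * ht - hn
    · linear_combination X 0 1 * ht
    · linear_combination X 1 0 * ht
    · linear_combination X 1 1 * ht - hn
  have hroot : ∀ a : F, (Polynomial.X - Polynomial.C a : Polynomial F) ∣
      Polynomial.X ^ Nat.card F - Polynomial.X := fun a => by
    rw [Polynomial.dvd_iff_isRoot]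
    simpa [sub_eq_zero] using pow_card_map (RingHom.id F) a
  have hdvd : ((Polynomial.X - Polynomial.C α) * (Polynomial.X - Polynomial.C β) : Polynomial F) ∣
      Polynomial.X ^ Nat.card F ^ 2 - Polynomial.X ^ Nat.card F := by
    rw [pow_card_sq, ← sub_pow_card Polynomial.C]
    exact (mul_dvd_mul (hroot α) (hroot β)).trans
      (by rw [← sq]; exact pow_dvd_pow _ (one_lt_natCard F))
  obtain ⟨p, hp⟩ := hdvd
  have h := congrArg (Polynomial.aeval X) hp
  simp only [map_sub, map_mul, map_pow, Polynomial.aeval_X, Polynomial.aeval_C] at h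
  rwa [hch, zero_mul, sub_eq_zero] at h

namespace Place

/-! ### The action on row vectors of a matrix with a fixed point -/

section Eigenvectors
variable {F K : Type*} [Field F] [Field K] [Algebra F K] {P : Place F K}

theorem linForm_vecMul {X : Matrix (Fin 2) (Fin 2) P.affineRing} {ω : P.Omega} {ε : P.Cinf}
    (h : Eigen X ω ε) (x : Fin 2 → P.Kinf) :
    linForm ω (Matrix.vecMul x (X.map P.affineToKinf)) = ε * linForm ω x := by
  obtain ⟨h1, h2⟩ := h
  simp only [affineToCinf, RingHom.comp_apply] at h1 h2
  simp only [linForm, Matrix.vecMul, dotProduct, Fin.sum_univ_two, map_add, map_mul,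
    Matrix.map_apply]
  linear_combination algebraMap P.Kinf P.Cinf (x 0) * h1 + algebraMap P.Kinf P.Cinf (x 1) * h2

theorem linForm_ne_zero (ω : P.Omega) {x : Fin 2 → P.Kinf} (hx : x ≠ 0) : linForm ω x ≠ 0 := by
  refine linear_ne_zero ω.2 ?_
  by_contra! h
  refine hx (funext fun i => ?_)
  fin_cases i
  · exact h.1
  · exact h.2

theorem linForm_add (ω : P.Omega) (x y : Fin 2 → P.Kinf) :
    linForm ω (x + y) = linForm ω x + linForm ω y := by
  simp only [linForm, Pi.add_apply, map_add]; ring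

theorem linForm_smul_vec (ω : P.Omega) (a : P.Kinf) (x : Fin 2 → P.Kinf) :
    linForm ω (a • x) = algebraMap P.Kinf P.Cinf a * linForm ω x := by
  simp only [linForm, Pi.smul_apply, smul_eq_mul, map_mul]; ring

/-- The matrix with rows `x` and `x X`. -/
def rowPair (x : Fin 2 → P.Kinf) (X : Matrix (Fin 2) (Fin 2) P.affineRing) :
    Matrix (Fin 2) (Fin 2) P.Kinf :=
  Matrix.of ![x, Matrix.vecMul x (X.map P.affineToKinf)]

theorem vecMul_rowPair (y x : Fin 2 → P.Kinf) (X : Matrix (Fin 2) (Fin 2) P.affineRing) :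
    Matrix.vecMul y (rowPair x X) =
      y 0 • x + y 1 • Matrix.vecMul x (X.map P.affineToKinf) := by
  funext j
  simp [rowPair, Matrix.vecMul, dotProduct, Fin.sum_univ_two]

theorem linForm_vecMul_rowPair {X : Matrix (Fin 2) (Fin 2) P.affineRing} {ω : P.Omega}
    {ε : P.Cinf} (h : Eigen X ω ε) (y x : Fin 2 → P.Kinf) :
    linForm ω (Matrix.vecMul y (rowPair x X)) =
      (algebraMap P.Kinf P.Cinf (y 1) * ε + algebraMap P.Kinf P.Cinf (y 0)) * linForm ω x := by
  rw [vecMul_rowPair, linForm_add, linForm_smul_vec, linForm_smul_vec, linForm_vecMul h]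
  ring

/-- A matrix with an eigenvector in `Ω` has no eigenvectors over `K_∞`, unless it is scalar. -/
theorem det_rowPair_ne_zero {X : Matrix (Fin 2) (Fin 2) P.affineRing} {ω : P.Omega} {ε : P.Cinf}
    (h : Eigen X ω ε) (hX : ∀ a : P.affineRing, X ≠ Matrix.scalar (Fin 2) a)
    {x : Fin 2 → P.Kinf} (hx : x ≠ 0) : (rowPair x X).det ≠ 0 := by
  intro h0
  obtain ⟨y, hy, hy0⟩ := Matrix.exists_vecMul_eq_zero_iff.2 h0
  have h1 := linForm_vecMul_rowPair h y x
  rw [hy0, show linForm ω 0 = 0 by simp [linForm], eq_comm, mul_eq_zero,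
    or_iff_left (linForm_ne_zero ω hx)] at h1
  refine linear_ne_zero (h.notMem_range hX) (c := y 1) (d := y 0) ?_ h1
  by_contra! h2
  refine hy (funext fun i => ?_)
  fin_cases i
  · exact h2.2
  · exact h2.1

theorem BuildingMapsTo.smul_eq {ω : P.Omega} {v : P.Vertex} (h : BuildingMapsTo ω v) {g : P.G}
    (hg : g • ω = ω) : g • v = v := by
  have h1 := h.smul_G g
  rw [hg] at h1
  exact h1.unique h

variable (P) in
/-- Quadratic polynomials over `K_∞` have a root in `C_∞`. -/
theorem exists_root_quadratic (t n : P.Kinf) : ∃ ε : P.Cinf,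
    ε ^ 2 - algebraMap P.Kinf P.Cinf t * ε + algebraMap P.Kinf P.Cinf n = 0 := by
  let f : Polynomial P.KinfBar := Polynomial.X ^ 2 -
    Polynomial.C (algebraMap P.Kinf P.KinfBar t) * Polynomial.X +
      Polynomial.C (algebraMap P.Kinf P.KinfBar n)
  have hdeg : f.degree = 2 := by simp only [f]; compute_degree!
  obtain ⟨e, he⟩ := IsAlgClosed.exists_root f (by rw [hdeg]; norm_num)
  have he' : e ^ 2 - algebraMap P.Kinf P.KinfBar t * e + algebraMap P.Kinf P.KinfBar n = 0 := by
    simpa [f, Polynomial.IsRoot] using he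
  refine ⟨algebraMap P.KinfBar P.Cinf e, ?_⟩
  have := congrArg (algebraMap P.KinfBar P.Cinf) he'
  simp only [map_add, map_sub, map_mul, map_pow, map_zero] at this
  exact this

/-- The eigenvalues of an element of finite order are roots of unity. -/
theorem eigenvalue_pow_eq_one {g : P.G} {N : ℕ} (hg : g ^ N = 1) {ε : P.Cinf}
    (h : ε ^ 2 - P.affineToCinf g.1.trace * ε + P.affineToCinf g.1.det = 0) : ε ^ N = 1 := by
  let M : Matrix (Fin 2) (Fin 2) P.Cinf := g.1.map P.affineToCinf
  have hM : M ^ N = 1 := by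
    have h1 : g.1 ^ N = 1 := by rw [← Units.val_pow_eq_pow_val, hg, Units.val_one]
    have := congrArg (RingHom.mapMatrix P.affineToCinf) h1
    rwa [map_pow, map_one] at this
  have hdet : (M - Matrix.scalar (Fin 2) ε).det = 0 := by
    rw [Matrix.trace_fin_two, Matrix.det_fin_two, map_add, map_sub, map_mul, map_mul] at h
    rw [Matrix.det_fin_two]
    simp [M]
    linear_combination h
  obtain ⟨x, hx, hx0⟩ := Matrix.exists_mulVec_eq_zero_iff.2 hdet
  have h1 : M.mulVec x = ε • x := by
    rw [Matrix.sub_mulVec, sub_eq_zero] at hx0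
    rw [hx0]
    funext i
    simp [Matrix.scalar_apply, Matrix.mulVec_diagonal]
  have h2 : ∀ n : ℕ, (M ^ n).mulVec x = ε ^ n • x := by
    intro n
    induction n with
    | zero => simp
    | succ n ih => rw [pow_succ, ← Matrix.mulVec_mulVec, h1, Matrix.mulVec_smul, ih, smul_smul,
        pow_succ, mul_comm]
  have h3 := h2 N
  rw [hM, Matrix.one_mulVec] at h3
  have h4 : (ε ^ N - 1) • x = 0 := by rw [sub_smul, one_smul, ← h3, sub_self]
  exact sub_eq_zero.1 ((smul_eq_zero.1 h4).resolve_right hx)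

end Eigenvectors

/-! ### The vertex of an elliptic element -/

section Vertices
variable {F K : Type*} [Field F] [Finite F] [Field K] [Algebra F K] {P : Place F K}

/-- The building map sends the elements of `F_{q²}` to the standard vertex. -/
theorem buildingMapsTo_stdVertex (hδ : Odd P.degree) {ω : P.Omega}
    (h : ω.1 ^ Nat.card F ^ 2 = ω.1) (h' : ω.1 ^ Nat.card F ≠ ω.1) :
    BuildingMapsTo ω P.stdVertex :=
  ⟨P.stdLattice, rfl, fun x => by
    rw [norm_mul_add_eq_max hδ h h', latticeNorm_stdLattice, norm_eq_max]⟩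

/-- The building map sends every elliptic element to a vertex: up to `GL₂(K_∞)`, an elliptic
element belongs to `F_{q²}`. -/
theorem exists_buildingMapsTo (hK : IsFunctionField F K) (hδ : Odd P.degree) {ω : P.Omega}
    (hω : IsElliptic ω) : ∃ v : P.Vertex, BuildingMapsTo ω v := by
  obtain ⟨g, hg, hns⟩ := hω
  have he := eigen_den hg
  have hc : P.affineToKinf (g 1 0) ≠ 0 :=
    (map_ne_zero_iff _ affineToKinf_injective).2 (he.apply_one_zero_ne hns)
  let k : GL (Fin 2) P.Kinf := Matrix.GeneralLinearGroup.mkOfDetNeZero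
    !![P.affineToKinf (g 1 0), P.affineToKinf (g 1 1); 0, 1]
    (by simpa [Matrix.det_fin_two] using hc)
  have hk : (k • ω).1 = den (P.toGLinf g) ω.1 := by
    have h0 : k 0 0 = P.affineToKinf (g 1 0) := rfl
    have h1 : k 0 1 = P.affineToKinf (g 1 1) := rfl
    have h2 : k 1 0 = 0 := rfl
    have h3 : k 1 1 = 1 := rfl
    rw [coe_smul_Omega, num, den, h0, h1, h2, h3, map_zero, map_one, zero_mul, zero_add, div_one]
    rfl
  have h := buildingMapsTo_stdVertex hδ (ω := k • ω) (by rw [hk]; exact he.pow_card_sq hK)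
    (by rw [hk]; exact he.pow_card_ne hns)
  have h' := h.smul k⁻¹
  rw [inv_smul_smul] at h'
  exact ⟨_, h'⟩

/-- The vertex `λ(ω)` of an elliptic element `ω` is the only vertex of the tree that is fixed by a
given non-scalar element of the stabilizer of `ω`. -/
theorem BuildingMapsTo.eq_of_smul_eq (hK : IsFunctionField F K) (hδ : Odd P.degree) {ω : P.Omega}
    {v w : P.Vertex} (h : BuildingMapsTo ω v) {g : P.G}
    (hns : ∀ a : P.affineRing, g.1 ≠ Matrix.scalar (Fin 2) a) (hg : g • ω = ω) (hw : g • w = w) :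
    v = w := by
  obtain ⟨k, rfl⟩ := exists_eq_smul_stdVertex w
  have hm := (smul_vertex_eq_iff hK g k).1 hw
  obtain ⟨L, rfl, hL⟩ := buildingMapsTo_iff.1 h
  have he := eigen_den hg
  set ε := den (P.toGLinf g) ω.1
  have hk : (k⁻¹ : GL (Fin 2) P.Kinf).1 * k.1 = 1 := by
    rw [← Units.val_mul, inv_mul_cancel, Units.val_one]
  have hk' : k.1 * (k⁻¹ : GL (Fin 2) P.Kinf).1 = 1 := by
    rw [← Units.val_mul, mul_inv_cancel, Units.val_one]
  -- among the two basis vectors of the lattice, choose one of maximal norm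
  let b : Fin 2 → Fin 2 → P.Kinf := fun i => (k⁻¹ : GL (Fin 2) P.Kinf).1 i
  obtain ⟨i, hi⟩ : ∃ i, ∀ j, latticeNorm L (b j) ≤ latticeNorm L (b i) := Finite.exists_max _
  have hbi : Matrix.vecMul (b i) k.1 = Pi.single i 1 := by
    have h1 : b i = Matrix.vecMul (Pi.single i 1) (k⁻¹ : GL (Fin 2) P.Kinf).1 := by
      rw [Matrix.single_one_vecMul]; rfl
    rw [h1, Matrix.vecMul_vecMul, hk, Matrix.vecMul_one]
  have hb0 : b i ≠ 0 := by
    intro h0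
    rw [h0, Matrix.zero_vecMul] at hbi
    exact one_ne_zero (α := P.Kinf) (by simpa using (congrFun hbi i).symm)
  obtain ⟨a, ha⟩ := exists_latticeNorm_eq L (b i)
  have ha0 : a ≠ 0 := by
    rintro rfl
    rw [← hL, norm_zero, norm_eq_zero] at ha
    exact linForm_ne_zero ω hb0 ha
  refine mkVertex_eq_iff.2 ⟨a, ha0, fun x => ?_⟩
  rw [latticeNorm_smul_stdLattice]
  refine le_antisymm ?_ ?_
  · -- write `x` in the basis of the lattice
    have hx : x = Matrix.vecMul x k.1 0 • b 0 + Matrix.vecMul x k.1 1 • b 1 := by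
      have h1 : x = Matrix.vecMul (Matrix.vecMul x k.1) (k⁻¹ : GL (Fin 2) P.Kinf).1 := by
        rw [Matrix.vecMul_vecMul, hk', Matrix.vecMul_one]
      conv_lhs => rw [h1]
      funext j
      rw [Matrix.vecMul, dotProduct, Fin.sum_univ_two]
      rfl
    conv_lhs => rw [hx]
    refine (latticeNorm_add_le L _ _).trans (max_le ?_ ?_)
    all_goals
      rw [latticeNorm_smul_vec, mul_comm, ← ha]
      exact mul_le_mul (hi _) (norm_le_pi_norm _ _) (norm_nonneg _) (ha ▸ norm_nonneg a)
  · -- write `x` in the basis `b i`, `(b i) g`, which is orthogonal for the norm of `ω`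
    have hdet := det_rowPair_ne_zero he hns hb0
    obtain ⟨y, hy⟩ : ∃ y, Matrix.vecMul y (rowPair (b i) g.1) = x :=
      ⟨Matrix.vecMul x (rowPair (b i) g.1)⁻¹, by
        rw [Matrix.vecMul_vecMul, Matrix.nonsing_inv_mul _ (isUnit_iff_ne_zero.2 hdet),
          Matrix.vecMul_one]⟩
    have h1 : latticeNorm L x = max ‖y 1‖ ‖y 0‖ * ‖a‖ := by
      rw [← hL, ← hy, linForm_vecMul_rowPair he, norm_mul,
        norm_mul_add_eq_max hδ (he.pow_card_sq hK) (he.pow_card_ne hns), hL, ha]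
    rw [h1, mul_comm]
    refine mul_le_mul_of_nonneg_right ?_ (norm_nonneg _)
    have h2 : Matrix.vecMul x k.1 = y 0 • (Pi.single i 1 : Fin 2 → P.Kinf) +
        y 1 • Matrix.vecMul (Pi.single i 1 : Fin 2 → P.Kinf)
          ((k⁻¹ : GL (Fin 2) P.Kinf).1 * g.1.map P.affineToKinf * k.1) := by
      rw [← hy, vecMul_rowPair, Matrix.add_vecMul, Matrix.smul_vecMul, Matrix.smul_vecMul, hbi,
        ← hbi, Matrix.vecMul_vecMul, Matrix.vecMul_vecMul, ← Matrix.mul_assoc, ← Matrix.mul_assoc,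
        hk', Matrix.one_mul]
    rw [h2]
    refine (IsUltrametricDist.norm_add_le_max _ _).trans (max_le ?_ ?_)
    · rw [norm_smul, Pi.norm_single, norm_one, mul_one]; exact le_max_right _ _
    · rw [norm_smul]
      refine (mul_le_of_le_one_right (norm_nonneg _) ?_).trans (le_max_left _ _)
      refine (norm_vecMul_le (mem_orderAt.1 hm) _).trans ?_
      rw [Pi.norm_single, norm_one, mul_one]

/-- A matrix over `A` whose characteristic polynomial has coefficients in `F` either has its
eigenvalues in `F`, or has a fixed point in `Ω`. -/
theorem split_or_exists_eigen (hδ : Odd P.degree) {X : Matrix (Fin 2) (Fin 2) P.affineRing}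
    {t n : F} (ht : X.trace = P.constA t) (hn : X.det = P.constA n) :
    (∃ α β : F, t = α + β ∧ n = α * β) ∨
      ((∀ a : P.affineRing, X ≠ Matrix.scalar (Fin 2) a) ∧ ∃ ω ε, Eigen X ω ε) := by
  obtain ⟨ε, hε⟩ := P.exists_root_quadratic (P.affineToKinf X.trace) (P.affineToKinf X.det)
  have h1 : ε ^ 2 - P.constC t * ε + P.constC n = 0 := by
    rw [ht, hn] at hε
    exact hε
  by_cases h : ε ^ Nat.card F = ε
  · left
    obtain ⟨α, rfl⟩ := (pow_card_eq_self_iff P.constC ε).1 h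
    rw [← map_pow, ← map_mul, ← map_sub, ← map_add, map_eq_zero] at h1
    exact ⟨α, t - α, by ring, by linear_combination h1⟩
  · right
    have hr := notMem_range_of_pow_card_ne hδ (pow_card_sq_eq_of_quadratic _ h1) h
    obtain ⟨ω, hω⟩ := Eigen.exists_of_charpoly hr hε
    refine ⟨?_, ω, ε, hω⟩
    rintro a rfl
    exact hr (hω.unique (Eigen.scalar a ω) ▸ affineToCinf_mem_range a)

/-- The order of a matrix of `G` with eigenvalues in `F` divides `q (q - 1)`. -/
theorem pow_eq_one_of_split {g : P.G} {α β : F} (ht : g.1.trace = P.constA (α + β))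
    (hn : g.1.det = P.constA (α * β)) : g ^ (Nat.card F ^ 2 - Nat.card F) = 1 := by
  have h := pow_card_sq_eq_pow_card_of_split P.constA ht hn
  have h1 : g ^ Nat.card F ^ 2 = g ^ Nat.card F := Units.ext (by simpa using h)
  have h2 : Nat.card F ≤ Nat.card F ^ 2 := Nat.le_self_pow two_ne_zero _
  rw [pow_sub g h2, h1, mul_inv_cancel]

/-! ### Cyclic subgroups of order `q² - 1` -/

/-- Every cyclic subgroup of order `q² - 1` is the stabilizer of an elliptic element. -/
theorem exists_eq_stabilizer (hδ : Odd P.degree) (hK : IsFunctionField F K) (C : P.CyclicSub) :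
    ∃ ω : P.Omega, IsElliptic ω ∧ C.1 = MulAction.stabilizer P.G ω := by
  obtain ⟨C, hC, hcard⟩ := C
  have hpos := natCard_sq_sub_one_pos F
  have hfin : Finite C := Nat.finite_of_card_ne_zero (by rw [hcard]; exact hpos.ne')
  obtain ⟨⟨g, hgC⟩, hg⟩ := IsCyclic.exists_generator (α := C)
  have hCz : C = Subgroup.zpowers g := by
    refine le_antisymm (fun x hx => ?_) ((Subgroup.zpowers_le).2 hgC)
    obtain ⟨n, hn⟩ := hg ⟨x, hx⟩
    exact ⟨n, congrArg Subtype.val hn⟩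
  have hord : orderOf g = Nat.card F ^ 2 - 1 := by
    rw [← hcard, hCz, Nat.card_zpowers]
  have hg1 : g ^ (Nat.card F ^ 2 - 1) = 1 := by rw [← hord, pow_orderOf_eq_one]
  have hroot : ∀ ε : P.Cinf, ε ^ 2 - P.affineToCinf g.1.trace * ε + P.affineToCinf g.1.det = 0 →
      ε ^ Nat.card F ^ 2 = ε := fun ε hε => by
    have := eigenvalue_pow_eq_one hg1 hε
    rw [← Nat.sub_add_cancel (Nat.one_le_pow 2 _ (one_lt_natCard F).le), pow_succ, this, one_mul]
  obtain ⟨ε, hε⟩ := P.exists_root_quadratic (P.affineToKinf g.1.trace) (P.affineToKinf g.1.det)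
  have hε1 : ε ^ 2 - P.affineToCinf g.1.trace * ε + P.affineToCinf g.1.det = 0 := hε
  have hε2 : (P.affineToCinf g.1.trace - ε) ^ 2 - P.affineToCinf g.1.trace *
      (P.affineToCinf g.1.trace - ε) + P.affineToCinf g.1.det = 0 := by linear_combination hε1
  -- the trace is a constant, being a sum of two elements of `F_{q²}` inside `K_∞`
  have ht : ∃ t : F, g.1.trace = P.constA t := by
    have h1 : (P.affineToCinf g.1.trace) ^ Nat.card F ^ 2 = P.affineToCinf g.1.trace := by
      have := sub_pow_card_sq P.constC (P.affineToCinf g.1.trace) ε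
      rw [hroot _ hε2, hroot _ hε1] at this
      linear_combination -this
    by_contra hne
    refine notMem_range_of_pow_card_ne hδ h1 ?_ (affineToCinf_mem_range _)
    intro h2
    obtain ⟨t, h3⟩ := (pow_card_eq_self_iff P.constC _).1 h2
    exact hne ⟨t, affineToCinf_injective h3⟩
  obtain ⟨t, ht⟩ := ht
  obtain ⟨n, -, hn⟩ := exists_const_det hK g
  rcases split_or_exists_eigen hδ ht hn with ⟨α, β, rfl, rfl⟩ | ⟨hns, ω, e, he⟩
  · exfalso
    have h1 := orderOf_dvd_of_pow_eq_one (pow_eq_one_of_split ht hn)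
    rw [hord] at h1
    have hq := one_lt_natCard F
    have hlt : Nat.card F < Nat.card F ^ 2 := by nlinarith
    have := Nat.le_of_dvd (by omega) h1
    omega
  · have hell : IsElliptic ω := IsElliptic.of_smul_eq hns he.smul_eq
    refine ⟨ω, hell, ?_⟩
    have hle : C ≤ MulAction.stabilizer P.G ω := by
      rw [hCz, Subgroup.zpowers_le]
      exact he.smul_eq
    have := finite_stabilizer_of_isElliptic hK hell
    exact Subgroup.eq_of_le_of_card_ge hle (by rw [hcard, card_stabilizer hK hell])

end Vertices
end Place
end Drinfeld

namespace Drinfeld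

/-! ### Finite groups of matrices with eigenvalues in a finite field -/

/-- Two commuting involutions of the plane differ by a sign, unless one of them is scalar. -/
theorem eq_or_eq_neg_of_involutions {R : Type*} [CommRing R] [IsDomain R] (h2 : (2 : R) ≠ 0)
    {X Y : Matrix (Fin 2) (Fin 2) R} (hX : X * X = 1) (hY : Y * Y = 1) (hXY : X * Y = Y * X) :
    X = 1 ∨ X = -1 ∨ Y = 1 ∨ Y = -1 ∨ Y = X ∨ Y = -X := by
  -- a non-scalar involution has trace zero
  have key : ∀ Z : Matrix (Fin 2) (Fin 2) R, Z * Z = 1 → Z = 1 ∨ Z = -1 ∨ Z 1 1 = -Z 0 0 := by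
    intro Z hZ
    by_cases htr : Z 0 0 + Z 1 1 = 0
    · exact Or.inr (Or.inr (by linear_combination htr))
    have e00 := congrFun (congrFun hZ 0) 0
    have e01 := congrFun (congrFun hZ 0) 1
    have e10 := congrFun (congrFun hZ 1) 0
    have e11 := congrFun (congrFun hZ 1) 1
    simp only [Matrix.mul_apply, Fin.sum_univ_two, Matrix.one_apply, if_true, Fin.isValue,
      zero_ne_one, one_ne_zero, if_false] at e00 e01 e10 e11
    have f01 : Z 0 1 = 0 :=
      (mul_eq_zero.1 (show (Z 0 0 + Z 1 1) * Z 0 1 = 0 by linear_combination e01)).resolve_left htr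
    have f10 : Z 1 0 = 0 :=
      (mul_eq_zero.1 (show (Z 0 0 + Z 1 1) * Z 1 0 = 0 by linear_combination e10)).resolve_left htr
    have f : Z 0 0 - Z 1 1 = 0 :=
      (mul_eq_zero.1 (show (Z 0 0 + Z 1 1) * (Z 0 0 - Z 1 1) = 0 by
        linear_combination e00 - e11)).resolve_left htr
    rw [f01, zero_mul, add_zero] at e00
    rcases mul_self_eq_one_iff.1 e00 with h | h
    · left
      ext i j
      fin_cases i <;> fin_cases j <;> simp [h, f01, f10]
      linear_combination h - f
    · right; left
      ext i j
      fin_cases i <;> fin_cases j <;> simp [h, f01, f10]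
      linear_combination h - f
  rcases key X hX with h | h | hx
  · tauto
  · tauto
  rcases key Y hY with h | h | hy
  · tauto
  · tauto
  have hZ : (X * Y) * (X * Y) = 1 := by
    rw [Matrix.mul_assoc, ← Matrix.mul_assoc Y, ← hXY, Matrix.mul_assoc X Y Y, hY, Matrix.mul_one,
      hX]
  have hXZ : X * (X * Y) = Y := by rw [← Matrix.mul_assoc, hX, Matrix.one_mul]
  rcases key (X * Y) hZ with h | h | hz
  · rw [h, Matrix.mul_one] at hXZ
    exact Or.inr (Or.inr (Or.inr (Or.inr (Or.inl hXZ.symm))))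
  · rw [h, Matrix.mul_neg, Matrix.mul_one] at hXZ
    exact Or.inr (Or.inr (Or.inr (Or.inr (Or.inr hXZ.symm))))
  exfalso
  have x00 := congrFun (congrFun hX 0) 0
  have y00 := congrFun (congrFun hY 0) 0
  have c00 := congrFun (congrFun hXY 0) 0
  have c01 := congrFun (congrFun hXY 0) 1
  have c10 := congrFun (congrFun hXY 1) 0
  simp only [Matrix.mul_apply, Fin.sum_univ_two, Matrix.one_apply, if_true, Fin.isValue]
    at x00 y00 c00 c01 c10 hz
  rw [hx, hy] at hz
  rw [hx, hy] at c01 c10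
  have d01 : X 0 0 * Y 0 1 = Y 0 0 * X 0 1 :=
    mul_left_cancel₀ h2 (by linear_combination c01)
  have d10 : X 0 0 * Y 1 0 = Y 0 0 * X 1 0 :=
    mul_left_cancel₀ h2 (by linear_combination -c10)
  have d : X 0 0 * Y 0 0 + X 0 1 * Y 1 0 = 0 :=
    mul_left_cancel₀ h2 (by linear_combination hz + c00)
  refine one_ne_zero (α := R) ?_
  -- `1 = (a² + bc) (a'² + b'c') = (aa' + bc')²`
  linear_combination (X 0 0 * Y 0 0 + X 0 1 * Y 1 0) * d - Y 0 0 * Y 0 0 * x00 -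
    Y 0 1 * Y 1 0 * x00 - y00 + X 0 0 * Y 1 0 * d01
    - X 0 1 * Y 1 0 * c00 - X 0 1 * Y 0 0 * d10

/-- A finite group of matrices whose elements have orders dividing `q (q - 1)` has an order that is
not divisible by `q² - 1`. -/
theorem not_dvd_card_of_pow_eq_one {R H : Type*} [CommRing R] [IsDomain R] [Group H] [Finite H]
    {q : ℕ} (hq : 1 < q) (h2 : Odd q → (2 : R) ≠ 0)
    (f : H →* Matrix (Fin 2) (Fin 2) R) (hf : Function.Injective f)
    (hH : ∀ h : H, h ^ (q ^ 2 - q) = 1) : ¬ q ^ 2 - 1 ∣ Nat.card H := by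
  intro hdvd
  have e1 : q ^ 2 - 1 = (q + 1) * (q - 1) := by
    rw [← Nat.sq_sub_sq, one_pow]
  have e2 : q ^ 2 - q = q * (q - 1) := by rw [Nat.mul_sub, mul_one, sq]
  rw [e2] at hH
  -- the only prime divisor of `q + 1` is `2`
  have hprime : ∀ {ℓ : ℕ}, ℓ.Prime → ℓ ∣ q + 1 → ℓ = 2 := by
    intro ℓ hℓ hd
    have : Fact ℓ.Prime := ⟨hℓ⟩
    obtain ⟨x, hx⟩ := exists_prime_orderOf_dvd_card' (G := H) ℓ
      ((hd.trans ⟨q - 1, e1⟩).trans hdvd)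
    have h1 := orderOf_dvd_of_pow_eq_one (hH x)
    rw [hx] at h1
    rcases hℓ.dvd_mul.1 h1 with h | h
    · exact absurd (Nat.dvd_one.1 ((Nat.dvd_add_right h).1 hd)) hℓ.one_lt.ne'
    · have h3 : ℓ ∣ 2 := by
        have := (Nat.dvd_sub hd h)
        rwa [show q + 1 - (q - 1) = 2 by omega] at this
      exact (Nat.prime_dvd_prime_iff_eq hℓ Nat.prime_two).1 h3
  obtain ⟨k, hk⟩ : ∃ k, q + 1 = 2 ^ k :=
    ⟨_, Nat.eq_prime_pow_of_unique_prime_dvd (Nat.succ_ne_zero q) hprime⟩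
  have hk2 : 2 ≤ k := by
    by_contra! hlt
    interval_cases k <;> omega
  have h4 : 4 ∣ q + 1 := hk ▸ (pow_dvd_pow 2 hk2)
  have hodd : Odd q := by rw [Nat.odd_iff]; omega
  -- hence `q` is odd and there is an elementary abelian `2`-subgroup of order `8`
  have h8 : 2 ^ 3 ∣ Nat.card H := by
    refine Dvd.dvd.trans ?_ hdvd
    rw [e1, show (2 : ℕ) ^ 3 = 4 * 2 by norm_num]
    exact mul_dvd_mul h4 (by omega)
  have : Fact (Nat.Prime 2) := ⟨Nat.prime_two⟩
  obtain ⟨S, hS⟩ := Sylow.exists_subgroup_card_pow_prime 2 h8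
  have hsq : ∀ s : S, s * s = 1 := by
    intro s
    have a1 : orderOf s.1 ∣ 2 ^ 3 := by
      rw [Subgroup.orderOf_coe, ← hS]; exact orderOf_dvd_natCard s
    have a2 := orderOf_dvd_of_pow_eq_one (hH s.1)
    have a3 : Nat.gcd (2 ^ 3) (q * (q - 1)) = 2 := by
      obtain ⟨m, hm⟩ : ∃ m, q = 4 * m + 3 := ⟨q / 4, by omega⟩
      have e : q * (q - 1) = 2 * (8 * (m * m) + 10 * m + 3) := by
        rw [hm, show 4 * m + 3 - 1 = 4 * m + 2 by omega]; ring
      rw [e, show (2 : ℕ) ^ 3 = 2 * 2 ^ 2 by norm_num, Nat.gcd_mul_left]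
      have : Nat.Coprime (2 ^ 2) (8 * (m * m) + 10 * m + 3) := by
        refine Nat.Coprime.pow_left 2 ?_
        rw [Nat.coprime_two_left, Nat.odd_iff]; omega
      rw [this]
    have a4 := Nat.dvd_gcd a1 a2
    rw [a3] at a4
    refine Subtype.ext ?_
    have := orderOf_dvd_iff_pow_eq_one.1 a4
    rwa [sq] at this
  have hcomm : ∀ s t : S, s * t = t * s := by
    intro s t
    have i : ∀ s : S, s⁻¹ = s := fun s => inv_eq_of_mul_eq_one_left (hsq s)
    have := i (s * t)
    rw [mul_inv_rev, i, i] at this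
    exact this.symm
  let φ : S →* Matrix (Fin 2) (Fin 2) R := f.comp S.subtype
  have hφ : Function.Injective φ := hf.comp Subtype.val_injective
  have hinv : ∀ s, φ s * φ s = 1 := fun s => by rw [← map_mul, hsq, map_one]
  -- such a subgroup has at most four elements
  have h4' : ∃ X : Matrix (Fin 2) (Fin 2) R, ∀ s, φ s = 1 ∨ φ s = -1 ∨ φ s = X ∨ φ s = -X := by
    by_cases hall : ∀ s, φ s = 1 ∨ φ s = -1
    · exact ⟨1, fun s => (hall s).elim Or.inl (fun h => Or.inr (Or.inl h))⟩
    · push Not at hall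
      obtain ⟨s₀, hs1, hs2⟩ := hall
      refine ⟨φ s₀, fun s => ?_⟩
      rcases eq_or_eq_neg_of_involutions (h2 hodd) (hinv s₀) (hinv s)
        (by rw [← map_mul, ← map_mul, hcomm]) with h | h | h | h | h | h <;> tauto
  obtain ⟨X, hX⟩ := h4'
  classical
  have hsub : Set.range φ ⊆ (({1, -1, X, -X} : Finset (Matrix (Fin 2) (Fin 2) R)) : Set _) := by
    rintro _ ⟨s, rfl⟩
    simpa using hX s
  have hle := Set.ncard_le_ncard hsub (Finset.finite_toSet _)
  rw [Set.ncard_coe_finset, Set.ncard_range_of_injective hφ, hS] at hle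
  have := hle.trans Finset.card_le_four
  norm_num at this

end Drinfeld

namespace Drinfeld

/-- The norm from `F_{q²}` to `F_q` is surjective. -/
theorem exists_norm_eq_of_isPrimitiveRoot {F L : Type*} [Field F] [Finite F] [Field L]
    (f : F →+* L) {ζ : L} (hζ : IsPrimitiveRoot ζ (Nat.card F ^ 2 - 1)) {c : F} (hc : c ≠ 0) :
    ∃ z : L, z ^ Nat.card F ^ 2 = z ∧ z * z ^ Nat.card F = f c := by
  have hq := one_lt_natCard F
  have hpos := natCard_sq_sub_one_pos F
  have e1 : Nat.card F ^ 2 - 1 = (Nat.card F + 1) * (Nat.card F - 1) := by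
    rw [← Nat.sq_sub_sq, one_pow]
  have hc1 : f c ^ (Nat.card F - 1) = 1 := by
    have h0 : f c ≠ 0 := (map_ne_zero f).2 hc
    refine mul_right_cancel₀ h0 ?_
    rw [← pow_succ, Nat.sub_add_cancel hq.le, pow_card_map, one_mul]
  have : NeZero (Nat.card F ^ 2 - 1) := ⟨hpos.ne'⟩
  obtain ⟨i, -, hi⟩ := hζ.eq_pow_of_pow_eq_one (ξ := f c) (by
    rw [e1, mul_comm, pow_mul, hc1, one_pow])
  have hdvd : Nat.card F + 1 ∣ i := by
    rw [← hi, ← pow_mul] at hc1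
    have h1 := hζ.dvd_of_pow_eq_one _ hc1
    rw [e1] at h1
    exact Nat.dvd_of_mul_dvd_mul_right (by omega) h1
  obtain ⟨j, rfl⟩ := hdvd
  refine ⟨ζ ^ j, ?_, ?_⟩
  · rw [← Nat.sub_add_cancel (Nat.one_le_pow 2 _ hq.le), pow_succ, ← pow_mul, mul_comm j, pow_mul,
      hζ.pow_eq_one, one_pow, one_mul]
  · rw [← hi, ← pow_succ', ← pow_mul, mul_comm]

namespace Place

/-! ### Elliptic elements above a vertex -/

variable {F K : Type*} [Field F] [Field K] [Algebra F K] {P : Place F K}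

/-- The stabilizer of a vertex `λ(ω)` contains the stabilizer of `ω`. -/
theorem BuildingMapsTo.stabilizer_le {ω : P.Omega} {v : P.Vertex} (h : BuildingMapsTo ω v) :
    MulAction.stabilizer P.G ω ≤ MulAction.stabilizer P.G v := fun _ hg => h.smul_eq hg

/-- A matrix that intertwines a matrix with an eigenvector in `Ω` with another one is zero or
invertible. -/
theorem det_ne_zero_of_intertwines {T X Y : Matrix (Fin 2) (Fin 2) P.affineRing} {ω : P.Omega}
    {ε : P.Cinf} (hY : Eigen Y ω ε) (hns : ∀ a : P.affineRing, Y ≠ Matrix.scalar (Fin 2) a)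
    (h : Y * T = T * X) (hT : T ≠ 0) : T.det ≠ 0 := by
  intro h0
  have h1 : (T.map P.affineToKinf).det = 0 := by
    have := RingHom.map_det P.affineToKinf T
    rw [h0, map_zero] at this
    exact this.symm
  obtain ⟨y, hy, hy0⟩ := Matrix.exists_vecMul_eq_zero_iff.2 h1
  have h2 : rowPair y Y * T.map P.affineToKinf = 0 := by
    have h3 : Matrix.vecMul (Matrix.vecMul y (Y.map P.affineToKinf))
        (T.map P.affineToKinf) = 0 := by
      rw [Matrix.vecMul_vecMul, ← Matrix.map_mul, h, Matrix.map_mul, ← Matrix.vecMul_vecMul, hy0,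
        Matrix.zero_vecMul]
    refine Matrix.ext fun i j => ?_
    fin_cases i
    · exact congrFun hy0 j
    · exact congrFun h3 j
  have h4 : T.map P.affineToKinf = 0 := by
    have hu := isUnit_iff_ne_zero.2 (det_rowPair_ne_zero hY hns hy)
    rw [← Matrix.one_mul (T.map P.affineToKinf), ← Matrix.nonsing_inv_mul _ hu, Matrix.mul_assoc,
      h2, Matrix.mul_zero]
  refine hT ?_
  ext i j
  have := congrFun (congrFun h4 i) j
  simp only [Matrix.map_apply, Matrix.zero_apply] at this
  exact congrArg Subtype.val ((map_eq_zero_iff _ affineToKinf_injective).1 this)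

/-- If `X` has the eigenvalue `ε` at `ω`, then `u X u⁻¹` has it at `u ω`. -/
theorem Eigen.conj {X : Matrix (Fin 2) (Fin 2) P.affineRing} {ω : P.Omega} {ε : P.Cinf}
    (h : Eigen X ω ε) (u : P.G) : Eigen (u.1 * X * (u⁻¹ : P.G).1) (u • ω) ε := by
  have hd := den_ne_zero (P.toGLinf u) ω
  set d := den (P.toGLinf u) ω.1 with hddef
  have hω : (u • ω).1 = num (P.toGLinf u) ω.1 / d := rfl
  have hn : P.affineToCinf (u.1 0 0) * ω.1 + P.affineToCinf (u.1 0 1) = (u • ω).1 * d := by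
    rw [hω, div_mul_cancel₀ _ hd]; rfl
  have hd' : P.affineToCinf (u.1 1 0) * ω.1 + P.affineToCinf (u.1 1 1) = d := rfl
  set Y := u.1 * X * (u⁻¹ : P.G).1 with hY
  have hYu : Y * u.1 = u.1 * X := by
    rw [hY, Matrix.mul_assoc, ← Units.val_mul, inv_mul_cancel, Units.val_one, Matrix.mul_one]
  obtain ⟨h1, h2⟩ := h
  have key : ∀ i, (P.affineToCinf (Y i 0) * (u • ω).1 + P.affineToCinf (Y i 1)) * d =
      (P.affineToCinf (u.1 i 0) * ω.1 + P.affineToCinf (u.1 i 1)) * ε := by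
    intro i
    have e0 := congrArg P.affineToCinf (congrFun (congrFun hYu i) 0)
    have e1 := congrArg P.affineToCinf (congrFun (congrFun hYu i) 1)
    simp only [Matrix.mul_apply, Fin.sum_univ_two, map_add, map_mul] at e0 e1
    linear_combination ω.1 * e0 + e1 - P.affineToCinf (Y i 0) * hn - P.affineToCinf (Y i 1) * hd' +
      P.affineToCinf (u.1 i 0) * h1 + P.affineToCinf (u.1 i 1) * h2
  constructor
  · refine mul_right_cancel₀ hd ?_
    rw [key, hn]; ring
  · refine mul_right_cancel₀ hd ?_
    rw [key, hd']; ring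

theorem nonscalar_of_eigen {X : Matrix (Fin 2) (Fin 2) P.affineRing} {ω : P.Omega} {ε : P.Cinf}
    (h : Eigen X ω ε) (hε : ε ∉ Set.range (algebraMap P.Kinf P.Cinf)) (a : P.affineRing) :
    X ≠ Matrix.scalar (Fin 2) a := by
  rintro rfl
  exact hε (h.unique (Eigen.scalar a ω) ▸ affineToCinf_mem_range a)

theorem cayleyHamilton_fin_two {R : Type*} [CommRing R] (X : Matrix (Fin 2) (Fin 2) R) :
    X * X = X.trace • X - X.det • 1 := by
  rw [Matrix.trace_fin_two, Matrix.det_fin_two]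
  ext i j
  fin_cases i <;> fin_cases j <;> simp [Matrix.mul_apply, Fin.sum_univ_two] <;> ring

variable [Finite F]

/-- If no elliptic element lies above `v`, every element of `G_v` has its eigenvalues in `F`, and so
`q² - 1` does not divide the order of `G_v`. -/
theorem IsGoodVertex.exists_isElliptic (hK : IsFunctionField F K) (hδ : Odd P.degree)
    {v : P.Vertex} (hv : IsGoodVertex v) : ∃ ω : P.Omega, IsElliptic ω ∧ BuildingMapsTo ω v := by
  obtain ⟨hfin, hdvd⟩ := hv
  by_contra! hne
  obtain ⟨h, rfl⟩ := exists_eq_smul_stdVertex v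
  refine not_dvd_card_of_pow_eq_one (R := P.affineRing) (one_lt_natCard F) ?_
    ((Units.coeHom _).comp (MulAction.stabilizer P.G (h • P.stdVertex)).subtype)
    (Units.val_injective.comp Subtype.val_injective) ?_ hdvd
  · intro hodd h2
    have h2F : (2 : F) = 0 := P.constA.injective (by rw [map_ofNat, h2, map_zero])
    obtain ⟨p, n, hp, hpp, hn, hcard⟩ := exists_card_eq_prime_pow F
    have hp2 : p ∣ 2 := (CharP.cast_eq_zero_iff F p 2).1 (by exact_mod_cast h2F)
    rw [(Nat.prime_dvd_prime_iff_eq hpp Nat.prime_two).1 hp2] at hcard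
    rw [hcard, Nat.odd_pow_iff hn.ne'] at hodd
    exact absurd hodd (by decide)
  · rintro ⟨g, hg⟩
    obtain ⟨t, n, ht, hn⟩ := exists_const_of_mem_orderAt hK ((smul_vertex_eq_iff hK g h).1 hg)
    rcases split_or_exists_eigen hδ ht hn with ⟨α, β, rfl, rfl⟩ | ⟨hns, ω, ε, hω⟩
    · exact Subtype.ext (pow_eq_one_of_split ht hn)
    · exfalso
      have hell := IsElliptic.of_smul_eq hns hω.smul_eq
      obtain ⟨w, hw⟩ := exists_buildingMapsTo hK hδ hell
      have := hw.eq_of_smul_eq hK hδ hns hω.smul_eq hg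
      exact hne ω hell (this ▸ hw)

/-- The stabilizer of an elliptic element has order `q² - 1` and fixes its vertex. -/
theorem BuildingMapsTo.isGoodVertex (hK : IsFunctionField F K) (hδ : Odd P.degree) {ω : P.Omega}
    (hω : IsElliptic ω) {v : P.Vertex} (h : BuildingMapsTo ω v) : IsGoodVertex v := by
  refine ⟨finite_stabilizer hK hδ v, ?_⟩
  rw [← card_stabilizer hK hω]
  exact Subgroup.card_dvd_of_le h.stabilizer_le

theorem exists_eigen_of_isElliptic (hK : IsFunctionField F K) {ω : P.Omega} (hω : IsElliptic ω)
    {ε : P.Cinf} (hε : ε ^ Nat.card F ^ 2 = ε) (h0 : ε ≠ 0) : ∃ g : P.G, Eigen g.1 ω ε := by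
  have h1 : Units.mk0 ε h0 ∈ (eigenvalueHom ω).range := by
    rw [range_eigenvalueHom hK hω, mem_rootsOfUnity']
    exact (pow_card_sq_iff_pow_eq_one h0).1 hε
  obtain ⟨g, hg⟩ := h1
  have : den (P.toGLinf g) ω.1 = ε := congrArg Units.val hg
  exact ⟨g, this ▸ eigen_den g.2⟩

theorem ne_zero_of_pow_card_ne {ε : P.Cinf} (h : ε ^ Nat.card F ≠ ε) : ε ≠ 0 := by
  rintro rfl
  exact h (zero_pow (one_lt_natCard F).ne_bot)

/-- The determinant of an element of an order is a constant, hence a unit of `A` unless it is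
zero. -/
theorem exists_unit_of_mem_orderAt (hK : IsFunctionField F K) {h : GL (Fin 2) P.Kinf}
    {T : Matrix (Fin 2) (Fin 2) P.affineRing} (hT : T ∈ orderAt h) (hdet : T.det ≠ 0) :
    ∃ u : P.G, u.1 = T := by
  obtain ⟨-, n, -, hn⟩ := exists_const_of_mem_orderAt hK hT
  have hn0 : n ≠ 0 := by
    rintro rfl
    rw [map_zero] at hn
    exact hdet hn
  have hu : IsUnit T := by
    rw [Matrix.isUnit_iff_isUnit_det, hn]
    exact (isUnit_iff_ne_zero.2 hn0).map P.constA
  exact ⟨hu.unit, rfl⟩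

/-- Elliptic elements with the same image under the building map are equivalent under `G`
or have the same stabilizer: if `g` and `g'` in their stabilizers have the same characteristic
polynomial, with trace `t`, then `T = g' + g - t` satisfies `g' T = T g`, and `T` is zero or
invertible. -/
theorem exists_smul_eq_or_stabilizer_eq (hK : IsFunctionField F K)
    {ω ω' : P.Omega} (hω : IsElliptic ω) (hω' : IsElliptic ω') {v : P.Vertex}
    (h : BuildingMapsTo ω v) (h' : BuildingMapsTo ω' v) :
    (∃ u : P.G, u • ω = ω') ∨ MulAction.stabilizer P.G ω = MulAction.stabilizer P.G ω' := by
  obtain ⟨k, rfl⟩ := exists_eq_smul_stdVertex v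
  obtain ⟨g, hg, hns⟩ := hω
  have he := eigen_den hg
  set ε := den (P.toGLinf g) ω.1
  have hε := he.pow_card_ne hns
  obtain ⟨g', he'⟩ := exists_eigen_of_isElliptic hK hω' (he.pow_card_sq hK)
    (ne_zero_of_pow_card_ne hε)
  have hns' := nonscalar_of_eigen he' (he.notMem_range hns)
  obtain ⟨t, n, ht, hn, hroot⟩ := he.trace_det_const hK hns
  obtain ⟨t', n', ht', hn', hroot'⟩ := he'.trace_det_const hK hns'
  -- both matrices have the minimal polynomial of `ε` over `F` as characteristic polynomial
  have htt : t' = t := by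
    by_contra hne
    have hne' : P.constC (t' - t) ≠ 0 := (map_ne_zero _).2 (sub_ne_zero.2 hne)
    refine hε ((pow_card_eq_self_iff P.constC ε).2 ⟨(n' - n) / (t' - t), ?_⟩)
    rw [map_div₀, eq_div_iff hne', map_sub, map_sub]
    linear_combination hroot - hroot'
  subst htt
  have hnn : n' = n := P.constC.injective (by linear_combination hroot' - hroot)
  subst hnn
  let T := g'.1 + g.1 - P.constA t' • (1 : Matrix (Fin 2) (Fin 2) P.affineRing)
  have hgT : g'.1 * T = T * g.1 := by
    have c1 := cayleyHamilton_fin_two g.1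
    have c2 := cayleyHamilton_fin_two g'.1
    simp only [T, mul_add, add_mul, mul_sub, sub_mul, c1, c2, ht, ht', hn, hn', Matrix.mul_smul,
      Matrix.smul_mul, mul_one, one_mul]
    abel
  by_cases hT : T = 0
  · right
    have h1 : g'.1 = Matrix.scalar (Fin 2) (P.constA t') - g.1 := by
      rw [eq_sub_iff_add_eq, ← sub_eq_zero, ← hT]
      simp only [T]
      rw [Matrix.smul_one_eq_diagonal]
      rfl
    have h2 := (Eigen.scalar (P.constA t') ω).sub he
    rw [← h1] at h2
    exact stabilizer_eq_of_smul_eq hK hns' h2.smul_eq he'.smul_eq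
  · left
    have hm : ∀ {x : P.G} {ω : P.Omega}, BuildingMapsTo ω (k • P.stdVertex) → x • ω = ω →
        x.1 ∈ orderAt k := fun hb hx => (smul_vertex_eq_iff hK _ k).1 (hb.smul_eq hx)
    have hTm : T ∈ orderAt k := sub_mem (add_mem (hm h' he'.smul_eq) (hm h hg))
      (smul_mem_orderAt (one_mem _) (norm_affineToKinf_constA_le t'))
    obtain ⟨u, hu⟩ := exists_unit_of_mem_orderAt hK hTm
      (det_ne_zero_of_intertwines he' hns' hgT hT)
    refine ⟨u, ?_⟩
    have h3 := he.conj u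
    have h4 : u.1 * g.1 * (u⁻¹ : P.G).1 = g'.1 := by
      rw [hu, ← hgT, ← hu, Matrix.mul_assoc, ← Units.val_mul, mul_inv_cancel, Units.val_one,
        Matrix.mul_one]
    rw [h4] at h3
    exact h3.point_eq he' hns'

/-! ### Vertices with stabilizer `GL₂(F)` -/

/-- The stabilizer of a vertex is the group of units of the order. -/
def stabilizerEquivUnits (hK : IsFunctionField F K) (h : GL (Fin 2) P.Kinf) :
    MulAction.stabilizer P.G (h • P.stdVertex) ≃* (orderAt h)ˣ where
  toFun g :=
    { val := ⟨g.1.1, (smul_vertex_eq_iff hK _ h).1 g.2⟩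
      inv := ⟨(g.1⁻¹ : P.G).1, (smul_vertex_eq_iff hK _ h).1 (g⁻¹).2⟩
      val_inv := Subtype.ext g.1.mul_inv
      inv_val := Subtype.ext g.1.inv_mul }
  invFun u := ⟨⟨u.1.1, u.2.1, congrArg Subtype.val u.3, congrArg Subtype.val u.4⟩,
    (smul_vertex_eq_iff hK _ h).2 u.1.2⟩
  left_inv _ := Subtype.ext (Units.ext rfl)
  right_inv _ := Units.ext rfl
  map_mul' _ _ := Units.ext rfl

/-- If the order of a vertex contains a matrix that does not commute with the stabilizer of an
elliptic element above the vertex, then it is conjugate to `M₂(F)`. The commutator of such a matrix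
with `g` conjugates `g` to `t - g`; a multiple of it by an element of `F[g]` is an involution `s`,
and in the basis `w, w g`, with `w` fixed by `s`, the matrices `1, g, s, g s` span `M₂(F)`. -/
theorem orderAt_ringEquiv (hK : IsFunctionField F K) (h : GL (Fin 2) P.Kinf)
    {g : P.G} {ω : P.Omega} {ε : P.Cinf} (he : Eigen g.1 ω ε)
    (hns : ∀ a : P.affineRing, g.1 ≠ Matrix.scalar (Fin 2) a) (hg : g.1 ∈ orderAt h)
    {Y : Matrix (Fin 2) (Fin 2) P.affineRing} (hY : Y ∈ orderAt h) (hYg : Y * g.1 ≠ g.1 * Y) :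
    Nonempty (orderAt h ≃+* Matrix (Fin 2) (Fin 2) F) := by
  obtain ⟨t, n, ht, hn, hroot⟩ := he.trace_det_const hK hns
  have hgg : g.1 * g.1 = P.constA t • g.1 - P.constA n • 1 := by
    rw [cayleyHamilton_fin_two, ht, hn]
  have hε := he.pow_card_ne hns
  have hεq := (pow_card_eq_or_of_quadratic _ hroot).resolve_left hε
  have hsm : ∀ (a : F) {X}, X ∈ orderAt h → P.constA a • X ∈ orderAt h := fun a X hX =>
    smul_mem_orderAt hX (norm_affineToKinf_constA_le a)
  have hdisc : 4 * n - t ^ 2 ≠ 0 := by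
    intro h0
    have h1 : (ε ^ Nat.card F - ε) ^ 2 = -P.constC (4 * n - t ^ 2) := by
      rw [hεq, map_sub, map_mul, map_pow, map_ofNat]
      linear_combination 4 * hroot
    rw [h0, map_zero, neg_zero] at h1
    exact hε (sub_eq_zero.1 (pow_eq_zero_iff two_ne_zero |>.1 h1))
  -- `D` anticommutes with `g`, up to the trace
  set D := Y * g.1 - g.1 * Y with hD
  have hD0 : D ≠ 0 := sub_ne_zero.2 hYg
  have hDm : D ∈ orderAt h := sub_mem (mul_mem hY hg) (mul_mem hg hY)
  have hDg : D * g.1 = P.constA t • D - g.1 * D := by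
    have c1 : g.1 * (g.1 * Y) = P.constA t • (g.1 * Y) - P.constA n • Y := by
      rw [← Matrix.mul_assoc, hgg, sub_mul, Matrix.smul_mul, Matrix.smul_mul, one_mul]
    have c2 : Y * g.1 * g.1 = P.constA t • (Y * g.1) - P.constA n • Y := by
      rw [Matrix.mul_assoc, hgg, mul_sub, Matrix.mul_smul, Matrix.mul_smul, mul_one]
    rw [hD, sub_mul, mul_sub, c1, c2, smul_sub, Matrix.mul_assoc g.1 Y g.1]
    abel
  have hDtr : D.trace = 0 := by
    rw [hD, Matrix.trace_sub, Matrix.trace_mul_comm, sub_self]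
  have hgDtr : (g.1 * D).trace = 0 := by
    rw [hD, mul_sub, Matrix.trace_sub, ← Matrix.mul_assoc, Matrix.trace_mul_comm,
      sub_self]
  clear_value D
  obtain ⟨-, m, -, hm⟩ := exists_const_of_mem_orderAt hK hDm
  have hm0 : m ≠ 0 := by
    rintro rfl
    refine det_ne_zero_of_intertwines (X := P.constA t • 1 - g.1) he hns ?_ hD0
      (by rw [hm, map_zero])
    rw [mul_sub, hDg, Matrix.mul_smul, mul_one, sub_sub_cancel]
  -- multiplying `D` by an element of `F[g]` of norm `-1 / det D` gives an involution
  obtain ⟨ζ, hζ⟩ := P.exists_isPrimitiveRoot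
  obtain ⟨z, hz, hzn⟩ := exists_norm_eq_of_isPrimitiveRoot P.constC hζ
    (neg_ne_zero.2 (inv_ne_zero hm0))
  obtain ⟨x, y, rfl⟩ := exists_eq_add_mul P.constC (he.pow_card_sq hK) hε hz
  have hxy : x ^ 2 + x * y * t + y ^ 2 * n = -m⁻¹ := by
    refine P.constC.injective ?_
    rw [← hzn, add_pow_card P.constC, mul_pow, pow_card_map, pow_card_map, hεq]
    simp only [map_add, map_mul, map_pow]
    linear_combination P.constC y ^ 2 * hroot
  obtain ⟨s, hs⟩ : ∃ s, s = (P.constA x • 1 + P.constA y • g.1) * D := ⟨_, rfl⟩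
  have hsm' : s ∈ orderAt h := by
    rw [hs]
    exact mul_mem (add_mem (hsm x (one_mem _)) (hsm y hg)) hDm
  have hstr : s.trace = 0 := by
    rw [hs, add_mul, Matrix.smul_mul, Matrix.smul_mul, one_mul, Matrix.trace_add,
      Matrix.trace_smul, Matrix.trace_smul, hDtr, hgDtr, smul_zero, smul_zero, add_zero]
  have hsdet : s.det = -1 := by
    have h1 : (P.constA x • 1 + P.constA y • g.1).det =
        P.constA (x ^ 2 + x * y * t + y ^ 2 * n) := by
      simp only [map_add, map_mul, map_pow]
      rw [← ht, ← hn, Matrix.det_fin_two, Matrix.trace_fin_two, Matrix.det_fin_two]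
      simp
      ring
    rw [hs, Matrix.det_mul, h1, hm, hxy, ← map_mul, neg_mul, inv_mul_cancel₀ hm0, map_neg, map_one]
  have hgs : g.1 * s = s * (P.constA t • 1 - g.1) := by
    have h1 : g.1 * D = D * (P.constA t • 1 - g.1) := by
      rw [mul_sub, hDg, Matrix.mul_smul, mul_one, sub_sub_cancel]
    have h2 : g.1 * (P.constA x • 1 + P.constA y • g.1) =
        (P.constA x • 1 + P.constA y • g.1) * g.1 := by
      simp only [mul_add, add_mul, Matrix.mul_smul, Matrix.smul_mul, mul_one, one_mul]
    rw [hs, ← Matrix.mul_assoc, h2, Matrix.mul_assoc, h1, Matrix.mul_assoc]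
  -- a fixed row vector `w` of the involution gives the basis `w, w g`
  let ι := P.affineToKinf.mapMatrix (m := Fin 2)
  have hι : ∀ X, ι X = X.map P.affineToKinf := fun _ => rfl
  obtain ⟨w, hw, hw0⟩ : ∃ w : Fin 2 → P.Kinf, w ≠ 0 ∧ Matrix.vecMul w (ι (s - 1)) = 0 := by
    refine Matrix.exists_vecMul_eq_zero_iff.2 ?_
    have h1 : (s - 1).det = 0 := by
      have : (s - 1).det = s.det - s.trace + 1 := by
        rw [Matrix.det_fin_two, Matrix.det_fin_two, Matrix.trace_fin_two]
        simp
        ring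
      rw [this, hstr, hsdet]; ring
    rw [← RingHom.map_det, h1, map_zero]
  rw [map_sub, map_one, Matrix.vecMul_sub, Matrix.vecMul_one, sub_eq_zero] at hw0
  set R := rowPair w g.1 with hR
  have hRu : IsUnit R.det := isUnit_iff_ne_zero.2 (det_rowPair_ne_zero he hns hw)
  let f : F →+* P.Kinf := P.affineToKinf.comp P.constA
  let ψ := f.mapMatrix (m := Fin 2)
  let φ : Matrix (Fin 2) (Fin 2) P.affineRing →+* Matrix (Fin 2) (Fin 2) P.Kinf :=
    { toFun := fun X => R * ι X * R⁻¹
      map_one' := by rw [map_one, mul_one, Matrix.mul_nonsing_inv _ hRu]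
      map_mul' := fun X Y => by
        rw [map_mul]
        simp only [Matrix.mul_assoc]
        rw [← Matrix.mul_assoc R⁻¹ R, Matrix.nonsing_inv_mul _ hRu, Matrix.one_mul]
      map_zero' := by rw [map_zero, mul_zero, zero_mul]
      map_add' := fun X Y => by rw [map_add, mul_add, add_mul] }
  have hφ : ∀ X Z, R * ι X = Z * R → φ X = Z := fun X Z hXZ => by
    change R * ι X * R⁻¹ = Z
    rw [hXZ, Matrix.mul_assoc, Matrix.mul_nonsing_inv _ hRu, Matrix.mul_one]
  have hR0 : R 0 = w := rfl
  have hR1 : R 1 = Matrix.vecMul w (ι g.1) := rfl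
  let G₀ : Matrix (Fin 2) (Fin 2) F := !![0, 1; -n, t]
  let S₀ : Matrix (Fin 2) (Fin 2) F := !![1, 0; t, -1]
  have hrow : ∀ (A B : Matrix (Fin 2) (Fin 2) P.Kinf), A 0 = B 0 → A 1 = B 1 → A = B := by
    intro A B h0 h1
    refine funext fun i => ?_
    fin_cases i
    · exact h0
    · exact h1
  have hmulrow : ∀ (A B : Matrix (Fin 2) (Fin 2) P.Kinf) i, (A * B) i = Matrix.vecMul (A i) B :=
    fun A B i => rfl
  have hvec : ∀ (Z : Matrix (Fin 2) (Fin 2) F) i, (ψ Z * R) i =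
      f (Z i 0) • w + f (Z i 1) • Matrix.vecMul w (ι g.1) := by
    intro Z i
    rw [hmulrow, hR, vecMul_rowPair]
    rfl
  have hιc : ∀ (a : F) X, ι (P.constA a • X) = f a • ι X := fun a X => by
    refine Matrix.ext fun i j => ?_
    simp [ι, f]
  have hφg : φ g.1 = ψ G₀ := by
    refine hφ _ _ (hrow _ _ ?_ ?_)
    · rw [hvec, hmulrow, hR0]
      simp [G₀]
    · rw [hvec, hmulrow, hR1, Matrix.vecMul_vecMul, ← map_mul, hgg, map_sub, hιc, hιc, map_one,
        Matrix.vecMul_sub, Matrix.vecMul_smul, Matrix.vecMul_smul, Matrix.vecMul_one]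
      simp [G₀, f]
      abel
  have hφs : φ s = ψ S₀ := by
    refine hφ _ _ (hrow _ _ ?_ ?_)
    · rw [hvec, hmulrow, hR0, hw0]
      simp [S₀]
    · rw [hvec, hmulrow, hR1, Matrix.vecMul_vecMul, ← map_mul, hgs, map_mul, ← Matrix.vecMul_vecMul,
        hw0, map_sub, hιc, map_one, Matrix.vecMul_sub, Matrix.vecMul_smul, Matrix.vecMul_one]
      simp [S₀, f, sub_eq_add_neg]
  have hφc : ∀ a : F, φ (P.constA a • 1) = ψ (a • 1) := fun a => by
    refine hφ _ _ ?_
    have : ψ (a • 1) = f a • 1 := by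
      refine Matrix.ext fun i j => ?_
      simp [ψ, Matrix.smul_apply, Matrix.one_apply, apply_ite f]
    rw [this, hιc, map_one, Matrix.mul_smul, Matrix.smul_mul, mul_one, one_mul]
  -- the conjugate of the order contains `M₂(F)`, which is spanned by `1, G₀, S₀, G₀ S₀`
  have hsup : ∀ Z : Matrix (Fin 2) (Fin 2) F, ∃ X ∈ orderAt h, φ X = ψ Z := by
    intro Z
    obtain ⟨c, d, hc, hd⟩ : ∃ c d, 2 * c + t * d = Z 0 0 + t * Z 0 1 - Z 1 1 ∧
        t * c + (t ^ 2 - 2 * n) * d = Z 1 0 + n * Z 0 1 := by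
      generalize Z 0 0 + t * Z 0 1 - Z 1 1 = p
      generalize Z 1 0 + n * Z 0 1 = r
      have hΔ := mul_inv_cancel₀ hdisc
      exact ⟨(t * r - (t ^ 2 - 2 * n) * p) * (4 * n - t ^ 2)⁻¹,
        (t * p - 2 * r) * (4 * n - t ^ 2)⁻¹,
        by linear_combination p * hΔ, by linear_combination r * hΔ⟩
    obtain ⟨a, ha⟩ : ∃ a, a = Z 0 0 - c - d * t := ⟨_, rfl⟩
    obtain ⟨b, hb⟩ : ∃ b, b = Z 0 1 + d := ⟨_, rfl⟩
    have hZ : Z = a • 1 + (b • 1) * G₀ + (c • 1) * S₀ + (d • 1) * (G₀ * S₀) := by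
      refine Matrix.ext fun i j => ?_
      fin_cases i <;> fin_cases j
      · simp [G₀, S₀]; linear_combination -ha
      · simp [G₀, S₀]; linear_combination -hb
      · simp [G₀, S₀]; linear_combination n * hb - hd
      · simp [G₀, S₀]; linear_combination -ha - t * hb + hc
    refine ⟨P.constA a • 1 + (P.constA b • 1) * g.1 + (P.constA c • 1) * s +
      (P.constA d • 1) * (g.1 * s), ?_, ?_⟩
    · exact add_mem (add_mem (add_mem (hsm _ (one_mem _)) (mul_mem (hsm _ (one_mem _)) hg))
        (mul_mem (hsm _ (one_mem _)) hsm')) (mul_mem (hsm _ (one_mem _)) (mul_mem hg hsm'))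
    · rw [hZ]
      simp only [map_add, map_mul, hφg, hφs, hφc]
  -- conversely, the traces of all products with elements of `M₂(F)` are constants
  have hsub : ∀ X ∈ orderAt h, ∃ Z, ψ Z = φ X := by
    intro X hX
    have hent : ∀ i j, ∃ a : F, f a = φ X i j := by
      intro i j
      obtain ⟨X', hX', he'⟩ := hsup (Matrix.single j i 1)
      obtain ⟨a, -, ha, -⟩ := exists_const_of_mem_orderAt hK (mul_mem hX hX')
      refine ⟨a, ?_⟩
      have h1 : (φ (X * X')).trace = P.affineToKinf (X * X').trace := by
        change (R * ι (X * X') * R⁻¹).trace = _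
        rw [Matrix.trace_mul_comm, ← Matrix.mul_assoc, Matrix.nonsing_inv_mul _ hRu, Matrix.one_mul,
          Matrix.trace_fin_two, Matrix.trace_fin_two, map_add]
        rfl
      have h2 : ψ (Matrix.single j i 1) = Matrix.single j i 1 := by
        refine Matrix.ext fun k l => ?_
        simp [ψ, Matrix.single_apply, apply_ite f]
      rw [map_mul, he', h2, Matrix.trace_mul_single, ha] at h1
      simpa [f] using h1.symm
    choose Z hZ using hent
    exact ⟨Matrix.of Z, Matrix.ext fun i j => hZ i j⟩
  let φ' := φ.comp (orderAt h).subtype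
  have hφinj : Function.Injective φ' := by
    intro X X' hXX
    have h1 : R * ι X.1 * R⁻¹ = R * ι X'.1 * R⁻¹ := hXX
    have h2 : ι X.1 = ι X'.1 := by
      have h3 : ∀ M, R⁻¹ * (R * M * R⁻¹) * R = M := fun M => by
        rw [Matrix.mul_assoc R M, ← Matrix.mul_assoc R⁻¹ R, Matrix.nonsing_inv_mul _ hRu,
          Matrix.one_mul, Matrix.mul_assoc, Matrix.nonsing_inv_mul _ hRu, Matrix.mul_one]
      rw [← h3 (ι X.1), h1, h3]
    exact Subtype.ext (Matrix.map_injective affineToKinf_injective h2)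
  have hψinj : Function.Injective ψ := Matrix.map_injective f.injective
  have hrange : φ'.range = ψ.range := by
    refine le_antisymm ?_ ?_
    · rintro _ ⟨X, rfl⟩
      exact hsub X.1 X.2
    · rintro _ ⟨Z, rfl⟩
      obtain ⟨X, hX, hXZ⟩ := hsup Z
      exact ⟨⟨X, hX⟩, hXZ⟩
  exact ⟨((RingEquiv.ofBijective φ'.rangeRestrict
      ⟨fun a b hab => hφinj (congrArg Subtype.val hab), φ'.rangeRestrict_surjective⟩).trans
    (RingEquiv.subringCongr hrange)).trans (RingEquiv.ofBijective ψ.rangeRestrict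
      ⟨fun a b hab => hψinj (congrArg Subtype.val hab), ψ.rangeRestrict_surjective⟩).symm⟩

end Place
end Drinfeld

namespace Drinfeld

/-! ### The groups `GL₂(F_q)` and `F_{q²}ˣ` -/

section FiniteGroups

variable (F : Type*) [Field F] [Finite F]

theorem natCard_Fq2 : Nat.card (Fq2 F) = Nat.card F ^ 2 := by
  obtain ⟨p, n, hp, hpp, hn, hcard⟩ := exists_card_eq_prime_pow F
  have hq := one_lt_natCard F
  have hq2 : 1 < Nat.card F ^ 2 := Nat.one_lt_pow two_ne_zero hq
  set f : Polynomial F := Polynomial.X ^ (Nat.card F ^ 2) - Polynomial.X with hf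
  have hsep : f.Separable := galois_poly_separable p _ (by
    rw [hcard, ← pow_mul]
    exact dvd_pow_self p (by omega))
  have h1 := Polynomial.card_rootSet_eq_natDegree hsep (Polynomial.SplittingField.splits f)
  rw [hf, FiniteField.X_pow_card_sub_X_natDegree_eq F hq2, ← hf] at h1
  have hf0 : f ≠ 0 := FiniteField.X_pow_card_sub_X_ne_zero F hq2
  have hmem : ∀ z : f.SplittingField, z ∈ f.rootSet f.SplittingField ↔ z ^ Nat.card F ^ 2 = z := by
    intro z
    have : Polynomial.aeval z f = z ^ Nat.card F ^ 2 - z := by simp [f]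
    rw [Polynomial.mem_rootSet_of_ne hf0, this, sub_eq_zero]
  have hall : ∀ z : f.SplittingField, z ^ Nat.card F ^ 2 = z := by
    intro z
    have hz : z ∈ Algebra.adjoin F (f.rootSet f.SplittingField) := by
      rw [Polynomial.SplittingField.adjoin_rootSet]
      exact Algebra.mem_top
    induction hz using Algebra.adjoin_induction with
    | mem z hz => exact (hmem z).1 hz
    | algebraMap r => rw [pow_card_sq, pow_card_map, pow_card_map]
    | add x y _ _ hx hy =>
      rw [pow_card_sq] at hx hy ⊢
      rw [add_pow_card (algebraMap F _), add_pow_card (algebraMap F _), hx, hy]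
    | mul x y _ _ hx hy => rw [mul_pow, hx, hy]
  have huniv : f.rootSet f.SplittingField = Set.univ :=
    Set.eq_univ_of_forall fun z => (hmem z).2 (hall z)
  rw [← Nat.card_eq_fintype_card, huniv, Nat.card_univ] at h1
  exact h1

theorem finite_Fq2 : Finite (Fq2 F) := Nat.finite_of_card_ne_zero (by
  rw [natCard_Fq2]
  exact pow_ne_zero _ (one_lt_natCard F).ne_bot)

theorem natCard_units_Fq2 : Nat.card (Fq2 F)ˣ = Nat.card F ^ 2 - 1 := by
  have := finite_Fq2 F
  rw [Nat.card_units, natCard_Fq2]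

theorem isCyclic_units_Fq2 : IsCyclic (Fq2 F)ˣ := by
  have := finite_Fq2 F
  infer_instance

theorem natCard_sq_sub_one_dvd_card_GL : Nat.card F ^ 2 - 1 ∣ Nat.card (GL (Fin 2) F) := by
  have : Fintype F := Fintype.ofFinite F
  rw [Matrix.card_GL_field, Fin.prod_univ_two, Nat.card_eq_fintype_card]
  simp

theorem exists_GL_not_commute {R : Type*} [CommRing R] [Nontrivial R] :
    ∃ a b : GL (Fin 2) R, a * b ≠ b * a := by
  refine ⟨⟨!![1, 1; 0, 1], !![1, -1; 0, 1], ?_, ?_⟩, ⟨!![1, 0; 1, 1], !![1, 0; -1, 1], ?_, ?_⟩,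
    fun h => ?_⟩
  iterate 4
    · ext i j
      fin_cases i <;> fin_cases j <;> simp [Matrix.mul_apply, Fin.sum_univ_two]
  have h1 := congrArg (fun g : GL (Fin 2) R => g.1 1 1) h
  simp [Matrix.mul_apply, Fin.sum_univ_two] at h1

end FiniteGroups

namespace Place

variable {F K : Type*} [Field F] [Field K] [Algebra F K] {P : Place F K}

/-! ### The stabilizers of vertices -/

/-- A matrix that commutes with `g` maps the eigenspace of `(ω, 1)` to itself. -/
theorem smul_eq_of_commute {ω : P.Omega} {g Y : P.G} {ε : P.Cinf} (he : Eigen g.1 ω ε)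
    (hns : ∀ a : P.affineRing, g.1 ≠ Matrix.scalar (Fin 2) a) (h : Y.1 * g.1 = g.1 * Y.1) :
    Y • ω = ω := by
  have h1 := he.conj Y
  rw [h, Matrix.mul_assoc, ← Units.val_mul, mul_inv_cancel, Units.val_one, Matrix.mul_one] at h1
  exact h1.point_eq he hns

variable [Finite F]

theorem isGoodVertex_of_mulEquiv_GL (hK : IsFunctionField F K) (hδ : Odd P.degree) {v : P.Vertex}
    (e : MulAction.stabilizer P.G v ≃* GL (Fin 2) F) : IsGoodVertex v := by
  refine ⟨finite_stabilizer hK hδ v, ?_⟩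
  rw [Nat.card_congr e.toEquiv]
  exact natCard_sq_sub_one_dvd_card_GL F

theorem isGoodVertex_of_mulEquiv_units (hK : IsFunctionField F K) (hδ : Odd P.degree)
    {v : P.Vertex} (e : MulAction.stabilizer P.G v ≃* (Fq2 F)ˣ) : IsGoodVertex v := by
  refine ⟨finite_stabilizer hK hδ v, ?_⟩
  rw [Nat.card_congr e.toEquiv, natCard_units_Fq2]

/-- The stabilizer of the vertex of an elliptic element `ω` either commutes with that of `ω`, and is
equal to it, or is conjugate to `GL₂(F)`. -/
theorem IsGoodVertex.nonempty_mulEquiv (hK : IsFunctionField F K) (hδ : Odd P.degree)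
    {v : P.Vertex} (hv : IsGoodVertex v) :
    Nonempty (MulAction.stabilizer P.G v ≃* GL (Fin 2) F) ∨
      Nonempty (MulAction.stabilizer P.G v ≃* (Fq2 F)ˣ) := by
  obtain ⟨ω, hω, hb⟩ := hv.exists_isElliptic hK hδ
  obtain ⟨g, hg, hns⟩ := id hω
  have he := eigen_den hg
  by_cases hcomm : ∀ Y ∈ MulAction.stabilizer P.G v, Y.1 * g.1 = g.1 * Y.1
  · right
    have heq : MulAction.stabilizer P.G v = MulAction.stabilizer P.G ω :=
      le_antisymm (fun Y hY => smul_eq_of_commute he hns (hcomm Y hY)) hb.stabilizer_le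
    have h1 := isCyclic_stabilizer hK hω
    have h2 := isCyclic_units_Fq2 F
    rw [heq]
    exact ⟨mulEquivOfCyclicCardEq (by rw [card_stabilizer hK hω, natCard_units_Fq2])⟩
  · left
    push Not at hcomm
    obtain ⟨Y, hY, hYg⟩ := hcomm
    obtain ⟨h, rfl⟩ := exists_eq_smul_stdVertex v
    obtain ⟨φ⟩ := orderAt_ringEquiv hK h he hns
      ((smul_vertex_eq_iff hK _ h).1 (hb.stabilizer_le hg)) ((smul_vertex_eq_iff hK _ h).1 hY) hYg
    exact ⟨(stabilizerEquivUnits hK h).trans (Units.mapEquiv φ.toMulEquiv)⟩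

/-! ### Elliptic elements with the same stabilizer -/

/-- Elliptic elements with the same stabilizer have the same vertex, the only one that the
stabilizer fixes. -/
theorem BuildingMapsTo.of_stabilizer_eq (hK : IsFunctionField F K) (hδ : Odd P.degree)
    {ω ω' : P.Omega} (hω : IsElliptic ω)
    (h : MulAction.stabilizer P.G ω = MulAction.stabilizer P.G ω')
    {v : P.Vertex} (hb : BuildingMapsTo ω v) : BuildingMapsTo ω' v := by
  obtain ⟨g, hg, hns⟩ := hω
  have hg' : g • ω' = ω' := by
    rw [h] at hg
    exact hg
  obtain ⟨w, hw⟩ := exists_buildingMapsTo hK hδ (IsElliptic.of_smul_eq hns hg')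
  rwa [hw.eq_of_smul_eq hK hδ hns hg' (hb.smul_eq hg)] at hw

/-- At most two elliptic elements have the same stabilizer. -/
theorem eq_or_eq_of_stabilizer_eq (hK : IsFunctionField F K) {ω ω' ω'' : P.Omega}
    (hω : IsElliptic ω) (h' : MulAction.stabilizer P.G ω = MulAction.stabilizer P.G ω')
    (h'' : MulAction.stabilizer P.G ω = MulAction.stabilizer P.G ω'') (hne : ω ≠ ω') :
    ω'' = ω ∨ ω'' = ω' := by
  obtain ⟨g, hg, hns⟩ := hω
  have he := eigen_den hg
  have hg' : g • ω' = ω' := by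
    rw [h'] at hg
    exact hg
  have hg'' : g • ω'' = ω'' := by
    rw [h''] at hg
    exact hg
  rcases eigen_or_eigen_pow hK hns he hg'' with h1 | h1
  · exact Or.inl (h1.point_eq he hns)
  · rcases eigen_or_eigen_pow hK hns he hg' with h2 | h2
    · exact absurd (he.point_eq h2 hns) hne
    · exact Or.inr (h1.point_eq h2 hns)

/-- If `G_v ≃ GL₂(F)`, all elliptic elements above `v` are equivalent. -/
theorem exists_smul_eq_of_mulEquiv_GL (hK : IsFunctionField F K) {v : P.Vertex}
    (e : MulAction.stabilizer P.G v ≃* GL (Fin 2) F) {ω ω' : P.Omega}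
    (hω : IsElliptic ω) (hω' : IsElliptic ω') (h : BuildingMapsTo ω v) (h' : BuildingMapsTo ω' v) :
    ∃ u : P.G, u • ω = ω' := by
  rcases exists_smul_eq_or_stabilizer_eq hK hω hω' h h' with h1 | h1
  · exact h1
  by_cases hne : ω = ω'
  · exact ⟨1, by rw [one_smul, hne]⟩
  -- the stabilizer of `v` moves `ω`, since it is not commutative
  obtain ⟨Y, hYv, hY⟩ : ∃ Y ∈ MulAction.stabilizer P.G v, Y • ω ≠ ω := by
    by_contra! hall
    have heq : MulAction.stabilizer P.G v = MulAction.stabilizer P.G ω :=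
      le_antisymm hall h.stabilizer_le
    have hcyc : IsCyclic (MulAction.stabilizer P.G v) := by
      rw [heq]
      exact isCyclic_stabilizer hK hω
    obtain ⟨a, b, hab⟩ := exists_GL_not_commute (R := F)
    refine hab (e.symm.injective ?_)
    rw [map_mul, map_mul]
    exact hcyc.commGroup.mul_comm _ _
  have hYb : BuildingMapsTo (Y • ω) v := by
    have := h.smul_G Y
    rwa [hYv] at this
  by_cases hst : MulAction.stabilizer P.G ω = MulAction.stabilizer P.G (Y • ω)
  · exact ⟨Y, (eq_or_eq_of_stabilizer_eq hK hω h1 hst hne).resolve_left hY⟩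
  · rcases exists_smul_eq_or_stabilizer_eq hK hω' (hω.smul Y) h' hYb with ⟨u, hu⟩ | h2
    · exact ⟨u⁻¹ * Y, by rw [mul_smul, ← hu, inv_smul_smul]⟩
    · exact absurd (h1.trans h2) hst

/-- If `G_v ≃ F_{q²}ˣ`, then `G_v` is the stabilizer of each elliptic element above `v`, and
distinct elliptic elements above `v` are not equivalent. -/
theorem eq_of_smul_eq_of_mulEquiv_units (hK : IsFunctionField F K) (hδ : Odd P.degree)
    {v : P.Vertex} (e : MulAction.stabilizer P.G v ≃* (Fq2 F)ˣ) {ω ω' : P.Omega}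
    (hω : IsElliptic ω) (h : BuildingMapsTo ω v) (h' : BuildingMapsTo ω' v) {u : P.G}
    (hu : u • ω = ω') : ω = ω' := by
  have := finite_stabilizer hK hδ v
  have heq : MulAction.stabilizer P.G ω = MulAction.stabilizer P.G v := by
    refine Subgroup.eq_of_le_of_card_ge h.stabilizer_le ?_
    rw [Nat.card_congr e.toEquiv, natCard_units_Fq2, card_stabilizer hK hω]
  have huv : u ∈ MulAction.stabilizer P.G v := by
    have h1 := h.smul_G u
    rw [hu] at h1
    exact h1.unique h'
  rw [← heq] at huv
  exact (MulAction.mem_stabilizer_iff.1 huv).symm.trans hu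

end Place
end Drinfeld

namespace Drinfeld
namespace Place

variable {F K : Type*} [Field F] [Field K] [Algebra F K] {P : Place F K}

/-! ### The field `K̃` and its Galois group -/

theorem mem_Ktilde_of_pow_card_sq {z : P.Cinf} (h : z ^ Nat.card F ^ 2 = z) : z ∈ P.Ktilde :=
  IntermediateField.subset_adjoin _ _ h

/-- Elements of the Galois group act on the fixed points of a matrix as they act on the
eigenvalues. -/
theorem Eigen.gal_apply_eq {g : P.G} {ω ω' : P.Omega} {ε ε' : P.Cinf} (h : Eigen g.1 ω ε)
    (h' : Eigen g.1 ω' ε') (hns : ∀ a : P.affineRing, g.1 ≠ Matrix.scalar (Fin 2) a) {σ : P.Gal}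
    {x e : P.Ktilde} (hx : ω.1 = x) (he : ε = e) (hσ : (σ e : P.Cinf) = ε') :
    ω'.1 = σ x := by
  have hc : P.affineToCinf (g 1 0) ≠ 0 :=
    (map_ne_zero_iff _ affineToCinf_injective).2 (h.apply_one_zero_ne hns)
  have h1 : algebraMap K P.Ktilde (g 1 0) * x + algebraMap K P.Ktilde (g 1 1) = e := by
    refine Subtype.ext ?_
    rw [← he, ← h.2, hx]
    rfl
  have h2 := congrArg (fun z => (σ z : P.Cinf)) h1
  simp only [map_add, map_mul, AlgEquiv.commutes, hσ] at h2
  have h3 : P.affineToCinf (g 1 0) * σ x + P.affineToCinf (g 1 1) = ε' := h2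
  refine mul_left_cancel₀ hc ?_
  linear_combination h'.2 - h3

theorem mkOmega_eq_iff {ω ω' : P.Omega} : P.mkOmega ω = P.mkOmega ω' ↔ ∃ u : P.G, u • ω' = ω :=
  Quotient.eq.trans (MulAction.orbitRel_apply.trans MulAction.mem_orbit_iff)

theorem mkEll_eq_iff {ω ω' : P.Omega} {hω : IsElliptic ω} {hω' : IsElliptic ω'} :
    mkEll ω hω = mkEll ω' hω' ↔ ∃ u : P.G, u • ω' = ω :=
  Subtype.ext_iff.trans mkOmega_eq_iff

theorem exists_eq_mkEll (c : P.Ell) : ∃ ω : {ω : P.Omega // IsElliptic ω}, c = mkEll ω.1 ω.2 := by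
  obtain ⟨c, ω, hω, rfl⟩ := c
  exact ⟨⟨ω, hω⟩, rfl⟩

variable [Finite F]

variable (P) in
/-- There is an element of `F_{q²} ⊆ C_∞` that is not in `F_q`. -/
theorem exists_pow_card_ne : ∃ ζ : P.Cinf, ζ ^ Nat.card F ^ 2 = ζ ∧ ζ ^ Nat.card F ≠ ζ := by
  obtain ⟨ζ, hζ⟩ := P.exists_isPrimitiveRoot
  have hq := one_lt_natCard F
  have hpos := natCard_sq_sub_one_pos F
  have h0 : ζ ≠ 0 := hζ.ne_zero hpos.ne'
  refine ⟨ζ, (pow_card_sq_iff_pow_eq_one h0).2 hζ.pow_eq_one, fun h => ?_⟩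
  have h1 : ζ ^ (Nat.card F - 1) = 1 := by
    refine mul_right_cancel₀ h0 ?_
    rw [← pow_succ, Nat.sub_add_cancel hq.le, h, one_mul]
  have h2 := Nat.le_of_dvd (by omega) (hζ.dvd_of_pow_eq_one _ h1)
  have h3 : Nat.card F < Nat.card F ^ 2 := lt_self_pow₀ hq one_lt_two
  omega

variable (P) in
theorem isGalois_Ktilde : FiniteDimensional K P.Ktilde ∧ IsGalois K P.Ktilde := by
  obtain ⟨p, n, hp, hpp, hn, hcard⟩ := exists_card_eq_prime_pow F
  have hq2 : 1 < Nat.card F ^ 2 := Nat.one_lt_pow two_ne_zero (one_lt_natCard F)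
  have hpK : CharP K p := charP_of_injective_algebraMap (algebraMap F K).injective p
  set f : Polynomial K := Polynomial.X ^ (Nat.card F ^ 2) - Polynomial.X with hf
  have hsep : f.Separable := galois_poly_separable p _ (by
    rw [hcard, ← pow_mul]
    exact dvd_pow_self p (by omega))
  have hf0 : f ≠ 0 := FiniteField.X_pow_card_sub_X_ne_zero K hq2
  have hroot : f.rootSet P.Cinf = {z : P.Cinf | z ^ (Nat.card F ^ 2) = z} := by
    ext z
    have : Polynomial.aeval z f = z ^ Nat.card F ^ 2 - z := by simp [f]
    rw [Polynomial.mem_rootSet_of_ne hf0, this, sub_eq_zero]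
    rfl
  have hsplit : (f.map (algebraMap K P.Cinf)).Splits := by
    obtain ⟨ζ, hζ⟩ := P.exists_isPrimitiveRoot
    have h1 : f.map (algebraMap K P.Cinf) =
        (Polynomial.X ^ (Nat.card F ^ 2 - 1) - Polynomial.C 1) * Polynomial.X := by
      rw [sub_mul, ← pow_succ, Nat.sub_add_cancel hq2.le]
      simp [f]
    rw [h1]
    exact (Polynomial.X_pow_sub_one_splits hζ).mul Polynomial.Splits.X
  have hsf : f.IsSplittingField K (IntermediateField.adjoin K (f.rootSet P.Cinf)) :=
    IntermediateField.adjoin_rootSet_isSplittingField hsplit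
  rw [hroot] at hsf
  have hsf' : f.IsSplittingField K P.Ktilde := hsf
  exact ⟨hsf'.finiteDimensional, IsGalois.of_separable_splitting_field hsep⟩

variable (P) in
/-- The inclusion of the constants into `K̃`. -/
def constKtilde : F →+* P.Ktilde := (algebraMap K P.Ktilde).comp (algebraMap F K)

/-- `σ ∈ Gal(K̃/K)` is the `q`-power map on `F_{q²}`. -/
def IsFrobenius (σ : P.Gal) : Prop :=
  ∀ z : P.Ktilde, z ^ Nat.card F ^ 2 = z → σ z = z ^ Nat.card F

/-- An element of `Gal(K̃/K)` is determined on `F_{q²}` by its value at a generator, one of the two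
roots of a quadratic polynomial over `F`. -/
theorem gal_trivial_or_isFrobenius (σ : P.Gal) :
    (∀ z : P.Ktilde, z ^ Nat.card F ^ 2 = z → σ z = z) ∨ IsFrobenius σ := by
  obtain ⟨ζ', h1, h2⟩ := P.exists_pow_card_ne
  obtain ⟨ζ, rfl⟩ : ∃ ζ : P.Ktilde, (ζ : P.Cinf) = ζ' := ⟨⟨ζ', mem_Ktilde_of_pow_card_sq h1⟩, rfl⟩
  have hζ : ζ ^ Nat.card F ^ 2 = ζ := Subtype.ext h1
  have hζ' : ζ ^ Nat.card F ≠ ζ := fun h => h2 (congrArg Subtype.val h)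
  have hσ : ∀ a, σ (P.constKtilde a) = P.constKtilde a := fun a => σ.commutes _
  obtain ⟨n, t, hnt⟩ := exists_eq_add_mul P.constKtilde hζ hζ' (z := ζ ^ 2) (by
    rw [← pow_mul, mul_comm, pow_mul, hζ])
  have hfr := (pow_card_eq_or_of_quadratic P.constKtilde (ε := ζ) (t := t) (n := -n) (by
    rw [map_neg]; linear_combination hnt)).resolve_left hζ'
  have h3 : (σ ζ - ζ) * (σ ζ - ζ ^ Nat.card F) = 0 := by
    have h4 := congrArg σ hnt
    rw [map_add, map_mul, map_pow, hσ, hσ] at h4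
    rw [hfr]
    linear_combination h4 - hnt
  rcases mul_eq_zero.1 h3 with h4 | h4
  · left
    intro z hz
    obtain ⟨x, y, rfl⟩ := exists_eq_add_mul P.constKtilde hζ hζ' hz
    rw [map_add, map_mul, hσ, hσ, sub_eq_zero.1 h4]
  · right
    intro z hz
    obtain ⟨x, y, rfl⟩ := exists_eq_add_mul P.constKtilde hζ hζ' hz
    rw [map_add, map_mul, hσ, hσ, sub_eq_zero.1 h4, add_pow_card P.constKtilde, mul_pow,
      pow_card_map, pow_card_map]

/-- As `δ` is odd, `F_{q²}` is not contained in `K`. -/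
theorem exists_isFrobenius (hδ : Odd P.degree) : ∃ σ : P.Gal, IsFrobenius σ := by
  by_contra! hne
  obtain ⟨ζ', h1, h2⟩ := P.exists_pow_card_ne
  obtain ⟨ζ, rfl⟩ : ∃ ζ : P.Ktilde, (ζ : P.Cinf) = ζ' := ⟨⟨ζ', mem_Ktilde_of_pow_card_sq h1⟩, rfl⟩
  obtain ⟨hfin, hgal⟩ := P.isGalois_Ktilde
  have h3 : ζ ∈ (⊥ : IntermediateField K P.Ktilde) := (IsGalois.mem_bot_iff_fixed ζ).2 fun σ =>
    (gal_trivial_or_isFrobenius σ).resolve_right (hne σ) ζ (Subtype.ext h1)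
  obtain ⟨x, hx⟩ := IntermediateField.mem_bot.1 h3
  exact notMem_range_of_pow_card_ne hδ h1 h2 ⟨algebraMap K P.Kinf x, congrArg Subtype.val hx⟩

/-! ### The Galois action on elliptic elements -/

theorem Eigen.coe_mem_Ktilde (hK : IsFunctionField F K) {g : P.G} {ω : P.Omega} {ε : P.Cinf}
    (h : Eigen g.1 ω ε) (hns : ∀ a : P.affineRing, g.1 ≠ Matrix.scalar (Fin 2) a) :
    ω.1 ∈ P.Ktilde := by
  have hc : P.affineToCinf (g 1 0) ≠ 0 :=
    (map_ne_zero_iff _ affineToCinf_injective).2 (h.apply_one_zero_ne hns)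
  have h1 : ω.1 = (ε - P.affineToCinf (g 1 1)) / P.affineToCinf (g 1 0) := by
    rw [eq_div_iff hc]
    linear_combination h.2
  rw [h1]
  exact div_mem (sub_mem (mem_Ktilde_of_pow_card_sq (h.pow_card_sq hK))
    (P.Ktilde.algebraMap_mem _)) (P.Ktilde.algebraMap_mem _)

theorem IsElliptic.mem_Ktilde (hK : IsFunctionField F K) {ω : P.Omega} (hω : IsElliptic ω) :
    ω.1 ∈ P.Ktilde := by
  obtain ⟨g, hg, hns⟩ := hω
  exact (eigen_den hg).coe_mem_Ktilde hK hns

/-- If `ω` has eigenvalue `ε` for `g`, then `σ ω` is its fixed point with eigenvalue `σ ε`. -/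
theorem exists_gal_conjugate (hK : IsFunctionField F K) (hδ : Odd P.degree) (σ : P.Gal)
    {ω : P.Omega} (hω : IsElliptic ω) {x : P.Ktilde} (hx : ω.1 = x) :
    ∃ ω' : P.Omega, ω'.1 = σ x ∧ IsElliptic ω' ∧
      MulAction.stabilizer P.G ω = MulAction.stabilizer P.G ω' ∧ (IsFrobenius σ → ω ≠ ω') := by
  obtain ⟨g, hg, hns⟩ := hω
  have he := eigen_den hg
  set ε := den (P.toGLinf g) ω.1
  have hsq := he.pow_card_sq hK
  have hε := he.pow_card_ne hns
  have hmem := mem_Ktilde_of_pow_card_sq hsq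
  by_cases hσ : IsFrobenius σ
  · obtain ⟨ω', he'⟩ := exists_eigen_pow hK hδ hns he
    refine ⟨ω', he.gal_apply_eq he' hns hx (e := ⟨ε, hmem⟩) rfl ?_,
      IsElliptic.of_smul_eq hns he'.smul_eq, stabilizer_eq_of_smul_eq hK hns hg he'.smul_eq, ?_⟩
    · rw [hσ _ (Subtype.ext hsq)]
      rfl
    · rintro - rfl
      exact hε (he'.unique he)
  · refine ⟨ω, he.gal_apply_eq he hns hx (e := ⟨ε, hmem⟩) rfl ?_,
      IsElliptic.of_smul_eq hns hg, rfl, fun h => absurd h hσ⟩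
    rw [(gal_trivial_or_isFrobenius σ).resolve_right hσ _ (Subtype.ext hsq)]

/-- The conjugate `σ ω` of an elliptic element. -/
def galPoint (hK : IsFunctionField F K) (hδ : Odd P.degree) (σ : P.Gal)
    (ω : {ω : P.Omega // IsElliptic ω}) : {ω : P.Omega // IsElliptic ω} :=
  ⟨(exists_gal_conjugate hK hδ σ ω.2 (x := ⟨ω.1.1, ω.2.mem_Ktilde hK⟩) rfl).choose,
    (exists_gal_conjugate hK hδ σ ω.2 (x := ⟨ω.1.1, ω.2.mem_Ktilde hK⟩) rfl).choose_spec.2.1⟩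

section GalPoint

variable (hK : IsFunctionField F K) (hδ : Odd P.degree) (σ : P.Gal)
  (ω : {ω : P.Omega // IsElliptic ω})

theorem coe_galPoint {x : P.Ktilde} (hx : ω.1.1 = x) : (galPoint hK hδ σ ω).1.1 = σ x := by
  obtain rfl : (⟨ω.1.1, ω.2.mem_Ktilde hK⟩ : P.Ktilde) = x := Subtype.ext hx
  exact (exists_gal_conjugate hK hδ σ ω.2 rfl).choose_spec.1

theorem stabilizer_galPoint :
    MulAction.stabilizer P.G ω.1 = MulAction.stabilizer P.G (galPoint hK hδ σ ω).1 :=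
  (exists_gal_conjugate hK hδ σ ω.2 rfl).choose_spec.2.2.1

theorem ne_galPoint (hσ : IsFrobenius σ) : ω.1 ≠ (galPoint hK hδ σ ω).1 :=
  (exists_gal_conjugate hK hδ σ ω.2 rfl).choose_spec.2.2.2 hσ

theorem galPoint_one : galPoint hK hδ 1 ω = ω :=
  Subtype.ext (Subtype.ext (coe_galPoint hK hδ 1 ω (x := ⟨ω.1.1, ω.2.mem_Ktilde hK⟩) rfl))

theorem galPoint_mul (τ : P.Gal) :
    galPoint hK hδ (σ * τ) ω = galPoint hK hδ σ (galPoint hK hδ τ ω) := by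
  refine Subtype.ext (Subtype.ext ?_)
  rw [coe_galPoint hK hδ (σ * τ) ω (x := ⟨ω.1.1, ω.2.mem_Ktilde hK⟩) rfl,
    coe_galPoint hK hδ σ _ (coe_galPoint hK hδ τ ω (x := ⟨ω.1.1, ω.2.mem_Ktilde hK⟩) rfl)]
  rfl

theorem galPoint_smul (u : P.G) :
    (galPoint hK hδ σ ⟨u • ω.1, ω.2.smul u⟩).1 = u • (galPoint hK hδ σ ω).1 := by
  refine Subtype.ext ?_
  obtain ⟨x, hx⟩ : ∃ x : P.Ktilde, ω.1.1 = x := ⟨⟨ω.1.1, ω.2.mem_Ktilde hK⟩, rfl⟩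
  let r : P.affineRing → P.Ktilde := fun a => algebraMap K P.Ktilde a
  have hr : ∀ a, σ (r a) = r a := fun a => σ.commutes _
  have h1 : (u • ω.1).1 = (((r (u 0 0) * x + r (u 0 1)) / (r (u 1 0) * x + r (u 1 1)) :
      P.Ktilde) : P.Cinf) := by
    rw [smul_Omega_def, coe_smul_Omega, num, den, hx]
    rfl
  have h2 : (u • (galPoint hK hδ σ ω).1).1 = (((r (u 0 0) * σ x + r (u 0 1)) /
      (r (u 1 0) * σ x + r (u 1 1)) : P.Ktilde) : P.Cinf) := by
    rw [smul_Omega_def, coe_smul_Omega, num, den, coe_galPoint hK hδ σ ω hx]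
    rfl
  rw [coe_galPoint hK hδ σ ⟨u • ω.1, ω.2.smul u⟩ h1, h2]
  simp only [map_div₀, map_add, map_mul, hr]

end GalPoint

/-- The elliptic elements with the same stabilizer are conjugate. -/
theorem eq_or_eq_galPoint (hK : IsFunctionField F K) (hδ : Odd P.degree) {σ : P.Gal}
    (hσ : IsFrobenius σ) (ω : {ω : P.Omega // IsElliptic ω}) {ω' : P.Omega}
    (h : MulAction.stabilizer P.G ω.1 = MulAction.stabilizer P.G ω') :
    ω' = ω.1 ∨ ω' = (galPoint hK hδ σ ω).1 :=
  eq_or_eq_of_stabilizer_eq hK ω.2 (stabilizer_galPoint hK hδ σ ω) h (ne_galPoint hK hδ σ ω hσ)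

/-- The Galois action on elliptic points, on representatives. -/
def galEll (hK : IsFunctionField F K) (hδ : Odd P.degree) (σ : P.Gal) (c : P.Ell) : P.Ell :=
  mkEll (galPoint hK hδ σ (exists_eq_mkEll c).choose).1 (galPoint hK hδ σ _).2

theorem galEll_mkEll (hK : IsFunctionField F K) (hδ : Odd P.degree) (σ : P.Gal)
    (ω : {ω : P.Omega // IsElliptic ω}) :
    galEll hK hδ σ (mkEll ω.1 ω.2) = mkEll (galPoint hK hδ σ ω).1 (galPoint hK hδ σ ω).2 := by
  have key : ∀ ω' : {ω : P.Omega // IsElliptic ω}, mkEll ω.1 ω.2 = mkEll ω'.1 ω'.2 →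
      mkEll (galPoint hK hδ σ ω').1 (galPoint hK hδ σ ω').2 =
        mkEll (galPoint hK hδ σ ω).1 (galPoint hK hδ σ ω).2 := by
    intro ω' h
    obtain ⟨u, hu⟩ := mkEll_eq_iff.1 h.symm
    refine mkEll_eq_iff.2 ⟨u, ?_⟩
    rw [← galPoint_smul]
    congr 2
    exact Subtype.ext hu
  exact key _ (exists_eq_mkEll (mkEll ω.1 ω.2)).choose_spec

/-- The action of `Gal(K̃/K)` on the elliptic points. -/
abbrev galAction (hK : IsFunctionField F K) (hδ : Odd P.degree) : MulAction P.Gal P.Ell where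
  smul σ c := galEll hK hδ σ c
  one_smul c := by
    obtain ⟨ω, rfl⟩ := exists_eq_mkEll c
    change galEll hK hδ 1 _ = _
    rw [galEll_mkEll]
    simp only [galPoint_one]
  mul_smul σ τ c := by
    obtain ⟨ω, rfl⟩ := exists_eq_mkEll c
    change galEll hK hδ (σ * τ) _ = galEll hK hδ σ (galEll hK hδ τ _)
    rw [galEll_mkEll, galEll_mkEll, galEll_mkEll]
    simp only [galPoint_mul]

theorem galAction_smul_mkEll (hK : IsFunctionField F K) (hδ : Odd P.degree) (σ : P.Gal)
    (ω : {ω : P.Omega // IsElliptic ω}) :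
    (galAction hK hδ).smul σ (mkEll ω.1 ω.2) =
      mkEll (galPoint hK hδ σ ω).1 (galPoint hK hδ σ ω).2 := galEll_mkEll hK hδ σ ω

theorem isGaloisAction_galAction (hK : IsFunctionField F K) (hδ : Odd P.degree) :
    IsGaloisAction (galAction hK hδ) where
  mem_Ktilde _ hω := hω.mem_Ktilde hK
  smul_mk σ _ ω hω hx := ⟨_, (galPoint hK hδ σ ⟨ω, hω⟩).2, coe_galPoint hK hδ σ ⟨ω, hω⟩ hx,
    galAction_smul_mkEll hK hδ σ ⟨ω, hω⟩⟩

/-- Elliptic points are in the same Galois orbit if and only if representatives can be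
chosen with the same stabilizer. -/
theorem exists_galEll_eq_iff (hK : IsFunctionField F K) (hδ : Odd P.degree)
    (ω ω' : {ω : P.Omega // IsElliptic ω}) :
    (∃ σ : P.Gal, galEll hK hδ σ (mkEll ω'.1 ω'.2) = mkEll ω.1 ω.2) ↔
      ∃ u : P.G, MulAction.stabilizer P.G (u • ω.1) = MulAction.stabilizer P.G ω'.1 := by
  constructor
  · rintro ⟨σ, h⟩
    rw [galEll_mkEll] at h
    obtain ⟨u, hu⟩ := mkEll_eq_iff.1 h
    exact ⟨u, by rw [hu, ← stabilizer_galPoint]⟩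
  · rintro ⟨u, hu⟩
    obtain ⟨τ, hτ⟩ := exists_isFrobenius hδ
    rcases eq_or_eq_galPoint hK hδ hτ ω' hu.symm with h | h
    · exact ⟨1, by rw [galEll_mkEll, galPoint_one]; exact mkEll_eq_iff.2 ⟨u, h⟩⟩
    · exact ⟨τ, by rw [galEll_mkEll]; exact mkEll_eq_iff.2 ⟨u, h⟩⟩

end Place
end Drinfeld

namespace Drinfeld

/-- Surjections with the same fibres identify their targets. -/
theorem exists_equiv_of_surjective {X Y Z : Type*} {f : X → Y} {g : X → Z}
    (hf : Function.Surjective f) (hg : Function.Surjective g)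
    (h : ∀ x x', f x = f x' ↔ g x = g x') : ∃ e : Y ≃ Z, ∀ x, e (f x) = g x := by
  have h1 : ∀ x, g (Function.surjInv hf (f x)) = g x := fun x =>
    (h _ _).1 (Function.surjInv_eq hf (f x))
  refine ⟨Equiv.ofBijective (fun y => g (Function.surjInv hf y)) ⟨fun y y' hy => ?_, fun z => ?_⟩,
    h1⟩
  · have := (h _ _).2 hy
    rwa [Function.surjInv_eq hf, Function.surjInv_eq hf] at this
  · obtain ⟨x, rfl⟩ := hg z
    exact ⟨f x, h1 x⟩

namespace Place

variable {F K : Type*} [Field F] [Field K] [Algebra F K] {P : Place F K}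

/-! ### The points above a vertex -/

theorem mkVertexQuot_eq_iff {v v' : P.Vertex} :
    P.mkVertexQuot v = P.mkVertexQuot v' ↔ ∃ u : P.G, u • v = v' :=
  eq_comm.trans
    (Quotient.eq.trans (MulAction.orbitRel_apply.trans MulAction.mem_orbit_iff))

theorem liesOver_iff {ω : P.Omega} {v : P.Vertex} :
    LiesOver (P.mkOmega ω) (P.mkVertexQuot v) ↔ ∃ u : P.G, BuildingMapsTo (u • ω) v := by
  constructor
  · rintro ⟨ω', v', h1, h2, hb⟩
    obtain ⟨u, rfl⟩ := mkOmega_eq_iff.1 h1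
    obtain ⟨k, rfl⟩ := mkVertexQuot_eq_iff.1 h2
    exact ⟨k * u, by rw [mul_smul]; exact hb.smul_G k⟩
  · rintro ⟨u, hb⟩
    exact ⟨u • ω, v, mkOmega_eq_iff.2 ⟨u, rfl⟩, rfl, hb⟩

theorem mkGood_eq_iff {v v' : P.Vertex} {hv : IsGoodVertex v} {hv' : IsGoodVertex v'} :
    mkGood v hv = mkGood v' hv' ↔ ∃ u : P.G, u • v = v' :=
  Subtype.ext_iff.trans mkVertexQuot_eq_iff

theorem eq_mkEll_of_liesOver {c : P.Ell} {v : P.Vertex} (h : LiesOver c.1 (P.mkVertexQuot v)) :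
    ∃ (ω : P.Omega) (hω : IsElliptic ω), c = mkEll ω hω ∧ BuildingMapsTo ω v := by
  obtain ⟨ω, rfl⟩ := exists_eq_mkEll c
  obtain ⟨u, hu⟩ := liesOver_iff.1 h
  exact ⟨u • ω.1, ω.2.smul u, mkEll_eq_iff.2 ⟨u⁻¹, inv_smul_smul u ω.1⟩, hu⟩

theorem BuildingMapsTo.liesOver {ω : P.Omega} {v : P.Vertex} (h : BuildingMapsTo ω v) :
    LiesOver (P.mkOmega ω) (P.mkVertexQuot v) := ⟨ω, v, rfl, rfl, h⟩

variable [Finite F]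

/-- Translating `F_{q²}` by the elements of the open unit ball of `K_∞` gives uncountably many
points above the standard vertex. -/
theorem not_countable_liesOver (hK : IsFunctionField F K) (hδ : Odd P.degree) (v : P.Vertex) :
    ¬ {c : P.OmegaQuot | LiesOver c (P.mkVertexQuot v)}.Countable := by
  intro hc
  obtain ⟨h, rfl⟩ := exists_eq_smul_stdVertex v
  obtain ⟨ζ, h1, h2⟩ := P.exists_pow_card_ne
  have hcountG := countable_G (P := P) hK
  -- the points `h (ζ + y)` with `|y| < 1` lie above the vertex
  let p : P.Kinf → P.Omega := fun y => ⟨ζ + algebraMap P.Kinf P.Cinf y, by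
    rintro ⟨z, hz⟩
    exact notMem_range_of_pow_card_ne hδ h1 h2 ⟨z - y, by rw [map_sub, hz, add_sub_cancel_right]⟩⟩
  have hp : Function.Injective p := fun y y' hy =>
    (algebraMap P.Kinf P.Cinf).injective (add_left_cancel (congrArg Subtype.val hy))
  have hb : ∀ y : P.Kinf, ‖y‖ < 1 → BuildingMapsTo (p y) P.stdVertex := fun y hy =>
    ⟨P.stdLattice, rfl, fun x => by
      have e1 : algebraMap P.Kinf P.Cinf (x 0) * (p y).1 + algebraMap P.Kinf P.Cinf (x 1) =
          algebraMap P.Kinf P.Cinf (x 0) * ζ + algebraMap P.Kinf P.Cinf (x 0 * y + x 1) := by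
        simp only [p, map_add, map_mul]
        ring
      have e2 : ‖x 0 * y‖ ≤ ‖x 0‖ := by
        rw [norm_mul]
        exact mul_le_of_le_one_right (norm_nonneg _) hy.le
      rw [e1, norm_mul_add_eq_max hδ h1 h2, latticeNorm_stdLattice, norm_eq_max]
      refine le_antisymm (max_le (le_max_left _ _) ?_) (max_le (le_max_left _ _) ?_)
      · exact (IsUltrametricDist.norm_add_le_max _ _).trans (max_le_max_right _ e2)
      · have e3 : x 1 = (x 0 * y + x 1) + -(x 0 * y) := by ring
        have e4 := IsUltrametricDist.norm_add_le_max (x 0 * y + x 1) (-(x 0 * y))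
        rw [← e3, norm_neg] at e4
        exact e4.trans (max_le (le_max_right _ _) (e2.trans (le_max_left _ _)))⟩
  -- the orbits of `G` are countable
  have hball : (Metric.ball (0 : P.Kinf) 1).Countable := by
    refine (hc.biUnion (t := fun c _ => {y | P.mkOmega (h • p y) = c}) fun c _ => ?_).mono ?_
    · rcases Set.eq_empty_or_nonempty {y | P.mkOmega (h • p y) = c} with h0 | ⟨y₀, rfl⟩
      · rw [h0]
        exact Set.countable_empty
      · refine ((Set.countable_range fun u : P.G => u • h • p y₀).preimage
          ((MulAction.injective h).comp hp)).mono ?_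
        intro y hy
        exact mkOmega_eq_iff.1 hy
    · intro y hy
      refine Set.mem_biUnion (x := P.mkOmega (h • p y)) ?_ rfl
      refine liesOver_iff.2 ⟨1, ?_⟩
      rw [one_smul]
      exact (hb y (by simpa using hy)).smul h
  have hcard := continuum_le_cardinal_of_isOpen P.Kinf
    (Metric.isOpen_ball (x := (0 : P.Kinf)) (ε := 1)) ⟨0, Metric.mem_ball_self one_pos⟩
  exact absurd (Cardinal.le_aleph0_iff_set_countable.2 hball)
    (not_le.2 (Cardinal.aleph0_lt_continuum.trans_le hcard))

/-! ### The maps from elliptic elements to the three sets -/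

/-- The vertex `λ(ω)` of an elliptic element. -/
def buildingVertex (hK : IsFunctionField F K) (hδ : Odd P.degree)
    (ω : {ω : P.Omega // IsElliptic ω}) : P.Vertex := (exists_buildingMapsTo hK hδ ω.2).choose

theorem buildingMapsTo_buildingVertex (hK : IsFunctionField F K) (hδ : Odd P.degree)
    (ω : {ω : P.Omega // IsElliptic ω}) :
    BuildingMapsTo ω.1 (buildingVertex hK hδ ω) := (exists_buildingMapsTo hK hδ ω.2).choose_spec

/-- The vertex of `G \ T` below an elliptic element. -/
def goodVertexOfElliptic (hK : IsFunctionField F K) (hδ : Odd P.degree)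
    (ω : {ω : P.Omega // IsElliptic ω}) : P.GoodVertexQuot :=
  mkGood (buildingVertex hK hδ ω) ((buildingMapsTo_buildingVertex hK hδ ω).isGoodVertex hK hδ ω.2)

/-- The stabilizer of an elliptic element. -/
def cyclicOfElliptic (hK : IsFunctionField F K)
    (ω : {ω : P.Omega // IsElliptic ω}) : P.CyclicSub :=
  ⟨MulAction.stabilizer P.G ω.1, isCyclic_stabilizer hK ω.2, card_stabilizer hK ω.2⟩

theorem exists_goodVertexOfElliptic_eq (hK : IsFunctionField F K) (hδ : Odd P.degree)
    {v : P.Vertex} (hv : IsGoodVertex v) :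
    ∃ ω, goodVertexOfElliptic hK hδ ω = mkGood v hv := by
  obtain ⟨ω, hω, hb⟩ := hv.exists_isElliptic hK hδ
  exact ⟨⟨ω, hω⟩, mkGood_eq_iff.2
    ⟨1, by rw [one_smul, (buildingMapsTo_buildingVertex hK hδ ⟨ω, hω⟩).unique hb]⟩⟩

theorem exists_cyclicOfElliptic_eq (hK : IsFunctionField F K) (hδ : Odd P.degree)
    (C : P.CyclicSub) : ∃ ω, cyclicOfElliptic hK ω = C := by
  obtain ⟨ω, hω, h⟩ := exists_eq_stabilizer hδ hK C
  exact ⟨⟨ω, hω⟩, Subtype.ext h.symm⟩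

theorem goodVertexOfElliptic_eq_iff (hK : IsFunctionField F K) (hδ : Odd P.degree)
    (ω ω' : {ω : P.Omega // IsElliptic ω}) :
    goodVertexOfElliptic hK hδ ω = goodVertexOfElliptic hK hδ ω' ↔
      ∃ u : P.G, MulAction.stabilizer P.G (u • ω.1) = MulAction.stabilizer P.G ω'.1 := by
  have hb := buildingMapsTo_buildingVertex hK hδ ω
  have hb' := buildingMapsTo_buildingVertex hK hδ ω'
  refine mkGood_eq_iff.trans ⟨?_, ?_⟩
  · rintro ⟨u, hu⟩
    have h1 := hb.smul_G u
    rw [hu] at h1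
    rcases exists_smul_eq_or_stabilizer_eq hK (ω.2.smul u) ω'.2 h1 hb' with ⟨k, hk⟩ | h2
    · exact ⟨k * u, by rw [mul_smul, hk]⟩
    · exact ⟨u, h2⟩
  · rintro ⟨u, hu⟩
    exact ⟨u, ((hb.smul_G u).of_stabilizer_eq hK hδ (ω.2.smul u) hu).unique hb'⟩

theorem mkCyclic_cyclicOfElliptic_eq_iff (hK : IsFunctionField F K)
    (ω ω' : {ω : P.Omega // IsElliptic ω}) :
    mkCyclic (cyclicOfElliptic hK ω) = mkCyclic (cyclicOfElliptic hK ω') ↔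
      ∃ u : P.G, MulAction.stabilizer P.G (u • ω.1) = MulAction.stabilizer P.G ω'.1 := by
  refine Quotient.eq.trans (exists_congr fun u => ?_)
  rw [MulAction.stabilizer_smul_eq_stabilizer_map_conj, eq_comm]
  rfl

theorem orbit_mkEll_eq_iff (hK : IsFunctionField F K) (hδ : Odd P.degree)
    (ω ω' : {ω : P.Omega // IsElliptic ω}) :
    letI := galAction (P := P) hK hδ
    (Quotient.mk _ (mkEll ω.1 ω.2) : MulAction.orbitRel.Quotient P.Gal P.Ell) =
        Quotient.mk _ (mkEll ω'.1 ω'.2) ↔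
      ∃ u : P.G, MulAction.stabilizer P.G (u • ω.1) = MulAction.stabilizer P.G ω'.1 := by
  let := galAction (P := P) hK hδ
  exact (Quotient.eq.trans (MulAction.orbitRel_apply.trans MulAction.mem_orbit_iff)).trans
    (exists_galEll_eq_iff hK hδ ω ω')

end Place
end Drinfeld

end

theorem theorem3p8 {F K : Type*} [Field F] [Finite F] [Field K] [Algebra F K]
    (hK : Drinfeld.IsFunctionField F K) (P : Drinfeld.Place F K) (hδ : Odd P.degree) :
    ∃ act : MulAction P.Gal P.Ell, Drinfeld.Place.IsGaloisAction act ∧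
      -- the bijections between the three sets
      (∃ (e₁ : P.GoodVertexQuot ≃ P.CyclicClasses)
          (e₂ : P.CyclicClasses ≃ MulAction.orbitRel.Quotient P.Gal P.Ell),
        -- `ṽ` corresponds to the class of `C` when `C` fixes a vertex above `ṽ`
        (∀ (v : P.Vertex) (hv : Drinfeld.Place.IsGoodVertex v) (C : P.CyclicSub),
          e₁ (Drinfeld.Place.mkGood v hv) = Drinfeld.Place.mkCyclic C ↔
            ∃ g : P.G, C.1 ≤ MulAction.stabilizer P.G (g • v)) ∧
        -- the class of `C` corresponds to the orbit of `ω` when `C` is conjugate to `G_ω`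
        (∀ (C : P.CyclicSub) (ω : P.Omega) (hω : Drinfeld.Place.IsElliptic ω),
          e₂ (Drinfeld.Place.mkCyclic C) =
              (Quotient.mk _ (Drinfeld.Place.mkEll ω hω) :
                MulAction.orbitRel.Quotient P.Gal P.Ell) ↔
            ∃ g : P.G, C.1 = MulAction.stabilizer P.G (g • ω)) ∧
        -- `ṽ` corresponds to the orbit of `ω` when the building map sends `ω` above `ṽ`
        (∀ (v : P.Vertex) (hv : Drinfeld.Place.IsGoodVertex v)
            (ω : P.Omega) (hω : Drinfeld.Place.IsElliptic ω),
          e₂ (e₁ (Drinfeld.Place.mkGood v hv)) =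
              (Quotient.mk _ (Drinfeld.Place.mkEll ω hω) :
                MulAction.orbitRel.Quotient P.Gal P.Ell) ↔
            ∃ g : P.G, Drinfeld.Place.BuildingMapsTo ω (g • v))) ∧
      -- the points of `G \ Ω` above a vertex `ṽ` of `G \ T`
      (∀ v : P.Vertex,
        ¬ {c : P.OmegaQuot | Drinfeld.Place.LiesOver c (P.mkVertexQuot v)}.Countable ∧
        (Drinfeld.Place.IsGoodVertex v →
          Nonempty (MulAction.stabilizer P.G v ≃* GL (Fin 2) F) ∨
            Nonempty (MulAction.stabilizer P.G v ≃* (Drinfeld.Fq2 F)ˣ)) ∧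
        (Nonempty (MulAction.stabilizer P.G v ≃* GL (Fin 2) F) →
          ∃! c : P.Ell, Drinfeld.Place.LiesOver c.1 (P.mkVertexQuot v)) ∧
        (Nonempty (MulAction.stabilizer P.G v ≃* (Drinfeld.Fq2 F)ˣ) →
          ∃ (c : P.Ell) (σ : P.Gal), σ • c ≠ c ∧
            ∀ d : P.Ell, Drinfeld.Place.LiesOver d.1 (P.mkVertexQuot v) ↔
              d = c ∨ d = σ • c) ∧
        (¬ Nonempty (MulAction.stabilizer P.G v ≃* GL (Fin 2) F) →
          ¬ Nonempty (MulAction.stabilizer P.G v ≃* (Drinfeld.Fq2 F)ˣ) →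
          ∀ d : P.Ell, ¬ Drinfeld.Place.LiesOver d.1 (P.mkVertexQuot v))) := by
  open Drinfeld Drinfeld.Place in
  let act := galAction (P := P) hK hδ
  refine ⟨act, isGaloisAction_galAction hK hδ, ?_, fun v =>
    ⟨not_countable_liesOver hK hδ v, fun hv => hv.nonempty_mulEquiv hK hδ, ?_, ?_, ?_⟩⟩
  · obtain ⟨e₁, he₁⟩ := exists_equiv_of_surjective (f := goodVertexOfElliptic (P := P) hK hδ)
      (g := fun ω => mkCyclic (cyclicOfElliptic hK ω))
      (by
        rintro ⟨_, v, hv, rfl⟩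
        exact exists_goodVertexOfElliptic_eq hK hδ hv)
      (fun c => Quotient.inductionOn c fun C =>
        (exists_cyclicOfElliptic_eq hK hδ C).imp fun _ h => congrArg mkCyclic h)
      (fun ω ω' => (goodVertexOfElliptic_eq_iff hK hδ ω ω').trans
        (mkCyclic_cyclicOfElliptic_eq_iff hK ω ω').symm)
    obtain ⟨e₂, he₂⟩ := exists_equiv_of_surjective
      (f := fun ω => mkCyclic (P := P) (cyclicOfElliptic hK ω))
      (g := fun ω => (Quotient.mk _ (mkEll ω.1 ω.2) : MulAction.orbitRel.Quotient P.Gal P.Ell))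
      (fun c => Quotient.inductionOn c fun C =>
        (exists_cyclicOfElliptic_eq hK hδ C).imp fun _ h => congrArg mkCyclic h)
      (fun c => Quotient.inductionOn c fun c =>
        (exists_eq_mkEll c).imp fun _ h => congrArg _ h.symm)
      (fun ω ω' => (mkCyclic_cyclicOfElliptic_eq_iff hK ω ω').trans
        (orbit_mkEll_eq_iff hK hδ ω ω').symm)
    refine ⟨e₁, e₂, fun v hv C => ?_, fun C ω hω => ?_, fun v hv ω hω => ?_⟩
    · obtain ⟨ω, hω⟩ := exists_goodVertexOfElliptic_eq hK hδ hv
      obtain ⟨ω', rfl⟩ := exists_cyclicOfElliptic_eq hK hδ C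
      rw [← hω, he₁, mkCyclic_cyclicOfElliptic_eq_iff, ← goodVertexOfElliptic_eq_iff hK hδ, hω]
      refine mkGood_eq_iff.trans (exists_congr fun u => ?_)
      have hb := buildingMapsTo_buildingVertex hK hδ ω'
      constructor
      · intro h
        rw [h]
        exact hb.stabilizer_le
      · intro h
        obtain ⟨g, hg, hns⟩ := ω'.2
        exact (hb.eq_of_smul_eq hK hδ hns hg (h hg)).symm
    · obtain ⟨ω', rfl⟩ := exists_cyclicOfElliptic_eq hK hδ C
      rw [he₂, eq_comm, orbit_mkEll_eq_iff hK hδ ⟨ω, hω⟩ ω']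
      exact exists_congr fun u => eq_comm
    · obtain ⟨ω', hω'⟩ := exists_goodVertexOfElliptic_eq hK hδ hv
      rw [← hω', he₁, he₂, orbit_mkEll_eq_iff hK hδ ω' ⟨ω, hω⟩,
        ← goodVertexOfElliptic_eq_iff hK hδ, hω']
      have hb := buildingMapsTo_buildingVertex hK hδ ⟨ω, hω⟩
      refine mkGood_eq_iff.trans (exists_congr fun u => ⟨fun h => ?_, fun h => h.unique hb⟩)
      rw [h]
      exact hb
  · rintro ⟨e⟩
    obtain ⟨ω, hω, hb⟩ := (isGoodVertex_of_mulEquiv_GL hK hδ e).exists_isElliptic hK hδ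
    refine ⟨mkEll ω hω, hb.liesOver, fun d hd => ?_⟩
    obtain ⟨ω', hω', rfl, hb'⟩ := eq_mkEll_of_liesOver hd
    exact mkEll_eq_iff.2 (exists_smul_eq_of_mulEquiv_GL hK e hω hω' hb hb')
  · rintro ⟨e⟩
    obtain ⟨ω, hω, hb⟩ := (isGoodVertex_of_mulEquiv_units hK hδ e).exists_isElliptic hK hδ
    obtain ⟨σ, hσ⟩ := exists_isFrobenius (P := P) hδ
    have hst := stabilizer_galPoint hK hδ σ ⟨ω, hω⟩
    have hb' := hb.of_stabilizer_eq hK hδ hω hst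
    have hsmul : σ • mkEll ω hω = mkEll _ (galPoint hK hδ σ ⟨ω, hω⟩).2 :=
      galAction_smul_mkEll hK hδ σ ⟨ω, hω⟩
    refine ⟨mkEll ω hω, σ, ?_, fun d => ⟨fun hd => ?_, ?_⟩⟩
    · rw [hsmul]
      intro h
      obtain ⟨u, hu⟩ := mkEll_eq_iff.1 h
      exact ne_galPoint hK hδ σ ⟨ω, hω⟩ hσ (eq_of_smul_eq_of_mulEquiv_units hK hδ e hω hb hb' hu)
    · obtain ⟨ω', hω', rfl, hb''⟩ := eq_mkEll_of_liesOver hd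
      rw [hsmul]
      rcases exists_smul_eq_or_stabilizer_eq hK hω hω' hb hb'' with h | h
      · exact Or.inl (mkEll_eq_iff.2 h)
      · refine (eq_or_eq_galPoint hK hδ hσ ⟨ω, hω⟩ h).imp ?_ ?_ <;>
          exact fun h => mkEll_eq_iff.2 ⟨1, by rw [one_smul, h]⟩
    · rw [hsmul]
      rintro (rfl | rfl)
      · exact hb.liesOver
      · exact hb'.liesOver
  · intro h1 h2 d hd
    obtain ⟨ω, hω, -, hb⟩ := eq_mkEll_of_liesOver hd
    exact ((hb.isGoodVertex hK hδ hω).nonempty_mulEquiv hK hδ).elim h1 h2
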